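/- \textbf{Setting.} Let $\bar A\in\{0,1\}^{n\times n}$ be the structural pattern of the linear system $x[t+1]=Ax[t]+Bu[t]$, $y[t]=Cx[t]$; a real matrix has pattern $\bar M$ if it vanishes wherever $\bar M$ does. Assume A1: the state bipartite graph of $\bar A$ (left and right copies of the states, an edge from $x_i$ to $x_j$ if $\bar A_{ji}\neq0$) has a perfect matching. Let $b=(b_1,\dots,b_p)$ and $c=(c_1,\dots,c_m)$ be minimum collections of state indices such that dedicated actuators at the states $b_i$ (input pattern $\bar B$) and dedicated sensors at the states $c_j$ (output pattern $\bar C$) make $(\bar A,\bar B)$ structurally controllable and $(\bar A,\bar C)$ structurally observable (some real pair with these patterns is controllable, respectively observable). An information pattern is a set $\mathcal K$ of links (sensor $j$, actuator $i$). For a set $\mathcal J\subseteq\mathcal K$ of failed links, the fixed modes of $(A,B,C)$ are $\bigcap_G\sigma(A+BGC)$, over all $G\in\mathbb R^{p\times m}$ with $G_{ij}=0$ unless $(j,i)\in\mathcal K\setminus\mathcal J$. For $k\ge0$, the pattern $\mathcal K$ has structurally fixed modes under at most $k$ failures if for almost all $(A,B,C)$ with patterns $(\bar A,\bar B,\bar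 C)$ the union of these sets over all $\mathcal J\subseteq\mathcal K$ with $|\mathcal J|\le k$ is nonempty; otherwise $\mathcal K$ is called $k$-resilient. A sparsest $k$-resilient pattern is one with the fewest links. \textbf{Procedure 1.} Take a maximum matching $M=\{(i_1,j_1),\dots,(i_r,j_r)\}$ of the bipartite graph of pairs (actuator $i$, sensor $j$) such that there is a path from $i$ to $j$ in the system digraph. Take the sequential pairing, i.e. the links from sensor $j_{l-1}$ to actuator $i_l$ for $2\le l\le r$ and from $j_r$ to $i_1$. If $p\le m$, add $m-p$ further links, one from each sensor not in $M$, each to an arbitrary actuator; dually, if $m\le p$, add $p-m$ further links, one into each actuator not in $M$, each from an arbitrary sensor. (For these counts to be correct, $|M|=\min\{p,m\}$; the procedure yields a pattern only then.) \textbf{Theorem 3.} (i) If $\mathcal K^{(1)},\dots,\mathcal K^{(k+1)}$ are pairwise disjoint outcomes of Procedure 1, then $\mathcal K^*=\mathcal K^{(1)}\cup\dots\cup\mathcal K^{(k+1)}$ is a sparsest $k$-resilient information pattern. Moreover, almost all $(A,B,C)$ with patterns $(\bar A,\bar B,\bar C)$ have no fixed mode with respect to $\mathcal K^*$ under any set of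 failures $\mathcal J\subseteq\mathcal K^*$ with $|\mathcal J|\le k$. (ii) There is a program for a random access machine (unit-cost tests, copies, array accesses, successor and predecessor on natural numbers) that, given the adjacency lists of $\bar A$ with $n\ge1$, the collections $b$ and $c$, and $k$, such that $k+1$ pairwise disjoint outcomes of Procedure 1 exist, determines a sparsest $k$-resilient information pattern in polynomial time, more precisely in $\mathcal O\big((k+1)\max\{|\mathcal V|+|\mathcal E|,\,(p+m)^{5/2}\}\big)$ steps, where $|\mathcal V|$ and $|\mathcal E|$ are the numbers of vertices and edges of the system digraph $\mathcal D(\bar A,\bar B,\bar C)$. -/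

import Mathlib

namespace ResilientControl

open MeasureTheory

/-! ### Structural patterns, realizations, controllability, observability -/

/-- The real matrix with sparsity pattern `P` whose free entries are the parameters `θ`.
As `θ` varies, it runs through all real matrices that vanish wherever `P` does. -/
def realization {α β : Type*} (P : Matrix α β Bool)
    (θ : {e : α × β // P e.1 e.2 = true} → ℝ) : Matrix α β ℝ :=
  Matrix.of fun i j => if h : P i j = true then θ ⟨(i, j), h⟩ else 0

/-- The Kalman controllability matrix `[B, AB, …, A^(n-1) B]`. -/
def controllabilityMatrix {n p : ℕ} (A : Matrix (Fin n) (Fin n) ℝ) (B : Matrix (Fin n) (Fin p) ℝ) :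
    Matrix (Fin n) (Fin n × Fin p) ℝ :=
  Matrix.of fun i q => (A ^ (q.1 : ℕ) * B) i q.2

/-- The Kalman observability matrix with block rows `C, CA, …, C A^(n-1)`. -/
def observabilityMatrix {n m : ℕ} (A : Matrix (Fin n) (Fin n) ℝ) (C : Matrix (Fin m) (Fin n) ℝ) :
    Matrix (Fin n × Fin m) (Fin n) ℝ :=
  Matrix.of fun q i => (C * A ^ (q.1 : ℕ)) q.2 i

def Controllable {n p : ℕ} (A : Matrix (Fin n) (Fin n) ℝ) (B : Matrix (Fin n) (Fin p) ℝ) : Prop :=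
  (controllabilityMatrix A B).rank = n

def Observable {n m : ℕ} (A : Matrix (Fin n) (Fin n) ℝ) (C : Matrix (Fin m) (Fin n) ℝ) : Prop :=
  (observabilityMatrix A C).rank = n

/-- Some pair with the given sparsity pattern is controllable. -/
def StructurallyControllable {n p : ℕ} (Abar : Matrix (Fin n) (Fin n) Bool)
    (Bbar : Matrix (Fin n) (Fin p) Bool) : Prop :=
  ∃ θA θB, Controllable (realization Abar θA) (realization Bbar θB)

/-- Some pair with the given sparsity pattern is observable. -/
def StructurallyObservable {n m : ℕ} (Abar : Matrix (Fin n) (Fin n) Bool)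
    (Cbar : Matrix (Fin m) (Fin n) Bool) : Prop :=
  ∃ θA θC, Observable (realization Abar θA) (realization Cbar θC)

/-- The input pattern of a collection `b` of dedicated actuators: actuator `j` acts on the single
state variable `b j` (several actuators may act on the same variable). -/
def inputPattern {n p : ℕ} (b : Fin p → Fin n) : Matrix (Fin n) (Fin p) Bool :=
  Matrix.of fun i j => decide (b j = i)

/-- The output pattern of a collection `c` of dedicated sensors: sensor `j` measures the single
state variable `c j`. -/
def outputPattern {n m : ℕ} (c : Fin m → Fin n) : Matrix (Fin m) (Fin n) Bool :=
  Matrix.of fun j i => decide (c j = i)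

/-- A collection of dedicated actuators of minimum size among those that ensure structural
controllability. -/
def IsMinimumActuation {n p : ℕ} (Abar : Matrix (Fin n) (Fin n) Bool) (b : Fin p → Fin n) : Prop :=
  StructurallyControllable Abar (inputPattern b) ∧
    ∀ (p' : ℕ) (b' : Fin p' → Fin n), StructurallyControllable Abar (inputPattern b') → p ≤ p'

/-- A collection of dedicated sensors of minimum size among those that ensure structural
observability. -/
def IsMinimumSensing {n m : ℕ} (Abar : Matrix (Fin n) (Fin n) Bool) (c : Fin m → Fin n) : Prop :=
  StructurallyObservable Abar (outputPattern c) ∧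
    ∀ (m' : ℕ) (c' : Fin m' → Fin n), StructurallyObservable Abar (outputPattern c') → m ≤ m'

/-- The state bipartite graph, with an edge from the left copy of `x_i` to the right copy of `x_j`
whenever `Abar j i` is nonzero, has a perfect matching. -/
def HasPerfectStateMatching {n : ℕ} (Abar : Matrix (Fin n) (Fin n) Bool) : Prop :=
  ∃ σ : Equiv.Perm (Fin n), ∀ i, Abar (σ i) i = true

/-! ### Fixed modes

A communication link is a pair (sensor, actuator); an information pattern is a set of links. -/

/-- The gains that use only links of `K` that are not in the set `Γ` of failed links. -/
def admissibleGains {p m : ℕ} (K Γ : Finset (Fin m × Fin p)) : Set (Matrix (Fin p) (Fin m) ℝ) :=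
  {G | ∀ (i : Fin p) (j : Fin m), ((j, i) ∉ K ∨ (j, i) ∈ Γ) → G i j = 0}

/-- The set of resilient fixed modes under the collection `F` of possible failures. -/
def resilientFixedModes {n p m : ℕ} (A : Matrix (Fin n) (Fin n) ℝ) (B : Matrix (Fin n) (Fin p) ℝ)
    (C : Matrix (Fin m) (Fin n) ℝ) (K : Finset (Fin m × Fin p))
    (F : Set (Finset (Fin m × Fin p))) : Set ℂ :=
  ⋃ Γ ∈ F, ⋂ G ∈ admissibleGains K Γ, spectrum ℂ ((A + B * G * C).map Complex.ofReal)

/-- The free parameters of a structural system, a Euclidean space with its Lebesgue measure. -/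
abbrev Parameters {n p m : ℕ} (Abar : Matrix (Fin n) (Fin n) Bool)
    (Bbar : Matrix (Fin n) (Fin p) Bool) (Cbar : Matrix (Fin m) (Fin n) Bool) : Type :=
  ({e : Fin n × Fin n // Abar e.1 e.2 = true} → ℝ) ×
    ({e : Fin n × Fin p // Bbar e.1 e.2 = true} → ℝ) ×
      ({e : Fin m × Fin n // Cbar e.1 e.2 = true} → ℝ)

/-- The resilient fixed modes of the realization with parameters `θ`. -/
def fixedModesAt {n p m : ℕ} {Abar : Matrix (Fin n) (Fin n) Bool}
    {Bbar : Matrix (Fin n) (Fin p) Bool} {Cbar : Matrix (Fin m) (Fin n) Bool}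
    (θ : Parameters Abar Bbar Cbar) (K : Finset (Fin m × Fin p))
    (F : Set (Finset (Fin m × Fin p))) : Set ℂ :=
  resilientFixedModes (realization Abar θ.1) (realization Bbar θ.2.1) (realization Cbar θ.2.2) K F

/-- Almost all realizations have a resilient fixed mode. -/
def HasStructurallyResilientFixedModes {n p m : ℕ} (Abar : Matrix (Fin n) (Fin n) Bool)
    (Bbar : Matrix (Fin n) (Fin p) Bool) (Cbar : Matrix (Fin m) (Fin n) Bool)
    (K : Finset (Fin m × Fin p)) (F : Set (Finset (Fin m × Fin p))) : Prop :=
  ∀ᵐ θ : Parameters Abar Bbar Cbar, (fixedModesAt θ K F).Nonempty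

/-- All sets of at most `k` failing links of `K`. -/
def failures {p m : ℕ} (k : ℕ) (K : Finset (Fin m × Fin p)) : Set (Finset (Fin m × Fin p)) :=
  {J | J ⊆ K ∧ J.card ≤ k}

/-- With the dedicated actuators `b` and sensors `c`, the information pattern `K` leaves no
structurally fixed modes, whichever at most `k` of its links fail. -/
def IsResilient {n p m : ℕ} (Abar : Matrix (Fin n) (Fin n) Bool) (b : Fin p → Fin n)
    (c : Fin m → Fin n) (k : ℕ) (K : Finset (Fin m × Fin p)) : Prop :=
  ¬ HasStructurallyResilientFixedModes Abar (inputPattern b) (outputPattern c) K (failures k K)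

/-- A resilient information pattern with the least number of links. -/
def IsSparsestResilient {n p m : ℕ} (Abar : Matrix (Fin n) (Fin n) Bool) (b : Fin p → Fin n)
    (c : Fin m → Fin n) (k : ℕ) (K : Finset (Fin m × Fin p)) : Prop :=
  IsResilient Abar b c k K ∧
    ∀ K' : Finset (Fin m × Fin p), IsResilient Abar b c k K' → K.card ≤ K'.card

/-! ### The system digraph and the pairing procedure -/

/-- Vertices of the system digraph: states, inputs, outputs. -/
inductive Vertex (n p m : ℕ) : Type
  | state (i : Fin n)
  | input (i : Fin p)
  | output (j : Fin m)

/-- Edges of the system digraph. -/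
inductive SystemEdge {n p m : ℕ} (Abar : Matrix (Fin n) (Fin n) Bool)
    (Bbar : Matrix (Fin n) (Fin p) Bool) (Cbar : Matrix (Fin m) (Fin n) Bool) :
    Vertex n p m → Vertex n p m → Prop
  | stateState (i j : Fin n) (h : Abar j i = true) :
      SystemEdge Abar Bbar Cbar (.state i) (.state j)
  | inputState (j : Fin p) (i : Fin n) (h : Bbar i j = true) :
      SystemEdge Abar Bbar Cbar (.input j) (.state i)
  | stateOutput (i : Fin n) (j : Fin m) (h : Cbar j i = true) :
      SystemEdge Abar Bbar Cbar (.state i) (.output j)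

/-- There is a path from dedicated actuator `i` to dedicated sensor `j`. -/
def Reaches {n p m : ℕ} (Abar : Matrix (Fin n) (Fin n) Bool) (b : Fin p → Fin n)
    (c : Fin m → Fin n) (i : Fin p) (j : Fin m) : Prop :=
  Relation.TransGen (SystemEdge Abar (inputPattern b) (outputPattern c)) (.input i) (.output j)

/-- A set of edges of the bipartite graph `E`, no two of which have a vertex in common. -/
def IsMatching {p m : ℕ} (E : Fin p → Fin m → Prop) (M : Finset (Fin p × Fin m)) : Prop :=
  (∀ e ∈ M, E e.1 e.2) ∧
    ∀ e ∈ M, ∀ e' ∈ M, (e.1 = e'.1 ∨ e.2 = e'.2) → e = e'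

/-- A matching with the largest number of edges. -/
def IsMaximumMatching {p m : ℕ} (E : Fin p → Fin m → Prop) (M : Finset (Fin p × Fin m)) : Prop :=
  IsMatching E M ∧ ∀ M' : Finset (Fin p × Fin m), IsMatching E M' → M'.card ≤ M.card

/-- For the edges `(i 0, j 0), …, (i (r-1), j (r-1))` of a matching: the links from sensor `j l`
to actuator `i (l + 1)`, and from the last sensor to the first actuator. -/
def sequentialPairing {p m r : ℕ} (i : Fin r → Fin p) (j : Fin r → Fin m) :
    Finset (Fin m × Fin p) :=
  Finset.univ.image fun l : Fin r => (j l, i (finRotate r l))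

/-- `K` is a sequential pairing induced by the matching `M`, for some enumeration of `M`. -/
def IsSequentialPairing {p m : ℕ} (M : Finset (Fin p × Fin m)) (K : Finset (Fin m × Fin p)) :
    Prop :=
  ∃ e : Fin M.card ≃ M, K = sequentialPairing (fun l => (e l).1.1) (fun l => (e l).1.2)

/-- The additional links when there are at least as many sensors as actuators: `m - p` links,
one from each sensor not in the matching `M`, ending in an arbitrary actuator. -/
def IsSensorCompletion {p m : ℕ} (M : Finset (Fin p × Fin m)) (K : Finset (Fin m × Fin p)) :
    Prop :=
  p ≤ m ∧ K.card = m - p ∧ (∀ e ∈ K, ∀ i, (i, e.1) ∉ M) ∧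
    ∀ j : Fin m, (∀ i, (i, j) ∉ M) → ∃! i : Fin p, (j, i) ∈ K

/-- The dual: `p - m` links, one into each actuator not in the matching `M`, starting in an
arbitrary sensor. -/
def IsActuatorCompletion {p m : ℕ} (M : Finset (Fin p × Fin m)) (K : Finset (Fin m × Fin p)) :
    Prop :=
  m ≤ p ∧ K.card = p - m ∧ (∀ e ∈ K, ∀ j, (e.2, j) ∉ M) ∧
    ∀ i : Fin p, (∀ j, (i, j) ∉ M) → ∃! j : Fin m, (j, i) ∈ K

/-- `K` is a possible outcome of the pairing procedure: a sequential pairing induced by a maximum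
matching of the reachability graph, together with the additional links. -/
def IsProcedurePattern {n p m : ℕ} (Abar : Matrix (Fin n) (Fin n) Bool) (b : Fin p → Fin n)
    (c : Fin m → Fin n) (K : Finset (Fin m × Fin p)) : Prop :=
  ∃ (M : Finset (Fin p × Fin m)) (K₁ K₂ : Finset (Fin m × Fin p)),
    IsMaximumMatching (Reaches Abar b c) M ∧ IsSequentialPairing M K₁ ∧
      (IsSensorCompletion M K₂ ∨ IsActuatorCompletion M K₂) ∧ K = K₁ ∪ K₂

/-- `k + 1` pairwise disjoint outcomes of the pairing procedure. -/
def IsDisjointProcedureFamily {n p m : ℕ} (Abar : Matrix (Fin n) (Fin n) Bool) (b : Fin p → Fin n)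
    (c : Fin m → Fin n) (k : ℕ) (K : Fin (k + 1) → Finset (Fin m × Fin p)) : Prop :=
  (∀ s, IsProcedurePattern Abar b c (K s)) ∧ ∀ s t, s ≠ t → Disjoint (K s) (K t)

/-! ### A random access machine with a step count

Programs act on natural-number registers and on arrays of natural numbers. The only arithmetic is
successor and truncated predecessor, so within `t` steps no number exceeds the largest one
in the input and in the program by more than `t`: unit cost is realistic. -/

inductive Expr : Type
  | const (v : ℕ)
  | reg (x : ℕ)
  | read (a : ℕ) (index : Expr)
  | succ (e : Expr)
  | pred (e : Expr)

inductive Test : Type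
  | lt (e₁ e₂ : Expr)
  | eq (e₁ e₂ : Expr)

inductive Prog : Type
  | assign (x : ℕ) (e : Expr)
  | store (a : ℕ) (index e : Expr)
  | seq (P Q : Prog)
  | ite (b : Test) (P Q : Prog)
  | loop (b : Test) (P : Prog)

/-- The contents of the registers and of the arrays. -/
structure Store : Type where
  reg : ℕ → ℕ
  arr : ℕ → ℕ → ℕ

def Expr.eval (s : Store) : Expr → ℕ
  | .const v => v
  | .reg x => s.reg x
  | .read a e => s.arr a (e.eval s)
  | .succ e => e.eval s + 1
  | .pred e => e.eval s - 1

/-- The number of elementary operations in the evaluation of an expression. -/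
def Expr.cost : Expr → ℕ
  | .const _ => 1
  | .reg _ => 1
  | .read _ e => e.cost + 1
  | .succ e => e.cost + 1
  | .pred e => e.cost + 1

def Test.eval (s : Store) : Test → Bool
  | .lt e₁ e₂ => decide (e₁.eval s < e₂.eval s)
  | .eq e₁ e₂ => decide (e₁.eval s = e₂.eval s)

def Test.cost : Test → ℕ
  | .lt e₁ e₂ => e₁.cost + e₂.cost + 1
  | .eq e₁ e₂ => e₁.cost + e₂.cost + 1

def Store.setReg (s : Store) (x v : ℕ) : Store :=
  { s with reg := Function.update s.reg x v }

def Store.setArr (s : Store) (a i v : ℕ) : Store :=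
  { s with arr := Function.update s.arr a (Function.update (s.arr a) i v) }

/-- `Runs P s s' t`: the program `P`, started in `s`, halts in `s'` after exactly `t` steps. -/
inductive Runs : Prog → Store → Store → ℕ → Prop
  | assign (x : ℕ) (e : Expr) (s : Store) :
      Runs (.assign x e) s (s.setReg x (e.eval s)) (e.cost + 1)
  | store (a : ℕ) (index e : Expr) (s : Store) :
      Runs (.store a index e) s (s.setArr a (index.eval s) (e.eval s)) (index.cost + e.cost + 1)
  | seq {P Q : Prog} {s₁ s₂ s₃ : Store} {t₁ t₂ : ℕ} (h₁ : Runs P s₁ s₂ t₁)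
      (h₂ : Runs Q s₂ s₃ t₂) : Runs (.seq P Q) s₁ s₃ (t₁ + t₂)
  | ite_true {b : Test} {P Q : Prog} {s s' : Store} {t : ℕ} (hb : b.eval s = true)
      (h : Runs P s s' t) : Runs (.ite b P Q) s s' (b.cost + t)
  | ite_false {b : Test} {P Q : Prog} {s s' : Store} {t : ℕ} (hb : b.eval s = false)
      (h : Runs Q s s' t) : Runs (.ite b P Q) s s' (b.cost + t)
  | loop_false {b : Test} {P : Prog} {s : Store} (hb : b.eval s = false) :
      Runs (.loop b P) s s b.cost
  | loop_true {b : Test} {P : Prog} {s₁ s₂ s₃ : Store} {t₁ t₂ : ℕ} (hb : b.eval s₁ = true)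
      (h₁ : Runs P s₁ s₂ t₁) (h₂ : Runs (.loop b P) s₂ s₃ t₂) :
      Runs (.loop b P) s₁ s₃ (b.cost + t₁ + t₂)

/-- The out-neighbours of state `x` in the state digraph. -/
def successors {n : ℕ} (Abar : Matrix (Fin n) (Fin n) Bool) (x : Fin n) : List (Fin n) :=
  (List.finRange n).filter fun y => Abar y x

/-- The adjacency lists of the states below `v`, one after the other. -/
def adjacency {n : ℕ} (Abar : Matrix (Fin n) (Fin n) Bool) (v : ℕ) : List ℕ :=
  ((List.finRange n).filter fun x => x.val < v).flatMap fun x =>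
    (successors Abar x).map Fin.val

/-- The input: registers 0, 1, 2, 3 hold `n`, `p`, `m`, `k`; array 1 holds the concatenated
adjacency lists of the state digraph, the list of state `x` starting at the position given by
entry `x` of array 0 and ending before the one given by entry `x + 1`; arrays 2 and 3 hold the
actuated and the measured states; all else is zero. -/
def inputStore {n p m : ℕ} (Abar : Matrix (Fin n) (Fin n) Bool) (b : Fin p → Fin n)
    (c : Fin m → Fin n) (k : ℕ) : Store where
  reg x := [n, p, m, k].getD x 0
  arr a i :=
    match a with
    | 0 => if i ≤ n then (adjacency Abar i).length else 0
    | 1 => (adjacency Abar n).getD i 0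
    | 2 => if h : i < p then (b ⟨i, h⟩).val else 0
    | 3 => if h : i < m then (c ⟨i, h⟩).val else 0
    | _ => 0

/-- The output: register 4 holds the length of a list of links, whose sensors and actuators are
listed in arrays 4 and 5, and whose set of members is `K`. -/
def Outputs {p m : ℕ} (s : Store) (K : Finset (Fin m × Fin p)) : Prop :=
  (Finset.range (s.reg 4)).image (fun t => (s.arr 4 t, s.arr 5 t)) =
    K.image fun e => (e.1.val, e.2.val)

/-- The number of vertices of the system digraph. -/
def numVertices (n p m : ℕ) : ℕ := n + p + m

/-- The number of nonzero entries of a pattern. -/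
def numNonzero {a b : ℕ} (P : Matrix (Fin a) (Fin b) Bool) : ℕ :=
  (Finset.univ.filter fun e : Fin a × Fin b => P e.1 e.2 = true).card

/-- The number of edges of the system digraph. -/
def numEdges {n p m : ℕ} (Abar : Matrix (Fin n) (Fin n) Bool) (b : Fin p → Fin n)
    (c : Fin m → Fin n) : ℕ :=
  numNonzero Abar + numNonzero (inputPattern b) + numNonzero (outputPattern c)

/-- `(k + 1) max {|V| + |E|, (p + m)^(5/2)}`. -/
noncomputable def timeBound {n p m : ℕ} (Abar : Matrix (Fin n) (Fin n) Bool) (b : Fin p → Fin n)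
    (c : Fin m → Fin n) (k : ℕ) : ℝ :=
  ((k : ℝ) + 1) *
    max ((numVertices n p m : ℝ) + (numEdges Abar b c : ℝ)) (((p : ℝ) + (m : ℝ)) ^ (5 / 2 : ℝ))

end ResilientControl

open ResilientControl
open scoped MeasureTheory

/-!
**The fixed modes.** By Lin's theorem in the presence of a perfect matching, actuators make the system
structurally controllable exactly if every state is reached from one of them. A minimum collection
therefore contains one actuator in each source component of the state digraph, and the states `b i` are
distinct; likewise for sensors. If the closed-loop digraph, with an edge from `c j` to `b i` for each
working link, is strongly connected, almost no realization has a fixed mode: with generic gains the closed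
loop and a rank-one modification of it have characteristic polynomials without a common root, a condition
given by a polynomial in the parameters (`ae_fixedModesAt_eq_empty_of_closed`). Conversely a source
component whose actuator has no working link keeps its eigenvalues, so a `k`-resilient pattern has at
least `k + 1` links at each actuator and each sensor, hence `(k + 1) max {p, m}` links
(`isSparsestResilient_of_ae` turns this into optimality). An outcome of the pairing procedure has
`max {p, m}` links and closes the loop strongly connectedly: the sequential pairing makes a cycle through
all matched pairs, one side is matched completely, and the additional links join the rest of the other
side to the cycle. Of `k + 1` disjoint outcomes one survives any `k` failures.

**The program.** The reachability graph would be too expensive to compute, and so would a maximum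
matching of it. Instead, augmenting paths are searched directly in the system digraph, in phases of
linear time, until the matching is maximum, or has `k + 2` edges or more and leaves `k + 1` vertices or
more of the smaller side free; `2 k + 2` phases are enough. After every phase each actuator reaches a
matched sensor and each sensor is reached from a matched actuator (`Net.Rest.exists_sensor`,
`Net.Rest.exists_actuator`), and a phase without success proves the matching maximum by a vertex cover
(`Net.Rest.card_le`). Linking each matched sensor with the next `k + 1` matched actuators in the cyclic
order gives a circulant digraph which `k` failures cannot disconnect (`le_sum_circulant_cut`); `k + 1`
links at each other vertex complete the pattern, with `(k + 1) max {p, m}` links in all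
(`isSparsestResilient_of_isRobust`). This needs `k + 2 ≤ min {p, m}`; counting the links of the given
family shows `k + 1 ≤ min {p, m}`, and in the case of equality its union contains every link.

The running time is obtained from a program logic with time credits (`Wp`), whose loop rule charges every
test. The potential of the search (`Net.potential`) counts the unmarked states and the edges not yet
looked at.
-/

namespace ResilientControl

open Matrix

/-! ### Controllability and left eigenvectors -/

theorem exists_eigenvector_mem {V : Type*} [AddCommGroup V] [Module ℂ V] [FiniteDimensional ℂ V]
    (f : Module.End ℂ V) (W : Submodule ℂ V) (hW : W ≠ ⊥) (hf : ∀ v ∈ W, f v ∈ W) :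
    ∃ μ : ℂ, ∃ v ∈ W, v ≠ 0 ∧ f v = μ • v := by
  have : Nontrivial W := Submodule.nontrivial_iff_ne_bot.mpr hW
  obtain ⟨μ, hμ⟩ := Module.End.exists_eigenvalue (f.restrict hf)
  obtain ⟨v, hv⟩ := hμ.exists_hasEigenvector
  refine ⟨μ, v, v.2, fun h => hv.2 (Subtype.ext h), ?_⟩
  have := congrArg Subtype.val hv.apply_eq_smul
  simpa using this

/-- The complexification of a real matrix. -/
abbrev complexify {α β : Type*} (A : Matrix α β ℝ) : Matrix α β ℂ := A.map Complex.ofRealHom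

/-- Every left eigenvector of `A` has a nonzero entry at one of the states `b i`: the
Popov–Belevitch–Hautus test for the pair of `A` with dedicated actuators at these states. -/
def ExcitesAllModes {n p : ℕ} (A : Matrix (Fin n) (Fin n) ℝ) (b : Fin p → Fin n) : Prop :=
  ∀ (μ : ℂ) (u : Fin n → ℂ), u ᵥ* complexify A = μ • u → (∀ i, u (b i) = 0) → u = 0

/-- The input matrix of dedicated actuators with unit gains. -/
def unitInput {n p : ℕ} (b : Fin p → Fin n) : Matrix (Fin n) (Fin p) ℝ :=
  Matrix.of fun x i => if b i = x then 1 else 0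

theorem controllable_iff_injective {n p : ℕ} (A : Matrix (Fin n) (Fin n) ℝ)
    (B : Matrix (Fin n) (Fin p) ℝ) :
    Controllable A B ↔ Function.Injective fun u => u ᵥ* controllabilityMatrix A B := by
  rw [Matrix.vecMul_injective_iff, linearIndependent_iff_card_eq_finrank_span, Controllable,
    Matrix.rank_eq_finrank_span_row, Fintype.card_fin, Set.finrank, eq_comm]

theorem vecMul_controllabilityMatrix_eq_zero_iff {n p : ℕ} (A : Matrix (Fin n) (Fin n) ℝ)
    (B : Matrix (Fin n) (Fin p) ℝ) (u : Fin n → ℝ) :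
    u ᵥ* controllabilityMatrix A B = 0 ↔ ∀ k : ℕ, u ᵥ* (A ^ k * B) = 0 := by
  constructor
  · intro h k
    have hlt : ∀ j < n, u ᵥ* (A ^ j * B) = 0 := fun j hj => by
      ext i
      simpa [Matrix.vecMul, dotProduct, controllabilityMatrix] using congrFun h (⟨j, hj⟩, i)
    rcases Nat.eq_zero_or_pos n with rfl | hn
    · ext i
      simp [Matrix.vecMul, dotProduct]
    have hdeg : (Polynomial.X ^ k %ₘ A.charpoly).natDegree < n := by
      have h1 : A.charpoly.natDegree = n := by simp
      have := Polynomial.natDegree_modByMonic_lt (Polynomial.X ^ k) A.charpoly_monic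
        (fun h => by rw [h] at h1; simp at h1; omega)
      omega
    -- Cayley–Hamilton: all powers of `A` are combinations of the first `n`
    rw [Matrix.pow_eq_aeval_mod_charpoly, Polynomial.aeval_eq_sum_range' hdeg, Matrix.sum_mul,
      Matrix.vecMul_sum]
    refine Finset.sum_eq_zero fun j hj => ?_
    rw [Matrix.smul_mul, Matrix.vecMul_smul, hlt j (Finset.mem_range.mp hj), smul_zero]
  · intro h
    ext ⟨j, i⟩
    simpa [Matrix.vecMul, dotProduct, controllabilityMatrix] using congrFun (h j) i

theorem controllable_of_left_eigenvector {n p : ℕ} (A : Matrix (Fin n) (Fin n) ℝ)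
    (B : Matrix (Fin n) (Fin p) ℝ)
    (h : ∀ (μ : ℂ) (u : Fin n → ℂ), u ᵥ* complexify A = μ • u → u ᵥ* complexify B = 0 → u = 0) :
    Controllable A B := by
  rw [controllable_iff_injective]
  intro u v huv
  by_contra hne
  have hu : (u - v) ᵥ* controllabilityMatrix A B = 0 := by
    rw [Matrix.sub_vecMul, sub_eq_zero]; exact huv
  rw [vecMul_controllabilityMatrix_eq_zero_iff] at hu
  -- the complex row vectors that annihilate the reachable subspace
  let W : Submodule ℂ (Fin n → ℂ) :=
    ⨅ k : ℕ, LinearMap.ker (Matrix.vecMulLinear (complexify A ^ k * complexify B))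
  have hW : ∀ w, w ∈ W ↔ ∀ k : ℕ, w ᵥ* (complexify A ^ k * complexify B) = 0 := by
    intro w; simp [W, Submodule.mem_iInf]
  obtain ⟨μ, w, hw, hw0, he⟩ := exists_eigenvector_mem (Matrix.vecMulLinear (complexify A)) W
    (by
      intro hbot
      have : (fun i => ((u - v) i : ℂ)) ∈ W := by
        rw [hW]
        intro k
        have := hu k
        have h2 := congrArg (fun z : Fin p → ℝ => Complex.ofRealHom ∘ z) this
        have h3 : Complex.ofRealHom ∘ ((u - v) ᵥ* (A ^ k * B)) =
            (Complex.ofRealHom ∘ (u - v)) ᵥ* (complexify A ^ k * complexify B) := by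
          ext i
          rw [Function.comp_apply, RingHom.map_vecMul, Matrix.map_mul, Matrix.map_pow]
        rw [show (fun i => ((u - v) i : ℂ)) = Complex.ofRealHom ∘ (u - v) from rfl, ← h3, h2]
        ext; simp
      rw [hbot, Submodule.mem_bot] at this
      apply hne
      ext i
      have := congrFun this i
      simp only [Pi.sub_apply, Pi.zero_apply, Complex.ofReal_eq_zero] at this
      linarith)
    (by
      intro w hw
      rw [hW] at hw ⊢
      intro k
      have := hw (k + 1)
      rw [Matrix.vecMulLinear_apply, Matrix.vecMul_vecMul, ← Matrix.mul_assoc, ← pow_succ']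
      exact this)
  refine hw0 (h μ w (by simpa using he) ?_)
  simpa using (hW w).mp hw 0

theorem excitesAllModes_of_controllable {n p : ℕ} {A : Matrix (Fin n) (Fin n) ℝ} {b : Fin p → Fin n}
    (h : Controllable A (unitInput b)) : ExcitesAllModes A b := by
  rw [controllable_iff_injective] at h
  intro μ u hu hb
  have hpow : ∀ k : ℕ, u ᵥ* (complexify A ^ k) = μ ^ k • u := by
    intro k
    induction k with
    | zero => simp
    | succ k ih => rw [pow_succ, ← Matrix.vecMul_vecMul, ih, Matrix.smul_vecMul, hu, smul_smul,
        pow_succ]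
  have hB : u ᵥ* complexify (unitInput b) = 0 := by
    ext i
    simp [Matrix.vecMul, dotProduct, unitInput, hb]
  have hall : ∀ k : ℕ, u ᵥ* complexify (A ^ k * unitInput b) = 0 := by
    intro k
    rw [complexify, Matrix.map_mul, ← Matrix.vecMul_vecMul, Matrix.map_pow, hpow,
      Matrix.smul_vecMul, hB, smul_zero]
  have key : ∀ f : ℂ →ₗ[ℝ] ℝ, (fun x => f (u x)) = 0 := by
    intro f
    apply h
    simp only [Matrix.zero_vecMul]
    rw [vecMul_controllabilityMatrix_eq_zero_iff]
    intro k
    ext i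
    have h1 := congrArg f (congrFun (hall k) i)
    simp only [Matrix.vecMul, dotProduct, map_sum, Pi.zero_apply, map_zero] at h1 ⊢
    rw [← h1]
    refine Finset.sum_congr rfl fun x _ => ?_
    have : u x * complexify (A ^ k * unitInput b) x i = (A ^ k * unitInput b) x i • u x := by
      rw [mul_comm]; simp [complexify]
    rw [this, map_smul, smul_eq_mul, mul_comm]
  ext x
  apply Complex.ext
  · exact congrFun (key Complex.reLm) x
  · exact congrFun (key Complex.imLm) x

/-- All states in a set that receives neither inputs nor edges from outside are uncontrollable. -/
theorem exists_reach_of_structurallyControllable {n p : ℕ} {Abar : Matrix (Fin n) (Fin n) Bool}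
    {b : Fin p → Fin n} (h : StructurallyControllable Abar (inputPattern b)) (y : Fin n) :
    ∃ i, Relation.ReflTransGen (fun x y => Abar y x = true) (b i) y := by
  obtain ⟨θA, θB, h⟩ := h
  by_contra hy
  rw [controllable_iff_injective] at h
  have hz : ∀ k : ℕ, ∀ z, (¬ ∃ i, Relation.ReflTransGen (fun x y => Abar y x = true) (b i) z) →
      ∀ j, (realization Abar θA ^ k * realization (inputPattern b) θB) z j = 0 := by
    intro k
    induction k with
    | zero =>
      intro z hz j
      have : inputPattern b z j = false := by
        simp only [inputPattern, of_apply, decide_eq_false_iff_not]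
        rintro rfl
        exact hz ⟨j, .refl⟩
      simp [realization, this]
    | succ k ih =>
      intro z hz j
      rw [pow_succ', Matrix.mul_assoc, Matrix.mul_apply]
      refine Finset.sum_eq_zero fun w _ => ?_
      by_cases hw : Abar z w = true
      · rw [ih w (fun ⟨i, hi⟩ => hz ⟨i, hi.tail hw⟩), mul_zero]
      · simp [realization, hw]
  have h1 : (Pi.single y 1 : Fin n → ℝ) = 0 := by
    apply h
    simp only [Matrix.zero_vecMul]
    ext q
    simp [controllabilityMatrix, hz q.1 y hy q.2]
  have := congrFun h1 y
  simp at this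

/-! ### Structural controllability under a perfect state matching -/

/-- The data of the construction: around each cycle of `σ` the weights `r` are equal, different
cycles have different weights, and `d` is a distance from the actuated cycles. Each cycle
`q` at positive distance has one edge `tail q → head q` into it, from a cycle that is closer. -/
structure CycleForest {n : ℕ} (σ : Equiv.Perm (Fin n)) where
  Q : Type
  [decQ : DecidableEq Q]
  [finQ : Fintype Q]
  cyc : Fin n → Q
  cyc_eq : ∀ x y, cyc x = cyc y ↔ σ.SameCycle x y
  r : Q → ℝ
  r_pos : ∀ q, 0 < r q
  r_inj : Function.Injective r
  d : Q → ℕ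
  tail : Q → Fin n
  head : Q → Fin n
  cyc_head : ∀ q, 0 < d q → cyc (head q) = q
  d_tail : ∀ q, 0 < d q → d (cyc (tail q)) + 1 = d q

attribute [instance] CycleForest.decQ CycleForest.finQ

namespace CycleForest

variable {n : ℕ} {σ : Equiv.Perm (Fin n)} (F : CycleForest σ)

/-- The weighted permutation matrix of `σ` plus the forest edges. -/
def mat : Matrix (Fin n) (Fin n) ℝ :=
  Matrix.of fun y x => (if σ x = y then F.r (F.cyc x) else 0) +
    ∑ q, if 0 < F.d q ∧ F.tail q = x ∧ F.head q = y then 1 else 0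

theorem vecMul_mat (u : Fin n → ℂ) (x : Fin n) :
    (u ᵥ* complexify F.mat) x = F.r (F.cyc x) * u (σ x) +
      ∑ q, if 0 < F.d q ∧ F.tail q = x then u (F.head q) else 0 := by
  simp only [Matrix.vecMul, dotProduct, complexify, mat, Matrix.map_apply, of_apply, map_add,
    mul_add, Finset.sum_add_distrib, map_sum, Finset.mul_sum]
  congr 1
  · rw [Finset.sum_eq_single (σ x)]
    · simp [mul_comm]
    · intro y _ hy; simp [hy.symm]
    · simp
  · rw [Finset.sum_comm]
    refine Finset.sum_congr rfl fun q _ => ?_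
    rw [Finset.sum_eq_single (F.head q)]
    · by_cases h : 0 < F.d q ∧ F.tail q = x
      · simp [h]
      · rw [if_neg h, if_neg (fun h' => h ⟨h'.1, h'.2.1⟩)]; simp
    · intro y _ hy
      rw [if_neg (fun h' => hy h'.2.2.symm)]; simp
    · simp

theorem cyc_apply (x : Fin n) : F.cyc (σ x) = F.cyc x := by
  rw [F.cyc_eq]; exact (Equiv.Perm.SameCycle.refl σ x).apply_left

theorem exists_pow_of_cyc_eq {x y : Fin n} (h : F.cyc x = F.cyc y) : ∃ k : ℕ, (σ ^ k) x = y := by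
  obtain ⟨k, _, hk⟩ := ((F.cyc_eq x y).mp h).exists_pow_eq'
  exact ⟨k, hk⟩

theorem cyc_pow (k : ℕ) (x : Fin n) : F.cyc ((σ ^ k) x) = F.cyc x := by
  rw [F.cyc_eq]; exact Equiv.Perm.sameCycle_pow_left.mpr (.refl _ _)

variable {u : Fin n → ℂ} {μ : ℂ}

theorem eigen_eq (hu : u ᵥ* complexify F.mat = μ • u) (x : Fin n) : F.r (F.cyc x) * u (σ x) +
    (∑ q, if 0 < F.d q ∧ F.tail q = x then u (F.head q) else 0) = μ * u x := by
  rw [← F.vecMul_mat, hu]; rfl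

/-- A cycle on which `u` does not vanish and which gets no contribution from its children has
weight `|μ|`. -/
theorem norm_eq_of_childless (hu : u ᵥ* complexify F.mat = μ • u)
    {q : F.Q} {x₀ : Fin n} (hx₀ : F.cyc x₀ = q) (hne : u x₀ ≠ 0)
    (hc : ∀ q', 0 < F.d q' → F.cyc (F.tail q') = q → u (F.head q') = 0) : ‖μ‖ = F.r q := by
  have hr : (0 : ℝ) < F.r q := F.r_pos q
  have hstep : ∀ x, F.cyc x = q → ‖u (σ x)‖ = (‖μ‖ / F.r q) * ‖u x‖ := by
    intro x hx
    have h := F.eigen_eq hu x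
    rw [Finset.sum_eq_zero, add_zero, hx] at h
    · have h2 := congrArg norm h
      rw [norm_mul, norm_mul, Complex.norm_real, Real.norm_of_nonneg hr.le] at h2
      field_simp
      linarith
    · intro q' _
      split_ifs with h'
      · exact hc q' h'.1 (by rw [h'.2, hx])
      · rfl
  have hpow : ∀ k : ℕ, ‖u ((σ ^ k) x₀)‖ = (‖μ‖ / F.r q) ^ k * ‖u x₀‖ := by
    intro k
    induction k with
    | zero => simp
    | succ k ih =>
      rw [pow_succ', Equiv.Perm.mul_apply, hstep _ (by rw [F.cyc_pow, hx₀]), ih, pow_succ]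
      ring
  have h := hpow (orderOf σ)
  rw [pow_orderOf_eq_one, Equiv.Perm.one_apply] at h
  have h1 : (‖μ‖ / F.r q) ^ orderOf σ = 1 := by
    have : ‖u x₀‖ ≠ 0 := norm_ne_zero_iff.mpr hne
    field_simp at h ⊢
    linarith
  have h2 := (pow_eq_one_iff_of_nonneg (by positivity) (orderOf_pos σ).ne').mp h1
  field_simp at h2
  exact h2

/-- A cycle that gets exactly one nonzero contribution, at the state `t`, has no zeros of `u`. -/
theorem ne_zero_of_child {q : F.Q} {t : Fin n} (ht : F.cyc t = q) {s : ℂ} (hs : s ≠ 0)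
    (h1 : F.r q * u (σ t) + s = μ * u t)
    (h2 : ∀ x, F.cyc x = q → x ≠ t → F.r q * u (σ x) = μ * u x) (hμ : μ ≠ 0) :
    ∀ x, F.cyc x = q → u x ≠ 0 := by
  have hr : (F.r q : ℂ) ≠ 0 := by exact_mod_cast (F.r_pos q).ne'
  have hA : u (σ t) ≠ 0 := by
    intro h0
    have : ∀ k : ℕ, u ((σ ^ k) (σ t)) = 0 := by
      intro k
      induction k with
      | zero => simpa using h0
      | succ k ih =>
        rw [pow_succ', Equiv.Perm.mul_apply]
        by_cases hx : (σ ^ k) (σ t) = t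
        · rw [hx]; exact h0
        · have := h2 _ (by rw [F.cyc_pow, F.cyc_apply, ht]) hx
          rw [ih, mul_zero] at this
          exact (mul_eq_zero.mp this).resolve_left hr
    obtain ⟨k, hk⟩ := F.exists_pow_of_cyc_eq (F.cyc_apply t)
    have h3 := this k
    rw [hk] at h3
    rw [h0, h3] at h1
    simp at h1
    exact hs h1
  have hB : ∀ k : ℕ, u ((σ ^ k) (σ t)) ≠ 0 := by
    intro k
    induction k with
    | zero => simpa using hA
    | succ k ih =>
      rw [pow_succ', Equiv.Perm.mul_apply]
      by_cases hx : (σ ^ k) (σ t) = t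
      · rw [hx]; exact hA
      · intro h0
        have := h2 _ (by rw [F.cyc_pow, F.cyc_apply, ht]) hx
        rw [h0, mul_zero] at this
        exact ih ((mul_eq_zero.mp this.symm).resolve_left hμ)
  intro x hx
  obtain ⟨k, hk⟩ := F.exists_pow_of_cyc_eq (x := σ t) (y := x) (by rw [F.cyc_apply, ht, hx])
  rw [← hk]
  exact hB k

/-- A left eigenvector of the forest matrix has no zeros on some cycle without parent: the cycles on
which it does not vanish are the ancestors of the one whose weight is `|μ|`. -/
theorem exists_root_ne_zero (hu : u ᵥ* complexify F.mat = μ • u) (hu0 : u ≠ 0) : ∃ q, F.d q = 0 ∧ ∀ x, F.cyc x = q → u x ≠ 0 := by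
  classical
  let N : Set F.Q := {q | ∃ x, F.cyc x = q ∧ u x ≠ 0}
  have head_mem : ∀ q, 0 < F.d q → u (F.head q) ≠ 0 → q ∈ N :=
    fun q hq h => ⟨F.head q, F.cyc_head q hq, h⟩
  -- a cycle in `N` has weight `|μ|` or a child in `N`
  have hchild : ∀ q ∈ N, ‖μ‖ = F.r q ∨
      ∃ q' ∈ N, 0 < F.d q' ∧ F.cyc (F.tail q') = q := by
    rintro q ⟨x, hx, hne⟩
    by_contra! hcon
    refine hcon.1 (F.norm_eq_of_childless hu hx hne fun q' hd ht => ?_)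
    by_contra h0
    exact hcon.2 q' (head_mem q' hd h0) hd ht
  obtain ⟨x₀, hx₀⟩ := Function.ne_iff.mp hu0
  -- a deepest cycle of `N` has weight `|μ|`
  obtain ⟨qm, hqm, hmax⟩ := Set.exists_max_image N F.d (Set.toFinite N) ⟨_, x₀, rfl, hx₀⟩
  have hnorm : ‖μ‖ = F.r qm := by
    rcases hchild qm hqm with h | ⟨q', hq', hd, ht⟩
    · exact h
    · have h1 := F.d_tail q' hd
      have h2 := hmax q' hq'
      rw [ht] at h1
      omega
  have hμ : μ ≠ 0 := by
    rw [← norm_ne_zero_iff, hnorm]; exact (F.r_pos qm).ne'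
  have heq : ∀ q, ‖μ‖ = F.r q → q = qm := fun q hq => F.r_inj (by rw [← hq, hnorm])
  -- at each depth there is at most one cycle of `N`
  have huniq : ∀ j, ∀ q ∈ N, ∀ q' ∈ N, F.d q + j = F.d qm → F.d q' = F.d q → q = q' := by
    intro j
    induction j with
    | zero =>
      have : ∀ q ∈ N, F.d q + 0 = F.d qm → q = qm := by
        intro q hq hd
        rcases hchild q hq with h | ⟨q', hq', hd', ht⟩
        · exact heq q h
        · have h1 := F.d_tail q' hd'
          have h2 := hmax q' hq'
          rw [ht] at h1
          omega
      intro q hq q' hq' hd hd'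
      rw [this q hq hd, this q' hq' (by omega)]
    | succ j ih =>
      have : ∀ q ∈ N, F.d q + (j + 1) = F.d qm →
          ∃ q' ∈ N, 0 < F.d q' ∧ F.cyc (F.tail q') = q := by
        intro q hq hd
        rcases hchild q hq with h | h
        · rw [heq q h] at hd; omega
        · exact h
      intro q hq q' hq' hd hd'
      obtain ⟨c, hc, hcd, hct⟩ := this q hq hd
      obtain ⟨c', hc', hcd', hct'⟩ := this q' hq' (by omega)
      have h1 := F.d_tail c hcd
      have h2 := F.d_tail c' hcd'
      rw [hct] at h1
      rw [hct'] at h2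
      have := ih c hc c' hc' (by omega) (by omega)
      rw [← hct, ← hct', this]
  -- at each depth up to the deepest one there is a cycle without zeros
  have hfull : ∀ j, j ≤ F.d qm → ∃ q, F.d q + j = F.d qm ∧ ∀ x, F.cyc x = q → u x ≠ 0 := by
    intro j
    induction j with
    | zero =>
      intro _
      refine ⟨qm, rfl, ?_⟩
      obtain ⟨x, hx, hne⟩ := hqm
      have hr : (F.r qm : ℂ) ≠ 0 := by exact_mod_cast (F.r_pos qm).ne'
      have hpow : ∀ k : ℕ, u ((σ ^ k) x) ≠ 0 := by
        intro k
        induction k with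
        | zero => simpa using hne
        | succ k ih =>
          rw [pow_succ', Equiv.Perm.mul_apply]
          intro h0
          have h := F.eigen_eq hu ((σ ^ k) x)
          rw [h0, mul_zero, zero_add, Finset.sum_eq_zero] at h
          · exact ih ((mul_eq_zero.mp h.symm).resolve_left hμ)
          · intro q' _
            split_ifs with h'
            · by_contra hz
              have h1 := F.d_tail q' h'.1
              have h2 := hmax q' (head_mem q' h'.1 hz)
              rw [h'.2, F.cyc_pow, hx] at h1
              omega
            · rfl
      intro y hy
      obtain ⟨k, hk⟩ := F.exists_pow_of_cyc_eq (x := x) (y := y) (by rw [hx, hy])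
      rw [← hk]
      exact hpow k
    | succ j ih =>
      intro hj
      obtain ⟨c, hcd, hc⟩ := ih (by omega)
      have hcpos : 0 < F.d c := by omega
      have h1 := F.d_tail c hcpos
      have hcN : c ∈ N := head_mem c hcpos (hc _ (F.cyc_head c hcpos))
      refine ⟨F.cyc (F.tail c), by omega, ?_⟩
      have hsum : ∀ x, F.cyc x = F.cyc (F.tail c) →
          (∑ q, if 0 < F.d q ∧ F.tail q = x then u (F.head q) else 0) =
            if F.tail c = x then u (F.head c) else 0 := by
        intro x hx
        rw [Finset.sum_eq_single c]
        · simp [hcpos]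
        · intro q _ hq
          split_ifs with h'
          · by_contra hz
            have h2 := F.d_tail q h'.1
            rw [h'.2, hx] at h2
            exact hq (huniq j q (head_mem q h'.1 hz) c hcN (by omega) (by omega))
          · rfl
        · simp
      refine F.ne_zero_of_child (t := F.tail c) rfl (s := u (F.head c))
        (hc _ (F.cyc_head c hcpos)) ?_ ?_ hμ
      · have h := F.eigen_eq hu (F.tail c)
        rw [hsum _ rfl, if_pos rfl] at h
        exact h
      · intro x hx hne
        have h := F.eigen_eq hu x
        rw [hsum _ hx, if_neg hne.symm, add_zero, hx] at h
        exact h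
  obtain ⟨q, hq, h⟩ := hfull _ le_rfl
  exact ⟨q, by omega, h⟩

end CycleForest

end ResilientControl

namespace ResilientControl

open Matrix

/-- The cycles of `σ` that can be reached from a cycle with an actuated state by `k` edges between
cycles. -/
def cycleLevel {n p : ℕ} (Abar : Matrix (Fin n) (Fin n) Bool) (σ : Equiv.Perm (Fin n))
    (b : Fin p → Fin n) : ℕ → Set (Quotient (Equiv.Perm.SameCycle.setoid σ))
  | 0 => {q | ∃ i, q = Quotient.mk _ (b i)}
  | k + 1 => {q | ∃ x y, Quotient.mk _ x ∈ cycleLevel Abar σ b k ∧ Quotient.mk _ y = q ∧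
      Abar y x = true}

/-- If `σ` is a perfect state matching and the actuators reach every state, some matrix with the
pattern `Abar` passes the eigenvector test. -/
theorem exists_excitesAllModes {n p : ℕ} {Abar : Matrix (Fin n) (Fin n) Bool} {b : Fin p → Fin n}
    (hA : HasPerfectStateMatching Abar)
    (hreach : ∀ y, ∃ i, Relation.ReflTransGen (fun x y => Abar y x = true) (b i) y) :
    ∃ A : Matrix (Fin n) (Fin n) ℝ, (∀ y x, A y x ≠ 0 → Abar y x = true) ∧
      ExcitesAllModes A b := by
  classical
  obtain ⟨σ, hσ⟩ := hA
  have hlevel : ∀ q, ∃ k, q ∈ cycleLevel Abar σ b k := by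
    intro q
    obtain ⟨y, rfl⟩ := Quotient.exists_rep q
    obtain ⟨i, hi⟩ := hreach y
    induction hi with
    | refl => exact ⟨0, i, rfl⟩
    | tail _ h ih =>
      obtain ⟨k, hk⟩ := ih
      exact ⟨k + 1, _, _, hk, rfl, h⟩
  let d : Quotient (Equiv.Perm.SameCycle.setoid σ) → ℕ := fun q => Nat.find (hlevel q)
  have hparent : ∀ q, 0 < d q → ∃ e : Fin n × Fin n, Quotient.mk _ e.2 = q ∧
      Abar e.2 e.1 = true ∧ d (Quotient.mk _ e.1) + 1 = d q := by
    intro q hq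
    obtain ⟨k, hk⟩ : ∃ k, d q = k + 1 := ⟨d q - 1, by omega⟩
    have hmem : q ∈ cycleLevel Abar σ b (d q) := Nat.find_spec (hlevel q)
    rw [hk] at hmem
    obtain ⟨x, y, hx, hy, he⟩ := hmem
    refine ⟨(x, y), hy, he, ?_⟩
    have h1 : d (Quotient.mk _ x) ≤ k := Nat.find_min' _ hx
    have h2 : d q ≤ d (Quotient.mk _ x) + 1 :=
      Nat.find_min' _ ⟨x, y, Nat.find_spec (hlevel (Quotient.mk _ x)), hy, he⟩
    change d (Quotient.mk _ x) + 1 = d q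
    omega
  have hparent' : ∀ q, ∃ e : Fin n × Fin n, 0 < d q → (Quotient.mk _ e.2 = q ∧
      Abar e.2 e.1 = true ∧ d (Quotient.mk _ e.1) + 1 = d q) := by
    intro q
    by_cases hq : 0 < d q
    · obtain ⟨e, he⟩ := hparent q hq
      exact ⟨e, fun _ => he⟩
    · obtain ⟨y, rfl⟩ := Quotient.exists_rep q
      exact ⟨(y, y), fun h => absurd h hq⟩
  choose e he using hparent'
  let F : CycleForest σ :=
    { Q := Quotient (Equiv.Perm.SameCycle.setoid σ)
      finQ := Fintype.ofFinite _
      cyc := Quotient.mk _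
      cyc_eq := fun x y => Quotient.eq (r := Equiv.Perm.SameCycle.setoid σ)
      r := fun q => ((Finite.equivFin _ q : ℕ) : ℝ) + 1
      r_pos := fun q => by positivity
      r_inj := fun q q' h => by
        have : ((Finite.equivFin _ q : ℕ) : ℝ) = (Finite.equivFin _ q' : ℕ) := by
          linarith
        exact (Finite.equivFin _).injective (Fin.ext (by exact_mod_cast this))
      d := d
      tail := fun q => (e q).1
      head := fun q => (e q).2
      cyc_head := fun q hq => (he q hq).1
      d_tail := fun q hq => (he q hq).2.2 }
  refine ⟨F.mat, fun y x hne => ?_, fun μ u hu hb => ?_⟩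
  · by_contra hA
    apply hne
    have h1 : σ x ≠ y := by rintro rfl; exact hA (hσ x)
    simp only [CycleForest.mat, of_apply, if_neg h1, zero_add]
    refine Finset.sum_eq_zero fun q _ => if_neg ?_
    rintro ⟨hq, rfl, rfl⟩
    exact hA (he q hq).2.1
  · by_contra hu0
    obtain ⟨q, hq, hne⟩ := F.exists_root_ne_zero hu hu0
    have hmem : q ∈ cycleLevel Abar σ b (d q) := Nat.find_spec (hlevel q)
    rw [show d q = 0 from hq] at hmem
    obtain ⟨i, hi⟩ := hmem
    exact hne (b i) hi.symm (hb i)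

theorem exists_realization_eq {α β : Type*} {P : Matrix α β Bool} {M : Matrix α β ℝ}
    (h : ∀ y x, M y x ≠ 0 → P y x = true) : ∃ θ, realization P θ = M := by
  refine ⟨fun e => M e.1.1 e.1.2, ?_⟩
  ext y x
  simp only [realization, of_apply]
  split_ifs with hP
  · rfl
  · by_contra h0
    exact hP (h y x (fun h' => h0 h'.symm))

theorem controllable_unitInput {n p : ℕ} {A : Matrix (Fin n) (Fin n) ℝ} {b : Fin p → Fin n}
    (h : ExcitesAllModes A b) : Controllable A (unitInput b) := by
  refine controllable_of_left_eigenvector _ _ fun μ u hu hB => h μ u hu fun i => ?_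
  have := congrFun hB i
  simpa [Matrix.vecMul, dotProduct, complexify, unitInput] using this

theorem unitInput_pattern {n p : ℕ} (b : Fin p → Fin n) :
    ∀ y i, unitInput b y i ≠ 0 → inputPattern b y i = true := by
  intro y i h
  by_contra h'
  simp [unitInput, inputPattern] at h h'
  exact h' h

/-- Lin's theorem under a perfect state matching. -/
theorem structurallyControllable_of_reach {n p : ℕ} {Abar : Matrix (Fin n) (Fin n) Bool}
    {b : Fin p → Fin n} (hA : HasPerfectStateMatching Abar)
    (hreach : ∀ y, ∃ i, Relation.ReflTransGen (fun x y => Abar y x = true) (b i) y) :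
    StructurallyControllable Abar (inputPattern b) := by
  obtain ⟨A, hP, hex⟩ := exists_excitesAllModes hA hreach
  obtain ⟨θA, rfl⟩ := exists_realization_eq hP
  obtain ⟨θB, hB⟩ := exists_realization_eq (unitInput_pattern b)
  exact ⟨θA, θB, by rw [hB]; exact controllable_unitInput hex⟩

/-! ### Minimum collections of actuators and sensors -/

theorem HasPerfectStateMatching.transpose {n : ℕ} {Abar : Matrix (Fin n) (Fin n) Bool}
    (h : HasPerfectStateMatching Abar) : HasPerfectStateMatching Abarᵀ := by
  obtain ⟨σ, hσ⟩ := h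
  exact ⟨σ⁻¹, fun x => by simpa using hσ (σ⁻¹ x)⟩

theorem observable_iff {n m : ℕ} (A : Matrix (Fin n) (Fin n) ℝ) (C : Matrix (Fin m) (Fin n) ℝ) :
    Observable A C ↔ Controllable Aᵀ Cᵀ := by
  have : (controllabilityMatrix Aᵀ Cᵀ) = (observabilityMatrix A C)ᵀ := by
    ext i q
    simp only [controllabilityMatrix, observabilityMatrix, of_apply, Matrix.transpose_apply]
    rw [← Matrix.transpose_pow, ← Matrix.transpose_mul, Matrix.transpose_apply]
  rw [Observable, Controllable, this, Matrix.rank_transpose]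

theorem transpose_realization {α β : Type*} (P : Matrix α β Bool)
    (θ : {e : α × β // P e.1 e.2 = true} → ℝ) : ∃ θ', realization Pᵀ θ' = (realization P θ)ᵀ :=
  exists_realization_eq fun y x h => by
    by_contra h'
    exact h (by simp only [Matrix.transpose_apply] at h' ⊢; simp [realization, h'])

theorem structurallyObservable_iff {n m : ℕ} (Abar : Matrix (Fin n) (Fin n) Bool)
    (c : Fin m → Fin n) : StructurallyObservable Abar (outputPattern c) ↔
      StructurallyControllable Abarᵀ (inputPattern c) := by
  constructor
  · rintro ⟨θA, θC, h⟩
    obtain ⟨θA', hA⟩ := transpose_realization _ θA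
    obtain ⟨θC', hC⟩ := transpose_realization _ θC
    rw [observable_iff, ← hA, ← hC] at h
    exact ⟨θA', θC', h⟩
  · rintro ⟨θA, θC, h⟩
    obtain ⟨θA', hA⟩ : ∃ θ, realization Abar θ = (realization Abarᵀ θA)ᵀ :=
      transpose_realization _ θA
    obtain ⟨θC', hC⟩ : ∃ θ, realization (outputPattern c) θ = (realization (inputPattern c) θC)ᵀ :=
      transpose_realization _ θC
    refine ⟨θA', θC', ?_⟩
    rw [observable_iff, hA, hC]
    exact h

theorem IsMinimumSensing.transpose {n m : ℕ} {Abar : Matrix (Fin n) (Fin n) Bool}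
    {c : Fin m → Fin n} (h : IsMinimumSensing Abar c) : IsMinimumActuation Abarᵀ c :=
  ⟨(structurallyObservable_iff _ _).mp h.1,
    fun m' c' h' => h.2 m' c' ((structurallyObservable_iff _ _).mpr h')⟩

/-- The states that can reach a state which only actuator `i` can reach. -/
theorem IsMinimumActuation.exists_private_set {n p : ℕ} {Abar : Matrix (Fin n) (Fin n) Bool}
    {b : Fin p → Fin n} (hA : HasPerfectStateMatching Abar) (h : IsMinimumActuation Abar b)
    (i : Fin p) : ∃ S : Set (Fin n), S.Nonempty ∧
      (∀ x y, Abar y x = true → y ∈ S → x ∈ S) ∧ ∀ i', i' ≠ i → b i' ∉ S := by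
  obtain ⟨p', rfl⟩ : ∃ p', p = p' + 1 := ⟨p - 1, by have := i.2; omega⟩
  have hn : ¬ StructurallyControllable Abar (inputPattern (b ∘ i.succAbove)) := fun h' => by
    have := h.2 _ _ h'
    omega
  have hy : ¬ ∀ y, ∃ i', Relation.ReflTransGen (fun x y => Abar y x = true)
      ((b ∘ i.succAbove) i') y := fun h' => hn (structurallyControllable_of_reach hA h')
  push Not at hy
  obtain ⟨y, hy⟩ := hy
  refine ⟨{x | Relation.ReflTransGen (fun x y => Abar y x = true) x y}, ⟨y, .refl⟩,
    fun x z he hz => Relation.ReflTransGen.head he hz, fun i' hi' hmem => ?_⟩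
  obtain ⟨l, rfl⟩ := Fin.exists_succAbove_eq hi'
  exact hy l hmem

theorem IsMinimumActuation.injective {n p : ℕ} {Abar : Matrix (Fin n) (Fin n) Bool}
    {b : Fin p → Fin n} (hA : HasPerfectStateMatching Abar) (h : IsMinimumActuation Abar b) :
    Function.Injective b := by
  intro i i' hb
  by_contra hne
  obtain ⟨S, ⟨y, hy⟩, hpred, hS⟩ := h.exists_private_set hA i
  obtain ⟨l, hl⟩ := exists_reach_of_structurallyControllable h.1 y
  have hback : ∀ z, Relation.ReflTransGen (fun x y => Abar y x = true) z y → z ∈ S := by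
    intro z hz
    induction hz using Relation.ReflTransGen.head_induction_on with
    | refl => exact hy
    | head he _ ih => exact hpred _ _ he ih
  have hlS : b l ∈ S := hback _ hl
  by_cases hli : l = i
  · subst hli
    exact hS i' (Ne.symm hne) (hb ▸ hlS)
  · exact hS l hli hlS

theorem reach_transpose {n : ℕ} {Abar : Matrix (Fin n) (Fin n) Bool} {x y : Fin n} :
    Relation.ReflTransGen (fun x y => Abarᵀ y x = true) x y ↔
      Relation.ReflTransGen (fun x y => Abar y x = true) y x :=
  Relation.reflTransGen_swap (r := fun x y => Abar y x = true)

/-- Reachability among the states. -/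
def StateReach {n : ℕ} (Abar : Matrix (Fin n) (Fin n) Bool) : Fin n → Fin n → Prop :=
  Relation.ReflTransGen fun x y => Abar y x = true

theorem reaches_iff {n p m : ℕ} {Abar : Matrix (Fin n) (Fin n) Bool} {b : Fin p → Fin n}
    {c : Fin m → Fin n} {i : Fin p} {j : Fin m} :
    Reaches Abar b c i j ↔ StateReach Abar (b i) (c j) := by
  constructor
  · intro h
    have key : ∀ v, Relation.TransGen (SystemEdge Abar (inputPattern b) (outputPattern c))
        (.input i) v → (∀ x, v = .state x → StateReach Abar (b i) x) ∧
          (∀ j, v = .output j → StateReach Abar (b i) (c j)) ∧ (∀ i', v ≠ .input i') := by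
      intro v hv
      induction hv with
      | single he =>
        cases he with
        | inputState _ x hx =>
          simp only [inputPattern, of_apply, decide_eq_true_eq] at hx
          refine ⟨fun y hy => ?_, by simp, by simp⟩
          cases hy
          rw [hx]; exact .refl
      | tail _ he ih =>
        cases he with
        | stateState x y hxy =>
          refine ⟨fun z hz => ?_, by simp, by simp⟩
          cases hz
          exact (ih.1 x rfl).tail hxy
        | inputState j x hx => exact absurd rfl (ih.2.2 j)
        | stateOutput x j hx =>
          simp only [outputPattern, of_apply, decide_eq_true_eq] at hx
          refine ⟨by simp, fun l hl => ?_, by simp⟩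
          cases hl
          rw [hx]; exact ih.1 x rfl
    exact (key _ h).2.1 j rfl
  · intro h
    have hs : ∀ x, StateReach Abar (b i) x → Relation.TransGen
        (SystemEdge Abar (inputPattern b) (outputPattern c)) (.input i) (.state x) := by
      intro x hx
      induction hx with
      | refl => exact .single (.inputState i (b i) (by simp [inputPattern]))
      | tail _ he ih => exact ih.tail (.stateState _ _ he)
    exact (hs _ h).tail (.stateOutput (c j) j (by simp [outputPattern]))

theorem IsMinimumActuation.exists_reach {n p : ℕ} {Abar : Matrix (Fin n) (Fin n) Bool}
    {b : Fin p → Fin n} (h : IsMinimumActuation Abar b) (y : Fin n) :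
    ∃ i, StateReach Abar (b i) y :=
  exists_reach_of_structurallyControllable h.1 y

theorem IsMinimumSensing.exists_reach {n m : ℕ} {Abar : Matrix (Fin n) (Fin n) Bool}
    {c : Fin m → Fin n} (h : IsMinimumSensing Abar c) (x : Fin n) :
    ∃ j, StateReach Abar x (c j) := by
  obtain ⟨j, hj⟩ := h.transpose.exists_reach x
  exact ⟨j, reach_transpose.mp hj⟩

end ResilientControl

namespace ResilientControl

open Matrix MeasureTheory

/-! ### Zero sets of polynomial functions -/

/-- A function that is polynomial on every line through a point where it does not vanish is nonzero
almost everywhere. The homotheties `t • Z` of its zero set `Z` about that point cover each point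
only finitely often, so by Fubini's theorem almost all of them, hence `Z`, are null sets. -/
theorem ae_ne_zero_of_polynomial {E : Type*} [NormedAddCommGroup E] [NormedSpace ℝ E]
    [MeasurableSpace E] [BorelSpace E] [FiniteDimensional ℝ E] (μ : Measure E) [μ.IsAddHaarMeasure]
    (f : E → ℝ) (hf : Continuous f) (x₀ : E) (h₀ : f x₀ ≠ 0)
    (hp : ∀ x, ∃ P : Polynomial ℝ, ∀ t : ℝ, f (x₀ + t • x) = P.eval t) : ∀ᵐ x ∂μ, f x ≠ 0 := by
  have hmeas : MeasurableSet {z : ℝ × E | f (x₀ + z.1 • z.2) ≠ 0} :=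
    (isOpen_ne_fun (by fun_prop) continuous_const).measurableSet
  have h1 : ∀ᵐ x ∂μ, ∀ᵐ t : ℝ, f (x₀ + t • x) ≠ 0 := by
    refine Filter.Eventually.of_forall fun x => ?_
    obtain ⟨P, hP⟩ := hp x
    have hP0 : P ≠ 0 := by
      rintro rfl
      have := hP 0
      simp at this
      exact h₀ this
    have hfin := Polynomial.finite_setOfPred_isRoot hP0
    refine Filter.mem_of_superset (hfin.countable.ae_notMem volume) fun t ht => ?_
    simpa [hP, Polynomial.IsRoot] using ht
  have h2 : ∀ᵐ t : ℝ, ∀ᵐ x ∂μ, f (x₀ + t • x) ≠ 0 :=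
    (Measure.ae_ae_comm (p := fun (t : ℝ) (x : E) => f (x₀ + t • x) ≠ 0) hmeas).mpr h1
  obtain ⟨t, ht, ht0⟩ := (h2.and (Measure.ae_ne volume 0)).exists
  rw [ae_iff] at ht ⊢
  have h3 := Measure.addHaar_preimage_smul μ ht0 {x : E | ¬ f (x₀ + x) ≠ 0}
  rw [show ((fun x => t • x) ⁻¹' {x : E | ¬ f (x₀ + x) ≠ 0}) = {x | ¬ f (x₀ + t • x) ≠ 0} from rfl,
    ht, eq_comm, mul_eq_zero] at h3
  have h4 : μ {x : E | ¬ f (x₀ + x) ≠ 0} = 0 := by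
    refine h3.resolve_left ?_
    rw [ENNReal.ofReal_eq_zero, not_le]
    positivity
  rw [← measure_preimage_add μ x₀]
  exact h4

/-! ### Matrices without common eigenvalue -/

/-- The matrix of the Sylvester operator `X ↦ M₁ X - X M₂`. -/
def sylvester {R : Type*} [CommRing R] {n : ℕ} (M₁ M₂ : Matrix (Fin n) (Fin n) R) :
    Matrix (Fin n × Fin n) (Fin n × Fin n) R :=
  kroneckerMap (fun x y => x * y) 1 M₁ - kroneckerMap (fun x y => x * y) M₂ᵀ 1

theorem sylvester_map {R S : Type*} [CommRing R] [CommRing S] {n : ℕ} (φ : R →+* S)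
    (M₁ M₂ : Matrix (Fin n) (Fin n) R) :
    (sylvester M₁ M₂).map φ = sylvester (M₁.map φ) (M₂.map φ) := by
  ext ⟨i, j⟩ ⟨k, l⟩
  simp [sylvester, kroneckerMap_apply, Matrix.one_apply, apply_ite φ]

theorem sylvester_mulVec_vec {n : ℕ} (M₁ M₂ X : Matrix (Fin n) (Fin n) ℂ) :
    sylvester M₁ M₂ *ᵥ X.vec = (M₁ * X - X * M₂).vec := by
  rw [sylvester, Matrix.sub_mulVec, kronecker_mulVec_vec, kronecker_mulVec_vec, vec_sub]
  simp

theorem exists_left_eigenvector {n : ℕ} {M : Matrix (Fin n) (Fin n) ℂ} {μ : ℂ}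
    (h : μ ∈ spectrum ℂ M) : ∃ u : Fin n → ℂ, u ≠ 0 ∧ u ᵥ* M = μ • u := by
  rw [spectrum.mem_iff, Matrix.isUnit_iff_isUnit_det, isUnit_iff_ne_zero, not_not,
    ← Matrix.exists_vecMul_eq_zero_iff] at h
  obtain ⟨u, hu, h⟩ := h
  refine ⟨u, hu, ?_⟩
  rw [Matrix.vecMul_sub, sub_eq_zero, Matrix.algebraMap_eq_diagonal] at h
  rw [← h]
  ext i
  simp [Matrix.vecMul_diagonal, mul_comm]

theorem exists_right_eigenvector {n : ℕ} {M : Matrix (Fin n) (Fin n) ℂ} {μ : ℂ}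
    (h : μ ∈ spectrum ℂ M) : ∃ v : Fin n → ℂ, v ≠ 0 ∧ M *ᵥ v = μ • v := by
  rw [spectrum.mem_iff, Matrix.isUnit_iff_isUnit_det, isUnit_iff_ne_zero, not_not,
    ← Matrix.exists_mulVec_eq_zero_iff] at h
  obtain ⟨u, hu, h⟩ := h
  refine ⟨u, hu, ?_⟩
  rw [Matrix.sub_mulVec, sub_eq_zero, Matrix.algebraMap_eq_diagonal] at h
  rw [← h]
  ext i
  simp [Matrix.mulVec_diagonal]

theorem mem_spectrum_of_left_eigenvector {n : ℕ} {M : Matrix (Fin n) (Fin n) ℂ} {μ : ℂ}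
    {u : Fin n → ℂ} (hu : u ≠ 0) (h : u ᵥ* M = μ • u) : μ ∈ spectrum ℂ M := by
  rw [spectrum.mem_iff, Matrix.isUnit_iff_isUnit_det, isUnit_iff_ne_zero, not_not,
    ← Matrix.exists_vecMul_eq_zero_iff]
  refine ⟨u, hu, ?_⟩
  rw [Matrix.vecMul_sub, h, sub_eq_zero, Matrix.algebraMap_eq_diagonal]
  ext i
  simp [Matrix.vecMul_diagonal, mul_comm]

theorem det_sylvester_eq_zero {n : ℕ} {M₁ M₂ : Matrix (Fin n) (Fin n) ℂ} {μ : ℂ}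
    (h₁ : μ ∈ spectrum ℂ M₁) (h₂ : μ ∈ spectrum ℂ M₂) : (sylvester M₁ M₂).det = 0 := by
  obtain ⟨v, hv, hv'⟩ := exists_right_eigenvector h₁
  obtain ⟨u, hu, hu'⟩ := exists_left_eigenvector h₂
  rw [← Matrix.exists_mulVec_eq_zero_iff]
  refine ⟨(Matrix.vecMulVec v u).vec, ?_, ?_⟩
  · rw [Ne, vec_eq_zero_iff]
    intro h0
    obtain ⟨i, hi⟩ := Function.ne_iff.mp hv
    obtain ⟨j, hj⟩ := Function.ne_iff.mp hu
    have := congrFun (congrFun h0 i) j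
    simp [vecMulVec_apply] at this
    exact this.elim hi hj
  · rw [sylvester_mulVec_vec, vec_eq_zero_iff, Matrix.mul_vecMulVec, Matrix.vecMulVec_mul, hv', hu',
      Matrix.smul_vecMulVec, Matrix.vecMulVec_smul, sub_self]

theorem det_sylvester_ne_zero {n : ℕ} {M₁ M₂ : Matrix (Fin n) (Fin n) ℂ}
    (h : ∀ μ ∈ spectrum ℂ M₁, μ ∉ spectrum ℂ M₂) : (sylvester M₁ M₂).det ≠ 0 := by
  intro hdet
  rw [← Matrix.exists_mulVec_eq_zero_iff] at hdet
  obtain ⟨z, hz, hz'⟩ := hdet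
  obtain ⟨X, rfl⟩ := vec_bijective.2 z
  rw [Ne, vec_eq_zero_iff] at hz
  rw [sylvester_mulVec_vec, vec_eq_zero_iff, sub_eq_zero] at hz'
  have hpow : ∀ k : ℕ, M₁ ^ k * X = X * M₂ ^ k := by
    intro k
    induction k with
    | zero => simp
    | succ k ih => rw [pow_succ, Matrix.mul_assoc, hz', ← Matrix.mul_assoc, ih, Matrix.mul_assoc,
        ← pow_succ]
  have hp : ∀ q : Polynomial ℂ, Polynomial.aeval M₁ q * X = X * Polynomial.aeval M₂ q := by
    intro q
    simp only [Polynomial.aeval_eq_sum_range, Matrix.sum_mul, Matrix.mul_sum, Matrix.smul_mul,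
      Matrix.mul_smul, hpow]
  have h0 : Polynomial.aeval M₁ M₂.charpoly * X = 0 := by
    rw [hp, Matrix.aeval_self_charpoly, Matrix.mul_zero]
  obtain ⟨μ, v, hv, hv0, he⟩ := exists_eigenvector_mem (Matrix.toLin' M₁)
    (LinearMap.ker (Matrix.toLin' (Polynomial.aeval M₁ M₂.charpoly)))
    (by
      intro hbot
      apply hz
      ext i j
      have : X.col j ∈ LinearMap.ker (Matrix.toLin' (Polynomial.aeval M₁ M₂.charpoly)) := by
        rw [LinearMap.mem_ker, Matrix.toLin'_apply]
        ext i
        exact congrFun (congrFun h0 i) j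
      rw [hbot, Submodule.mem_bot] at this
      exact congrFun this i)
    (by
      intro v hv
      rw [LinearMap.mem_ker, Matrix.toLin'_apply] at hv ⊢
      rw [Matrix.toLin'_apply, Matrix.mulVec_mulVec]
      have : Polynomial.aeval M₁ M₂.charpoly * M₁ = M₁ * Polynomial.aeval M₁ M₂.charpoly := by
        nth_rw 2 [← Polynomial.aeval_X (R := ℂ) M₁]
        nth_rw 3 [← Polynomial.aeval_X (R := ℂ) M₁]
        rw [← map_mul, ← map_mul, mul_comm]
      rw [this, ← Matrix.mulVec_mulVec, hv, Matrix.mulVec_zero])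
  rw [LinearMap.mem_ker, Matrix.toLin'_apply] at hv
  rw [Matrix.toLin'_apply] at he
  have hpow' : ∀ k : ℕ, (M₁ ^ k) *ᵥ v = μ ^ k • v := by
    intro k
    induction k with
    | zero => simp
    | succ k ih => rw [pow_succ, ← Matrix.mulVec_mulVec, he, Matrix.mulVec_smul, ih, smul_smul,
        pow_succ, mul_comm]
  have hev : Polynomial.eval μ M₂.charpoly • v = 0 := by
    rw [← hv, Polynomial.aeval_eq_sum_range, Matrix.sum_mulVec, Polynomial.eval_eq_sum_range,
      Finset.sum_smul]
    refine Finset.sum_congr rfl fun k _ => ?_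
    rw [Matrix.smul_mulVec, hpow', smul_smul]
  have hroot : M₂.charpoly.IsRoot μ := (smul_eq_zero.mp hev).resolve_right hv0
  have h1 : μ ∈ spectrum ℂ M₁ := by
    rw [← Matrix.spectrum_toLin', ← Module.End.hasEigenvalue_iff_mem_spectrum]
    exact Module.End.hasEigenvalue_of_hasEigenvector
      ⟨Module.End.mem_eigenspace_iff.mpr (by rwa [Matrix.toLin'_apply]), hv0⟩
  exact h μ h1 (Matrix.mem_spectrum_iff_isRoot_charpoly.mpr hroot)

/-- If `M` is excited from the state `y` and, dually, observed at `x`, then the feedback from `x`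
to `y` moves every eigenvalue. -/
theorem not_mem_spectrum_add_single {n : ℕ} {M : Matrix (Fin n) (Fin n) ℝ} {x y : Fin n}
    (hy : ExcitesAllModes M fun _ : Fin 1 => y) (hx : ExcitesAllModes Mᵀ fun _ : Fin 1 => x)
    {μ : ℂ} (h₁ : μ ∈ spectrum ℂ (complexify M)) :
    μ ∉ spectrum ℂ (complexify (M + Matrix.single y x 1)) := by
  intro h₂
  obtain ⟨u, hu, hu'⟩ := exists_left_eigenvector h₁
  obtain ⟨v, hv, hv'⟩ := exists_right_eigenvector h₂
  have hmap : complexify (M + Matrix.single y x 1) = complexify M + Matrix.single y x 1 := by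
    rw [complexify, Matrix.map_add _ (fun a b => map_add Complex.ofRealHom a b), Matrix.map_single,
      map_one]
  rw [hmap] at hv'
  have hprod : u y * v x = 0 := by
    have h3 : u ⬝ᵥ (complexify M + Matrix.single y x 1) *ᵥ v = μ * (u ⬝ᵥ v) := by
      rw [hv', dotProduct_smul, smul_eq_mul]
    rw [Matrix.add_mulVec, dotProduct_add, Matrix.dotProduct_mulVec, hu', smul_dotProduct,
      smul_eq_mul, Matrix.single_mulVec, add_eq_left] at h3
    simpa [Function.update_apply, dotProduct, mul_comm] using h3
  rcases mul_eq_zero.mp hprod with h | h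
  · exact hu (hy μ u hu' fun _ => h)
  · refine hv (hx μ v ?_ fun _ => h)
    rw [Matrix.add_mulVec, Matrix.single_mulVec, h] at hv'
    rw [complexify, Matrix.transpose_map, Matrix.vecMul_transpose, ← hv']
    ext i
    simp

/-! ### Generic matrices with a strongly connected pattern -/

/-- The Kalman matrix over a commutative ring. -/
def kalman {R : Type*} [CommRing R] {n p : ℕ} (A : Matrix (Fin n) (Fin n) R)
    (B : Matrix (Fin n) (Fin p) R) : Matrix (Fin n) (Fin n × Fin p) R :=
  Matrix.of fun i q => (A ^ (q.1 : ℕ) * B) i q.2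

theorem kalman_map {R S : Type*} [CommRing R] [CommRing S] {n p : ℕ} (φ : R →+* S)
    (A : Matrix (Fin n) (Fin n) R) (B : Matrix (Fin n) (Fin p) R) :
    (kalman A B).map φ = kalman (A.map φ) (B.map φ) := by
  ext i q
  simp only [kalman, Matrix.map_apply, of_apply]
  rw [← Matrix.map_pow, ← Matrix.map_mul, Matrix.map_apply]

theorem controllable_iff_det {n p : ℕ} (A : Matrix (Fin n) (Fin n) ℝ)
    (B : Matrix (Fin n) (Fin p) ℝ) :
    Controllable A B ↔ (kalman A B * (kalman A B)ᵀ).det ≠ 0 := by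
  change (kalman A B).rank = n ↔ _
  rw [← Matrix.rank_self_mul_transpose, ← isUnit_iff_ne_zero, ← Matrix.isUnit_iff_isUnit_det]
  constructor
  · intro h
    rw [← Matrix.vecMul_injective_iff_isUnit, Matrix.vecMul_injective_iff,
      linearIndependent_iff_card_eq_finrank_span, Set.finrank, ← Matrix.rank_eq_finrank_span_row, h]
    simp
  · intro h
    simpa using Matrix.rank_of_isUnit _ h

/-- Controllability is generic along the line from `M₀` to `M₁`: the polynomial that detects it. -/
theorem exists_line_polynomial {n p : ℕ} (M₀ M₁ : Matrix (Fin n) (Fin n) ℝ)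
    (B : Matrix (Fin n) (Fin p) ℝ) : ∃ P : Polynomial ℝ, ∀ t,
      Controllable (M₀ + t • (M₁ - M₀)) B ↔ P.eval t ≠ 0 := by
  let L : Matrix (Fin n) (Fin n) (Polynomial ℝ) :=
    M₀.map Polynomial.C + (Polynomial.X : Polynomial ℝ) • (M₁ - M₀).map Polynomial.C
  refine ⟨(kalman L (B.map Polynomial.C) * (kalman L (B.map Polynomial.C))ᵀ).det, fun t => ?_⟩
  have h1 : L.map (Polynomial.evalRingHom t) = M₀ + t • (M₁ - M₀) := by
    ext i j; simp [L]
  have h2 : (B.map Polynomial.C).map (Polynomial.evalRingHom t) = B := by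
    ext i j; simp
  rw [controllable_iff_det, ← Polynomial.coe_evalRingHom, RingHom.map_det, RingHom.mapMatrix_apply,
    Matrix.map_mul, Matrix.transpose_map, kalman_map, h1, h2]

/-- If `M`'s pattern is strongly connected and has a perfect matching, some matrix is excited from
`y` and observed at `x`. -/
theorem exists_excites_observed {n : ℕ} {Mbar : Matrix (Fin n) (Fin n) Bool}
    (hM : HasPerfectStateMatching Mbar) (hconn : ∀ x y, StateReach Mbar x y) (x y : Fin n) :
    ∃ M : Matrix (Fin n) (Fin n) ℝ, (∀ z w, M z w ≠ 0 → Mbar z w = true) ∧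
      (ExcitesAllModes M fun _ : Fin 1 => y) ∧ ExcitesAllModes Mᵀ fun _ : Fin 1 => x := by
  obtain ⟨M₀, hP₀, h₀⟩ := exists_excitesAllModes (b := fun _ : Fin 1 => y) hM
    fun z => ⟨0, hconn y z⟩
  obtain ⟨M₁, hP₁, h₁⟩ := exists_excitesAllModes (b := fun _ : Fin 1 => x) hM.transpose
    fun z => ⟨0, reach_transpose.mpr (hconn z x)⟩
  obtain ⟨P₀, hQ₀⟩ := exists_line_polynomial M₀ M₁ᵀ (unitInput fun _ : Fin 1 => y)
  obtain ⟨P₁, hQ₁⟩ := exists_line_polynomial M₀ᵀ M₁ (unitInput fun _ : Fin 1 => x)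
  have hne₀ : P₀ ≠ 0 := by
    rintro rfl
    have := (hQ₀ 0).mp (by simpa using controllable_unitInput h₀)
    simp at this
  have hne₁ : P₁ ≠ 0 := by
    rintro rfl
    have := (hQ₁ 1).mp (by simpa using controllable_unitInput h₁)
    simp at this
  obtain ⟨t, ht⟩ : ∃ t, (P₀ * P₁).eval t ≠ 0 := by
    by_contra! h
    exact mul_ne_zero hne₀ hne₁ (Polynomial.funext fun r => by rw [h r]; simp)
  rw [Polynomial.eval_mul, mul_ne_zero_iff] at ht
  refine ⟨M₀ + t • (M₁ᵀ - M₀), fun z w hne => ?_,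
    excitesAllModes_of_controllable ((hQ₀ t).mpr ht.1), excitesAllModes_of_controllable ?_⟩
  · by_contra hb
    have e0 : M₀ z w = 0 := by by_contra h'; exact hb (hP₀ z w h')
    have e1 : M₁ w z = 0 := by by_contra h'; exact hb (hP₁ w z h')
    simp [e0, e1] at hne
  · have := (hQ₁ t).mpr ht.2
    simpa [Matrix.transpose_add, Matrix.transpose_smul, Matrix.transpose_sub] using this

end ResilientControl

namespace ResilientControl

open Matrix MeasureTheory

/-! ### Fixed modes and strong connectivity -/

theorem realization_add_smul {α β : Type*} (P : Matrix α β Bool)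
    (θ θ' : {e : α × β // P e.1 e.2 = true} → ℝ) (t : ℝ) :
    realization P (θ + t • θ') = realization P θ + t • realization P θ' := by
  ext i j
  simp only [realization, of_apply, Matrix.add_apply, Matrix.smul_apply]
  split_ifs <;> simp

theorem continuous_realization {α β : Type*} (P : Matrix α β Bool) :
    Continuous (realization P) := by
  refine continuous_matrix fun i j => ?_
  simp only [realization, of_apply]
  split_ifs
  · exact continuous_apply _
  · exact continuous_const

theorem isAddHaarMeasure_parameters {n p m : ℕ} (Abar : Matrix (Fin n) (Fin n) Bool)
    (Bbar : Matrix (Fin n) (Fin p) Bool) (Cbar : Matrix (Fin m) (Fin n) Bool) :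
    (volume : Measure (Parameters Abar Bbar Cbar)).IsAddHaarMeasure := by
  have hpi : ∀ (ι : Type) [Fintype ι], (volume : Measure (ι → ℝ)).IsAddHaarMeasure :=
    fun ι _ => inferInstance
  have h₁ := hpi {e : Fin n × Fin n // Abar e.1 e.2 = true}
  have h₂ := hpi {e : Fin n × Fin p // Bbar e.1 e.2 = true}
  have h₃ := hpi {e : Fin m × Fin n // Cbar e.1 e.2 = true}
  have h₂₃ : (volume : Measure (({e : Fin n × Fin p // Bbar e.1 e.2 = true} → ℝ) ×
      ({e : Fin m × Fin n // Cbar e.1 e.2 = true} → ℝ))).IsAddHaarMeasure :=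
    Measure.prod.instIsAddHaarMeasure _ _
  exact Measure.prod.instIsAddHaarMeasure _ _

/-- The closed loop of the realization `θ` with gains `G`. -/
def closedLoop {n p m : ℕ} {Abar : Matrix (Fin n) (Fin n) Bool}
    {Bbar : Matrix (Fin n) (Fin p) Bool} {Cbar : Matrix (Fin m) (Fin n) Bool}
    (G : Matrix (Fin p) (Fin m) ℝ) (θ : Parameters Abar Bbar Cbar) : Matrix (Fin n) (Fin n) ℝ :=
  realization Abar θ.1 + realization Bbar θ.2.1 * G * realization Cbar θ.2.2

/-- If two gains give closed loops without common eigenvalue for one realization, they do so for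
almost all realizations. -/
theorem ae_disjoint_spectrum {n p m : ℕ} {Abar : Matrix (Fin n) (Fin n) Bool}
    {Bbar : Matrix (Fin n) (Fin p) Bool} {Cbar : Matrix (Fin m) (Fin n) Bool}
    (G₁ G₂ : Matrix (Fin p) (Fin m) ℝ) (θ₀ : Parameters Abar Bbar Cbar)
    (h : ∀ μ ∈ spectrum ℂ (complexify (closedLoop G₁ θ₀)),
      μ ∉ spectrum ℂ (complexify (closedLoop G₂ θ₀))) :
    ∀ᵐ θ : Parameters Abar Bbar Cbar, ∀ μ ∈ spectrum ℂ (complexify (closedLoop G₁ θ)),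
      μ ∉ spectrum ℂ (complexify (closedLoop G₂ θ)) := by
  have hdet : ∀ θ : Parameters Abar Bbar Cbar,
      (sylvester (complexify (closedLoop G₁ θ)) (complexify (closedLoop G₂ θ))).det =
        Complex.ofRealHom (sylvester (closedLoop G₁ θ) (closedLoop G₂ θ)).det := by
    intro θ
    rw [RingHom.map_det, RingHom.mapMatrix_apply, sylvester_map]
  have hcont : Continuous fun θ : Parameters Abar Bbar Cbar =>
      (sylvester (closedLoop G₁ θ) (closedLoop G₂ θ)).det := by
    have hcl : ∀ G : Matrix (Fin p) (Fin m) ℝ,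
        Continuous fun θ : Parameters Abar Bbar Cbar => closedLoop G θ := fun G =>
      ((continuous_realization Abar).comp continuous_fst).add
        ((((continuous_realization Bbar).comp (continuous_fst.comp continuous_snd)).matrix_mul
          continuous_const).matrix_mul
            ((continuous_realization Cbar).comp (continuous_snd.comp continuous_snd)))
    refine Continuous.matrix_det (continuous_matrix fun x y => ?_)
    simp only [sylvester, Matrix.sub_apply, kroneckerMap_apply, Matrix.transpose_apply]
    exact (continuous_const.mul ((hcl G₁).matrix_elem _ _)).sub
      (((hcl G₂).matrix_elem _ _).mul continuous_const)
  have := isAddHaarMeasure_parameters Abar Bbar Cbar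
  have hae := ae_ne_zero_of_polynomial (volume : Measure (Parameters Abar Bbar Cbar)) _ hcont θ₀
    (by
      have h0 := det_sylvester_ne_zero h
      rw [hdet] at h0
      intro h'
      rw [h', map_zero] at h0
      exact h0 rfl)
    (fun θ => by
      let line : {α β : Type} → [Fintype α] → [Fintype β] → Matrix α β ℝ → Matrix α β ℝ →
          Matrix α β (Polynomial ℝ) := fun M N =>
        M.map Polynomial.C + (Polynomial.X : Polynomial ℝ) • N.map Polynomial.C
      have hline : ∀ {α β : Type} [Fintype α] [Fintype β] (M N : Matrix α β ℝ) (t : ℝ),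
          (line M N).map (Polynomial.evalRingHom t) = M + t • N := by
        intro α β _ _ M N t
        ext i j
        simp only [line, Matrix.map_apply, Matrix.add_apply, Matrix.smul_apply, smul_eq_mul,
          Polynomial.coe_evalRingHom, Polynomial.eval_add, Polynomial.eval_mul, Polynomial.eval_C,
          Polynomial.eval_X]
      let loop : Matrix (Fin p) (Fin m) ℝ → Matrix (Fin n) (Fin n) (Polynomial ℝ) := fun G =>
        line (realization Abar θ₀.1) (realization Abar θ.1) +
          line (realization Bbar θ₀.2.1) (realization Bbar θ.2.1) * G.map Polynomial.C *
            line (realization Cbar θ₀.2.2) (realization Cbar θ.2.2)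
      have hloop : ∀ G t, (loop G).map (Polynomial.evalRingHom t) =
          closedLoop G (θ₀ + t • θ) := by
        intro G t
        have hG : (G.map Polynomial.C).map (Polynomial.evalRingHom t) = G := by ext i j; simp
        simp only [loop, closedLoop]
        rw [Matrix.map_add _ (fun a b => map_add (Polynomial.evalRingHom t) a b), Matrix.map_mul,
          Matrix.map_mul, hline, hline, hline, hG]
        simp only [Prod.fst_add, Prod.snd_add, Prod.smul_fst, Prod.smul_snd, realization_add_smul]
      refine ⟨(sylvester (loop G₁) (loop G₂)).det, fun t => ?_⟩
      rw [← Polynomial.coe_evalRingHom, RingHom.map_det, RingHom.mapMatrix_apply, sylvester_map,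
        hloop, hloop])
  filter_upwards [hae] with θ hθ μ h₁ h₂
  have h0 := det_sylvester_eq_zero h₁ h₂
  rw [hdet] at h0
  exact hθ (by simpa using h0)

/-- Edges of the closed loop between states: those of the state digraph, and those through the
links in `K`. -/
def LoopEdge {n p m : ℕ} (Abar : Matrix (Fin n) (Fin n) Bool) (b : Fin p → Fin n)
    (c : Fin m → Fin n) (K : Finset (Fin m × Fin p)) (x y : Fin n) : Prop :=
  Abar y x = true ∨ ∃ e ∈ K, c e.1 = x ∧ b e.2 = y

theorem unitInput_mul_apply {n p m : ℕ} {b : Fin p → Fin n} {c : Fin m → Fin n}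
    (G : Matrix (Fin p) (Fin m) ℝ) (y x : Fin n) :
    (unitInput b * G * (unitInput c)ᵀ) y x =
      ∑ j, ∑ i, if b i = y ∧ c j = x then G i j else 0 := by
  rw [Matrix.mul_apply]
  refine Finset.sum_congr rfl fun j _ => ?_
  rw [Matrix.mul_apply, Finset.sum_mul]
  refine Finset.sum_congr rfl fun i _ => ?_
  by_cases h₁ : b i = y <;> by_cases h₂ : c j = x <;> simp [unitInput, h₁, h₂]

theorem unitInput_mul_apply_of_injective {n p m : ℕ} {b : Fin p → Fin n} {c : Fin m → Fin n}
    (hb : Function.Injective b) (hc : Function.Injective c)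
    (G : Matrix (Fin p) (Fin m) ℝ) (i : Fin p) (j : Fin m) :
    (unitInput b * G * (unitInput c)ᵀ) (b i) (c j) = G i j := by
  rw [unitInput_mul_apply, Finset.sum_eq_single j, Finset.sum_eq_single i]
  · simp
  · intro i' _ h'; rw [if_neg]; rintro ⟨h, -⟩; exact h' (hb h)
  · simp
  · intro j' _ h'
    refine Finset.sum_eq_zero fun i' _ => ?_
    rw [if_neg]; rintro ⟨-, h⟩; exact h' (hc h)
  · simp

/-- A structural system with a perfect state matching whose closed loop is strongly connected has no
structurally fixed modes. -/
theorem ae_fixedModes_eq_empty {n p m : ℕ} {Abar : Matrix (Fin n) (Fin n) Bool} {b : Fin p → Fin n}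
    {c : Fin m → Fin n} (hA : HasPerfectStateMatching Abar) (hb : Function.Injective b)
    (hc : Function.Injective c) (K J : Finset (Fin m × Fin p))
    (hconn : ∀ x y, Relation.ReflTransGen (LoopEdge Abar b c (K \ J)) x y)
    (hne : 0 < n → (K \ J).Nonempty) :
    ∀ᵐ θ : Parameters Abar (inputPattern b) (outputPattern c),
      (⋂ G ∈ admissibleGains K J, spectrum ℂ ((realization Abar θ.1 +
        realization (inputPattern b) θ.2.1 * G * realization (outputPattern c) θ.2.2).map
          Complex.ofReal)) = ∅ := by
  classical
  rcases Nat.eq_zero_or_pos n with rfl | hn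
  · refine Filter.Eventually.of_forall fun θ => Set.eq_empty_of_forall_notMem fun μ hμ => ?_
    rw [Set.mem_iInter₂] at hμ
    exact hμ 0 (fun i j _ => rfl) (isUnit_of_subsingleton _)
  obtain ⟨⟨j₀, i₀⟩, h₀⟩ := hne hn
  let Mbar : Matrix (Fin n) (Fin n) Bool := Matrix.of fun y x => decide (LoopEdge Abar b c (K \ J) x y)
  have hMbar : ∀ y x, Mbar y x = true ↔ LoopEdge Abar b c (K \ J) x y := fun y x => by simp [Mbar]
  obtain ⟨M, hM, hMy, hMx⟩ := exists_excites_observed (Mbar := Mbar)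
    (by
      obtain ⟨σ, hσ⟩ := hA
      exact ⟨σ, fun x => (hMbar _ _).mpr (Or.inl (hσ x))⟩)
    (fun x y => Relation.ReflTransGen.mono (fun x y h => (hMbar y x).mpr h) _ _ (hconn x y)) (c j₀) (b i₀)
  -- split `M` into a realization of `Abar` and a feedback term
  let A₀ : Matrix (Fin n) (Fin n) ℝ := Matrix.of fun y x => if Abar y x = true then M y x else 0
  let G : Matrix (Fin p) (Fin m) ℝ := Matrix.of fun i j =>
    if (j, i) ∈ K \ J ∧ ¬ Abar (b i) (c j) = true then M (b i) (c j) else 0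
  have hsplit : A₀ + unitInput b * G * (unitInput c)ᵀ = M := by
    ext y x
    rw [Matrix.add_apply]
    by_cases hyx : ∃ i j, b i = y ∧ c j = x ∧ (j, i) ∈ K \ J
    · obtain ⟨i, j, rfl, rfl, hmem⟩ := hyx
      rw [unitInput_mul_apply_of_injective hb hc]
      by_cases h : Abar (b i) (c j) = true
      · simp [A₀, G, h]
      · simp [A₀, G, h, Finset.mem_sdiff.mp hmem]
    · rw [unitInput_mul_apply, Finset.sum_eq_zero, add_zero]
      · by_cases h : Abar y x = true
        · simp [A₀, h]
        · simp only [A₀, of_apply, if_neg h]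
          by_contra h'
          rcases (hMbar y x).mp (hM y x (Ne.symm h')) with h1 | ⟨e, he, h1, h2⟩
          · exact h h1
          · exact hyx ⟨e.2, e.1, h2, h1, he⟩
      · intro j _
        refine Finset.sum_eq_zero fun i _ => ?_
        split_ifs with h
        · simp only [G, of_apply]
          rw [if_neg]
          rintro ⟨h', -⟩
          exact hyx ⟨i, j, h.1, h.2, h'⟩
        · rfl
  obtain ⟨θA, hθA⟩ := exists_realization_eq (P := Abar) (M := A₀) fun y x h => by
    by_contra h'; simp [A₀, h'] at h
  obtain ⟨θB, hθB⟩ := exists_realization_eq (unitInput_pattern b)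
  obtain ⟨θC, hθC⟩ := exists_realization_eq (P := outputPattern c) (M := (unitInput c)ᵀ)
    fun j x h => unitInput_pattern c x j h
  let G' := G + Matrix.single i₀ j₀ 1
  have hG' : A₀ + unitInput b * G' * (unitInput c)ᵀ = M + Matrix.single (b i₀) (c j₀) 1 := by
    rw [← hsplit, add_assoc, Matrix.mul_add, Matrix.add_mul]
    congr 2
    ext y x
    rw [unitInput_mul_apply, Finset.sum_eq_single j₀, Finset.sum_eq_single i₀]
    · by_cases h₁ : b i₀ = y <;> by_cases h₂ : c j₀ = x <;> simp [h₁, h₂]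
    · intro i _ hi; simp [hi.symm]
    · simp
    · intro j _ hj
      refine Finset.sum_eq_zero fun i _ => ?_
      simp [hj.symm]
    · simp
  have hadm : G ∈ admissibleGains K J ∧ G' ∈ admissibleGains K J := by
    have h1 : G ∈ admissibleGains K J := by
      intro i j h
      simp only [G, of_apply]
      rw [if_neg]
      rintro ⟨h', -⟩
      rw [Finset.mem_sdiff] at h'
      exact h.elim (fun h => h h'.1) h'.2
    refine ⟨h1, fun i j h => ?_⟩
    have h2 : ¬ (i₀ = i ∧ j₀ = j) := by
      rintro ⟨rfl, rfl⟩
      rw [Finset.mem_sdiff] at h₀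
      exact h.elim (fun h => h h₀.1) h₀.2
    change (G + Matrix.single i₀ j₀ (1 : ℝ) : Matrix (Fin p) (Fin m) ℝ) i j = 0
    rw [Matrix.add_apply, h1 i j h, Matrix.single_apply, if_neg h2, add_zero]
  have hae := ae_disjoint_spectrum (Abar := Abar) (Bbar := inputPattern b)
    (Cbar := outputPattern c) G G' (θA, θB, θC) (by
      intro μ h1
      simp only [closedLoop, hθA, hθB, hθC, hsplit, hG'] at h1 ⊢
      exact not_mem_spectrum_add_single hMy hMx h1)
  filter_upwards [hae] with θ hθ
  refine Set.eq_empty_of_forall_notMem fun μ hμ => ?_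
  rw [Set.mem_iInter₂] at hμ
  exact hθ μ (hμ G hadm.1) (hμ G' hadm.2)

/-- A pattern all of whose closed loops after at most `k` failures are strongly connected has almost
never a resilient fixed mode. -/
theorem ae_fixedModesAt_eq_empty {n p m : ℕ} {Abar : Matrix (Fin n) (Fin n) Bool}
    {b : Fin p → Fin n} {c : Fin m → Fin n} (hA : HasPerfectStateMatching Abar)
    (hb : Function.Injective b) (hc : Function.Injective c) (k : ℕ) (K : Finset (Fin m × Fin p))
    (hconn : ∀ J ⊆ K, J.card ≤ k → ∀ x y, Relation.ReflTransGen (LoopEdge Abar b c (K \ J)) x y)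
    (hne : 0 < n → ∀ J ⊆ K, J.card ≤ k → (K \ J).Nonempty) :
    ∀ᵐ θ : Parameters Abar (inputPattern b) (outputPattern c),
      fixedModesAt θ K (failures k K) = ∅ := by
  have h : ∀ᵐ θ : Parameters Abar (inputPattern b) (outputPattern c), ∀ J : Finset (Fin m × Fin p),
      J ∈ failures k K → (⋂ G ∈ admissibleGains K J, spectrum ℂ ((realization Abar θ.1 +
        realization (inputPattern b) θ.2.1 * G * realization (outputPattern c) θ.2.2).map
          Complex.ofReal)) = ∅ := by
    rw [ae_all_iff]
    intro J
    by_cases hJ : J ∈ failures k K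
    · filter_upwards [ae_fixedModes_eq_empty hA hb hc K J (hconn J hJ.1 hJ.2)
        (fun hn => hne hn J hJ.1 hJ.2)] with θ hθ _ using hθ
    · exact Filter.Eventually.of_forall fun θ h => absurd h hJ
  filter_upwards [h] with θ hθ
  simp only [fixedModesAt, resilientFixedModes, Set.iUnion_eq_empty]
  exact hθ

theorem isResilient_of_ae {n p m : ℕ} {Abar : Matrix (Fin n) (Fin n) Bool} {b : Fin p → Fin n}
    {c : Fin m → Fin n} {k : ℕ} {K : Finset (Fin m × Fin p)}
    (h : ∀ᵐ θ : Parameters Abar (inputPattern b) (outputPattern c),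
      fixedModesAt θ K (failures k K) = ∅) : IsResilient Abar b c k K := by
  intro h'
  have := isAddHaarMeasure_parameters Abar (inputPattern b) (outputPattern c)
  have hne : (ae (volume : Measure (Parameters Abar (inputPattern b) (outputPattern c)))).NeBot :=
    ae_neBot.mpr fun h0 => by
      have := isOpen_univ.measure_pos
        (volume : Measure (Parameters Abar (inputPattern b) (outputPattern c))) ⟨0, trivial⟩
      rw [h0] at this
      simp at this
  obtain ⟨θ, hθ, hθ'⟩ := (h.and h').exists
  rw [hθ] at hθ'
  exact Set.not_nonempty_empty hθ'

/-! ### The number of links of a resilient pattern -/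

/-- The modes of a nonempty set `S` of states that has no incoming edges, and no working
links into its actuators, are fixed. -/
theorem nonempty_iInter_of_closed {n p m : ℕ} {A : Matrix (Fin n) (Fin n) ℝ}
    {B : Matrix (Fin n) (Fin p) ℝ} {C : Matrix (Fin m) (Fin n) ℝ} (𝒢 : Set (Matrix (Fin p) (Fin m) ℝ))
    {S : Set (Fin n)} (hS : S.Nonempty) (hA : ∀ y ∈ S, ∀ x ∉ S, A y x = 0)
    (hB : ∀ G ∈ 𝒢, ∀ y ∈ S, ∀ x, (B * G * C) y x = 0) :
    (⋂ G ∈ 𝒢, spectrum ℂ ((A + B * G * C).map Complex.ofReal)).Nonempty := by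
  classical
  let W : Submodule ℂ (Fin n → ℂ) :=
    { carrier := {u | ∀ x ∉ S, u x = 0}
      add_mem' := fun hu hv x hx => by simp [hu x hx, hv x hx]
      zero_mem' := fun _ _ => rfl
      smul_mem' := fun a u hu x hx => by simp [hu x hx] }
  obtain ⟨y, hy⟩ := hS
  obtain ⟨μ, u, hu, hu0, he⟩ := exists_eigenvector_mem (Matrix.vecMulLinear (complexify A)) W
    (fun hbot => by
      have : (Pi.single y 1 : Fin n → ℂ) ∈ W := fun x hx => by
        rw [Pi.single_eq_of_ne]; rintro rfl; exact hx hy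
      rw [hbot, Submodule.mem_bot] at this
      simpa using congrFun this y)
    (fun u hu x hx => by
      change ∑ z, u z * complexify A z x = 0
      refine Finset.sum_eq_zero fun z _ => ?_
      by_cases hz : z ∈ S
      · simp [hA z hz x hx]
      · simp [hu z hz])
  refine ⟨μ, Set.mem_iInter₂.mpr fun G hG => mem_spectrum_of_left_eigenvector hu0 ?_⟩
  rw [← he, Matrix.vecMulLinear_apply]
  ext x
  change ∑ z, u z * (A + B * G * C).map Complex.ofReal z x = ∑ z, u z * complexify A z x
  refine Finset.sum_congr rfl fun z _ => ?_
  by_cases hz : z ∈ S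
  · simp [hB G hG z hz x]
  · rw [hu z hz, zero_mul, zero_mul]

theorem IsResilient.lt_card_actuator {n p m : ℕ} {Abar : Matrix (Fin n) (Fin n) Bool}
    {b : Fin p → Fin n} {c : Fin m → Fin n} {k : ℕ} {K : Finset (Fin m × Fin p)}
    (hA : HasPerfectStateMatching Abar) (hb : IsMinimumActuation Abar b)
    (hK : IsResilient Abar b c k K) (i : Fin p) : k < (K.filter fun e => e.2 = i).card := by
  by_contra! hcard
  obtain ⟨S, hS, hpred, hpriv⟩ := hb.exists_private_set hA i
  refine hK (Filter.Eventually.of_forall fun θ => ?_)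
  obtain ⟨μ, hμ⟩ := nonempty_iInter_of_closed (A := realization Abar θ.1)
    (B := realization (inputPattern b) θ.2.1) (C := realization (outputPattern c) θ.2.2)
    (admissibleGains K (K.filter fun e => e.2 = i)) hS
    (fun y hy x hx => by
      have : ¬ Abar y x = true := fun h => hx (hpred x y h hy)
      simp [realization, this])
    (fun G hG y hy x => by
      rw [Matrix.mul_assoc, Matrix.mul_apply]
      refine Finset.sum_eq_zero fun i' _ => ?_
      by_cases hi : i' = i
      · subst hi
        rw [Matrix.mul_apply, Finset.sum_eq_zero, mul_zero]
        intro j _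
        rw [hG i' j, zero_mul]
        by_cases h : (j, i') ∈ K
        · exact Or.inr (by simp [h])
        · exact Or.inl h
      · have : ¬ b i' = y := fun h => hpriv i' hi (h ▸ hy)
        simp [realization, inputPattern, this])
  exact ⟨μ, Set.mem_biUnion (show _ ∈ failures k K from ⟨Finset.filter_subset _ _, hcard⟩) hμ⟩

theorem spectrum_transpose {n : ℕ} (M : Matrix (Fin n) (Fin n) ℂ) :
    spectrum ℂ Mᵀ = spectrum ℂ M := by
  ext μ
  rw [Matrix.mem_spectrum_iff_isRoot_charpoly, Matrix.mem_spectrum_iff_isRoot_charpoly,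
    Matrix.charpoly_transpose]

theorem IsResilient.lt_card_sensor {n p m : ℕ} {Abar : Matrix (Fin n) (Fin n) Bool}
    {b : Fin p → Fin n} {c : Fin m → Fin n} {k : ℕ} {K : Finset (Fin m × Fin p)}
    (hA : HasPerfectStateMatching Abar) (hc : IsMinimumSensing Abar c)
    (hK : IsResilient Abar b c k K) (j : Fin m) : k < (K.filter fun e => e.1 = j).card := by
  by_contra! hcard
  obtain ⟨S, hS, hpred, hpriv⟩ := hc.transpose.exists_private_set hA.transpose j
  refine hK (Filter.Eventually.of_forall fun θ => ?_)
  obtain ⟨μ, hμ⟩ := nonempty_iInter_of_closed (A := (realization Abar θ.1)ᵀ)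
    (B := (realization (outputPattern c) θ.2.2)ᵀ) (C := (realization (inputPattern b) θ.2.1)ᵀ)
    {G | Gᵀ ∈ admissibleGains K (K.filter fun e => e.1 = j)} hS
    (fun y hy x hx => by
      have : ¬ Abar x y = true := fun h => hx (hpred x y h hy)
      simp [realization, this])
    (fun G hG y hy x => by
      rw [Matrix.mul_assoc, Matrix.mul_apply]
      refine Finset.sum_eq_zero fun j' _ => ?_
      by_cases hj : j' = j
      · subst hj
        rw [Matrix.mul_apply, Finset.sum_eq_zero, mul_zero]
        intro i _
        rw [show G j' i = 0 from hG i j' ?_, zero_mul]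
        by_cases h : (j', i) ∈ K
        · exact Or.inr (by simp [h])
        · exact Or.inl h
      · have : ¬ c j' = y := fun h => hpriv j' hj (h ▸ hy)
        simp [realization, outputPattern, this])
  refine ⟨μ, Set.mem_biUnion (show _ ∈ failures k K from ⟨Finset.filter_subset _ _, hcard⟩) ?_⟩
  rw [Set.mem_iInter₂] at hμ ⊢
  intro G hG
  have := hμ Gᵀ (by simpa using hG)
  rw [← spectrum_transpose, ← Matrix.transpose_map, Matrix.transpose_add, Matrix.transpose_mul,
    Matrix.transpose_mul, ← Matrix.mul_assoc]
  exact this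

theorem IsResilient.le_card {n p m : ℕ} {Abar : Matrix (Fin n) (Fin n) Bool}
    {b : Fin p → Fin n} {c : Fin m → Fin n} {k : ℕ} {K : Finset (Fin m × Fin p)}
    (hA : HasPerfectStateMatching Abar) (hb : IsMinimumActuation Abar b)
    (hc : IsMinimumSensing Abar c) (hK : IsResilient Abar b c k K) :
    (k + 1) * max p m ≤ K.card := by
  rw [mul_comm, max_mul_of_nonneg _ _ (Nat.zero_le _)]
  refine max_le ?_ ?_
  · rw [Finset.card_eq_sum_card_fiberwise (f := Prod.snd) (t := Finset.univ)
      (fun _ _ => Finset.mem_coe.mpr (Finset.mem_univ _))]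
    simpa using Finset.card_nsmul_le_sum Finset.univ
      (fun i => (K.filter fun e => e.2 = i).card) (k + 1) (fun i _ => hK.lt_card_actuator hA hb i)
  · rw [Finset.card_eq_sum_card_fiberwise (f := Prod.fst) (t := Finset.univ)
      (fun _ _ => Finset.mem_coe.mpr (Finset.mem_univ _))]
    simpa using Finset.card_nsmul_le_sum Finset.univ
      (fun j => (K.filter fun e => e.1 = j).card) (k + 1) (fun j _ => hK.lt_card_sensor hA hc j)

end ResilientControl

namespace ResilientControl

open Matrix MeasureTheory

/-! ### Outcomes of the pairing procedure -/

theorem reflTransGen_of_closed {α : Type*} {r : α → α → Prop}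
    (h : ∀ X : Set α, X.Nonempty → (∀ x ∈ X, ∀ y, r x y → y ∈ X) → X = Set.univ) (x y : α) :
    Relation.ReflTransGen r x y := by
  have := h {y | Relation.ReflTransGen r x y} ⟨x, .refl⟩ fun z hz y hy => hz.tail hy
  have hy : y ∈ {y | Relation.ReflTransGen r x y} := by rw [this]; trivial
  exact hy

theorem mem_of_stateReach {n : ℕ} {Abar : Matrix (Fin n) (Fin n) Bool} {X : Set (Fin n)}
    (hX : ∀ x ∈ X, ∀ y, Abar y x = true → y ∈ X) {x y : Fin n} (hx : x ∈ X)
    (h : StateReach Abar x y) : y ∈ X := by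
  induction h with
  | refl => exact hx
  | tail _ he ih => exact hX _ ih _ he

open Fin.NatCast in
theorem eq_univ_of_finRotate_closed {r : ℕ} {S : Set (Fin r)} (hS : S.Nonempty)
    (h : ∀ l ∈ S, finRotate r l ∈ S) : S = Set.univ := by
  obtain ⟨l, hl⟩ := hS
  obtain ⟨r, rfl⟩ : ∃ r', r = r' + 1 := ⟨r - 1, by have := l.2; omega⟩
  have hk : ∀ k : ℕ, l + (k : Fin (r + 1)) ∈ S := by
    intro k
    induction k with
    | zero => simpa using hl
    | succ k ih =>
      have := h _ ih
      rw [finRotate_apply] at this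
      rwa [Nat.cast_succ, ← add_assoc]
  refine Set.eq_univ_of_forall fun y => ?_
  have := hk (y - l).val
  simpa using this

theorem IsMatching.card_fst {p m : ℕ} {E : Fin p → Fin m → Prop} {M : Finset (Fin p × Fin m)}
    (hM : IsMatching E M) : (M.image Prod.fst).card = M.card :=
  Finset.card_image_of_injOn fun e he e' he' h => hM.2 e he e' he' (Or.inl h)

theorem IsMatching.card_snd {p m : ℕ} {E : Fin p → Fin m → Prop} {M : Finset (Fin p × Fin m)}
    (hM : IsMatching E M) : (M.image Prod.snd).card = M.card :=
  Finset.card_image_of_injOn fun e he e' he' h => hM.2 e he e' he' (Or.inr h)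

theorem IsSequentialPairing.card {p m : ℕ} {E : Fin p → Fin m → Prop} {M : Finset (Fin p × Fin m)}
    {K : Finset (Fin m × Fin p)} (hM : IsMatching E M) (h : IsSequentialPairing M K) :
    K.card = M.card := by
  obtain ⟨e, rfl⟩ := h
  rw [sequentialPairing, Finset.card_image_of_injective, Finset.card_fin]
  intro l l' hl
  simp only [Prod.mk.injEq] at hl
  have := hM.2 _ (e l).2 _ (e l').2 (Or.inr hl.1)
  exact e.injective (Subtype.ext this)

theorem IsSequentialPairing.subset {p m : ℕ} {M : Finset (Fin p × Fin m)}
    {K : Finset (Fin m × Fin p)} (h : IsSequentialPairing M K) :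
    ∀ e ∈ K, e.1 ∈ M.image Prod.snd ∧ e.2 ∈ M.image Prod.fst := by
  obtain ⟨e, rfl⟩ := h
  intro x hx
  simp only [sequentialPairing, Finset.mem_image, Finset.mem_univ, true_and] at hx
  obtain ⟨l, rfl⟩ := hx
  exact ⟨Finset.mem_image_of_mem Prod.snd (e l).2,
    Finset.mem_image_of_mem Prod.fst (e (finRotate _ l)).2⟩

/-- The completion by sensor links saturates the actuators. -/
theorem IsSensorCompletion.card_matching {p m : ℕ} {E : Fin p → Fin m → Prop}
    {M : Finset (Fin p × Fin m)} {K : Finset (Fin m × Fin p)} (hM : IsMatching E M)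
    (h : IsSensorCompletion M K) : M.card = p := by
  obtain ⟨hpm, hcard, hK, hex⟩ := h
  have h1 : K.image Prod.fst = Finset.univ \ M.image Prod.snd := by
    ext j
    simp only [Finset.mem_image, Finset.mem_sdiff, Finset.mem_univ, true_and, Prod.exists]
    constructor
    · rintro ⟨j', i, he, rfl⟩ ⟨i', j'', hm, rfl⟩
      exact hK _ he i' hm
    · intro hj
      obtain ⟨i, hi, -⟩ := hex j fun i hi => hj ⟨i, j, hi, rfl⟩
      exact ⟨j, i, hi, rfl⟩
  have h2 : (K.image Prod.fst).card = K.card := by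
    refine Finset.card_image_of_injOn fun e he e' he' h => ?_
    obtain ⟨i, -, hu⟩ := hex e.1 fun i hi => hK e he i hi
    have e1 := hu e.2 he
    have e2 := hu e'.2 (by rw [show e.1 = e'.1 from h]; exact he')
    exact Prod.ext h (e1.trans e2.symm)
  rw [h1, ← Finset.compl_eq_univ_sdiff, Finset.card_compl, hM.card_snd, hcard, Fintype.card_fin] at h2
  have h3 : M.card ≤ m := by
    rw [← hM.card_snd]
    simpa using Finset.card_le_univ (M.image Prod.snd)
  omega

/-- The completion by actuator links saturates the sensors. -/
theorem IsActuatorCompletion.card_matching {p m : ℕ} {E : Fin p → Fin m → Prop}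
    {M : Finset (Fin p × Fin m)} {K : Finset (Fin m × Fin p)} (hM : IsMatching E M)
    (h : IsActuatorCompletion M K) : M.card = m := by
  obtain ⟨hpm, hcard, hK, hex⟩ := h
  have h1 : K.image Prod.snd = Finset.univ \ M.image Prod.fst := by
    ext i
    simp only [Finset.mem_image, Finset.mem_sdiff, Finset.mem_univ, true_and, Prod.exists]
    constructor
    · rintro ⟨j, i', he, rfl⟩ ⟨i'', j', hm, rfl⟩
      exact hK _ he j' hm
    · intro hi
      obtain ⟨j, hj, -⟩ := hex i fun j hj => hi ⟨i, j, hj, rfl⟩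
      exact ⟨j, i, hj, rfl⟩
  have h2 : (K.image Prod.snd).card = K.card := by
    refine Finset.card_image_of_injOn fun e he e' he' h => ?_
    obtain ⟨j, -, hu⟩ := hex e.2 fun j hj => hK e he j hj
    have e1 := hu e.1 he
    have e2 := hu e'.1 (by rw [show e.2 = e'.2 from h]; exact he')
    exact Prod.ext (e1.trans e2.symm) h
  rw [h1, ← Finset.compl_eq_univ_sdiff, Finset.card_compl, hM.card_fst, hcard, Fintype.card_fin] at h2
  have h3 : M.card ≤ p := by
    rw [← hM.card_fst]
    simpa using Finset.card_le_univ (M.image Prod.fst)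
  omega

theorem IsProcedurePattern.card {n p m : ℕ} {Abar : Matrix (Fin n) (Fin n) Bool} {b : Fin p → Fin n}
    {c : Fin m → Fin n} {K : Finset (Fin m × Fin p)} (h : IsProcedurePattern Abar b c K) :
    K.card = max p m := by
  obtain ⟨M, K₁, K₂, hM, h₁, h₂, rfl⟩ := h
  have hdisj : Disjoint K₁ K₂ := by
    rw [Finset.disjoint_left]
    intro e he he'
    obtain ⟨h3, h4⟩ := h₁.subset e he
    simp only [Finset.mem_image, Prod.exists, exists_eq_right] at h3 h4
    rcases h₂ with h₂ | h₂
    · obtain ⟨i, hi⟩ := h3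
      exact h₂.2.2.1 e he' i hi
    · obtain ⟨a, j, hj, ha⟩ := h4
      exact h₂.2.2.1 e he' j (ha ▸ hj)
  rw [Finset.card_union_of_disjoint hdisj, h₁.card hM.1]
  rcases h₂ with h₂ | h₂
  · have h5 := h₂.card_matching hM.1
    have h6 := h₂.1
    have h7 := h₂.2.1
    omega
  · have h5 := h₂.card_matching hM.1
    have h6 := h₂.1
    have h7 := h₂.2.1
    omega

theorem IsProcedurePattern.exists_matching {n p m : ℕ} {Abar : Matrix (Fin n) (Fin n) Bool}
    {b : Fin p → Fin n} {c : Fin m → Fin n} {K : Finset (Fin m × Fin p)}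
    (h : IsProcedurePattern Abar b c K) :
    ∃ M, IsMatching (Reaches Abar b c) M ∧ M.card = min p m := by
  obtain ⟨M, K₁, K₂, hM, h₁, h₂, rfl⟩ := h
  refine ⟨M, hM.1, ?_⟩
  rcases h₂ with h₂ | h₂
  · rw [h₂.card_matching hM.1, min_eq_left h₂.1]
  · rw [h₂.card_matching hM.1, min_eq_right h₂.1]

/-- The closed loop with an outcome of the procedure is strongly connected: the sequential pairing
puts all matched actuators and sensors on one closed walk, and the additional links lead from
the other sensors to it, or from it to the other actuators. -/
theorem IsProcedurePattern.eq_univ {n p m : ℕ} {Abar : Matrix (Fin n) (Fin n) Bool}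
    {b : Fin p → Fin n} {c : Fin m → Fin n} {K : Finset (Fin m × Fin p)}
    (hb : ∀ y, ∃ i, StateReach Abar (b i) y) (hc : ∀ x, ∃ j, StateReach Abar x (c j))
    (h : IsProcedurePattern Abar b c K) {X : Set (Fin n)} (hX : X.Nonempty)
    (hXA : ∀ x ∈ X, ∀ y, Abar y x = true → y ∈ X)
    (hXK : ∀ e ∈ K, c e.1 ∈ X → b e.2 ∈ X) : X = Set.univ := by
  obtain ⟨M, K₁, K₂, hM, ⟨e, hK₁⟩, h₂, rfl⟩ := h
  have hE : ∀ l, b (e l).1.1 ∈ X → c (e l).1.2 ∈ X := fun l hl =>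
    mem_of_stateReach hXA hl (reaches_iff.mp (hM.1.1 _ (e l).2))
  have hlink : ∀ l, c (e l).1.2 ∈ X → b (e (finRotate _ l)).1.1 ∈ X := fun l hl =>
    hXK ((e l).1.2, (e (finRotate _ l)).1.1) (Finset.mem_union_left _ (by
      rw [hK₁]; exact Finset.mem_image_of_mem _ (Finset.mem_univ l))) hl
  have hcycle : (∃ l, c (e l).1.2 ∈ X) → ∀ l, b (e l).1.1 ∈ X := by
    intro hex l
    have : {l | c (e l).1.2 ∈ X} = Set.univ :=
      eq_univ_of_finRotate_closed hex fun l hl => hE _ (hlink l hl)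
    have hl : (finRotate _).symm l ∈ {l | c (e l).1.2 ∈ X} := by rw [this]; trivial
    have := hlink _ hl
    rwa [Equiv.apply_symm_apply] at this
  obtain ⟨x, hx⟩ := hX
  obtain ⟨j, hj⟩ := hc x
  have hjX := mem_of_stateReach hXA hx hj
  suffices hall : ∀ i, b i ∈ X by
    refine Set.eq_univ_of_forall fun y => ?_
    obtain ⟨i, hi⟩ := hb y
    exact mem_of_stateReach hXA (hall i) hi
  have hmem : ∀ i j, (i, j) ∈ M → ∃ l, (e l).1 = (i, j) := fun i j hij =>
    ⟨e.symm ⟨(i, j), hij⟩, by simp⟩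
  rcases h₂ with h₂ | h₂
  · have hfull : ∀ i, ∃ j, (i, j) ∈ M := by
      have : M.image Prod.fst = Finset.univ := by
        rw [← Finset.card_eq_iff_eq_univ, hM.1.card_fst, h₂.card_matching hM.1, Fintype.card_fin]
      intro i
      have hi : i ∈ M.image Prod.fst := this ▸ Finset.mem_univ i
      simpa using hi
    have hstart : ∃ l, c (e l).1.2 ∈ X := by
      by_cases hjM : ∃ i, (i, j) ∈ M
      · obtain ⟨i, hi⟩ := hjM
        obtain ⟨l, hl⟩ := hmem i j hi
        exact ⟨l, by rw [hl]; exact hjX⟩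
      · push Not at hjM
        obtain ⟨i, hi, -⟩ := h₂.2.2.2 j hjM
        have hiX := hXK _ (Finset.mem_union_right _ hi) hjX
        obtain ⟨j', hj'⟩ := hfull i
        obtain ⟨l, hl⟩ := hmem i j' hj'
        exact ⟨l, hE l (by rw [hl]; exact hiX)⟩
    intro i
    obtain ⟨j', hj'⟩ := hfull i
    obtain ⟨l, hl⟩ := hmem i j' hj'
    have := hcycle hstart l
    rwa [hl] at this
  · have hfull : ∀ j, ∃ i, (i, j) ∈ M := by
      have : M.image Prod.snd = Finset.univ := by
        rw [← Finset.card_eq_iff_eq_univ, hM.1.card_snd, h₂.card_matching hM.1, Fintype.card_fin]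
      intro j
      have hj : j ∈ M.image Prod.snd := this ▸ Finset.mem_univ j
      simpa using hj
    have hstart : ∃ l, c (e l).1.2 ∈ X := by
      obtain ⟨i, hi⟩ := hfull j
      obtain ⟨l, hl⟩ := hmem i j hi
      exact ⟨l, by rw [hl]; exact hjX⟩
    intro i
    by_cases hiM : ∃ j, (i, j) ∈ M
    · obtain ⟨j', hj'⟩ := hiM
      obtain ⟨l, hl⟩ := hmem i j' hj'
      have := hcycle hstart l
      rwa [hl] at this
    · push Not at hiM
      obtain ⟨j', hj', -⟩ := h₂.2.2.2 i hiM
      obtain ⟨i', hi'⟩ := hfull j'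
      obtain ⟨l, hl⟩ := hmem i' j' hi'
      refine hXK _ (Finset.mem_union_right _ hj') ?_
      have := hE l (hcycle hstart l)
      rwa [hl] at this

/-- Resilience from a condition on closed sets of states, after any admissible failures. -/
theorem ae_fixedModesAt_eq_empty_of_closed {n p m : ℕ} {Abar : Matrix (Fin n) (Fin n) Bool}
    {b : Fin p → Fin n} {c : Fin m → Fin n} {k : ℕ} {K : Finset (Fin m × Fin p)}
    (hA : HasPerfectStateMatching Abar) (hb : IsMinimumActuation Abar b)
    (hc : IsMinimumSensing Abar c)
    (hcl : ∀ J ⊆ K, J.card ≤ k → ∀ X : Set (Fin n), X.Nonempty →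
      (∀ x ∈ X, ∀ y, Abar y x = true → y ∈ X) →
      (∀ e ∈ K \ J, c e.1 ∈ X → b e.2 ∈ X) → X = Set.univ)
    (hcard : 0 < n → k < K.card) :
    ∀ᵐ θ : Parameters Abar (inputPattern b) (outputPattern c),
      fixedModesAt θ K (failures k K) = ∅ := by
  have hcinj : Function.Injective c := hc.transpose.injective hA.transpose
  refine ae_fixedModesAt_eq_empty hA (hb.injective hA) hcinj k K (fun J hJ hJk =>
    reflTransGen_of_closed fun X hX hX' => hcl J hJ hJk X hX
      (fun x hx y hy => hX' x hx y (Or.inl hy))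
      (fun e he hce => hX' _ hce _ (Or.inr ⟨e, he, rfl, rfl⟩))) fun hn J hJ hJk => ?_
  rw [← Finset.card_pos, Finset.card_sdiff_of_subset hJ]
  have := hcard hn
  omega

theorem IsDisjointProcedureFamily.card {n p m : ℕ} {Abar : Matrix (Fin n) (Fin n) Bool}
    {b : Fin p → Fin n} {c : Fin m → Fin n} {k : ℕ} {K : Fin (k + 1) → Finset (Fin m × Fin p)}
    (h : IsDisjointProcedureFamily Abar b c k K) :
    (Finset.univ.biUnion K).card = (k + 1) * max p m := by
  rw [Finset.card_biUnion fun s _ t _ hst => h.2 s t hst, Finset.sum_congr rfl fun s _ => (h.1 s).card]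
  simp

/-- At most `k` failures leave one of `k + 1` disjoint patterns intact. -/
theorem IsDisjointProcedureFamily.ae_eq_empty {n p m : ℕ} {Abar : Matrix (Fin n) (Fin n) Bool}
    {b : Fin p → Fin n} {c : Fin m → Fin n} {k : ℕ} {K : Fin (k + 1) → Finset (Fin m × Fin p)}
    (hA : HasPerfectStateMatching Abar) (hb : IsMinimumActuation Abar b)
    (hc : IsMinimumSensing Abar c) (h : IsDisjointProcedureFamily Abar b c k K) :
    ∀ᵐ θ : Parameters Abar (inputPattern b) (outputPattern c),
      fixedModesAt θ (Finset.univ.biUnion K) (failures k (Finset.univ.biUnion K)) = ∅ := by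
  refine ae_fixedModesAt_eq_empty_of_closed hA hb hc (fun J hJ hJk X hX hXA hXK => ?_) fun hn => by
    obtain ⟨i, -⟩ := hb.exists_reach ⟨0, hn⟩
    have hp : 1 ≤ max p m := le_trans (by have := i.2; omega) (le_max_left _ _)
    rw [h.card]
    exact Nat.lt_of_lt_of_le (Nat.lt_succ_self k) (Nat.le_mul_of_pos_right _ hp)
  obtain ⟨s, hs⟩ : ∃ s, Disjoint (K s) J := by
    by_contra! hcon
    have hne : ∀ s, ∃ e, e ∈ K s ∧ e ∈ J := fun s => Finset.not_disjoint_iff.mp (hcon s)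
    choose f hf using hne
    have hinj : Function.Injective f := by
      intro s t hst
      by_contra hne
      exact Finset.disjoint_left.mp (h.2 s t hne) (hf s).1 (hst ▸ (hf t).1)
    have := Finset.card_le_card (s := Finset.univ.image f) (t := J)
      (by intro e he; obtain ⟨s, -, rfl⟩ := Finset.mem_image.mp he; exact (hf s).2)
    rw [Finset.card_image_of_injective _ hinj, Finset.card_fin] at this
    omega
  exact (h.1 s).eq_univ hb.exists_reach hc.exists_reach hX hXA fun e he =>
    hXK e (Finset.mem_sdiff.mpr ⟨Finset.mem_biUnion.mpr ⟨s, Finset.mem_univ s, he⟩,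
      Finset.disjoint_left.mp hs he⟩)

theorem isSparsestResilient_of_ae {n p m : ℕ} {Abar : Matrix (Fin n) (Fin n) Bool}
    {b : Fin p → Fin n} {c : Fin m → Fin n} {k : ℕ} {K : Finset (Fin m × Fin p)}
    (hA : HasPerfectStateMatching Abar) (hb : IsMinimumActuation Abar b)
    (hc : IsMinimumSensing Abar c)
    (hae : ∀ᵐ θ : Parameters Abar (inputPattern b) (outputPattern c),
      fixedModesAt θ K (failures k K) = ∅) (hcard : K.card ≤ (k + 1) * max p m) :
    IsSparsestResilient Abar b c k K :=
  ⟨isResilient_of_ae hae, fun _ hK' => hcard.trans (hK'.le_card hA hb hc)⟩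

end ResilientControl

namespace ResilientControl

/-! ### Circulant link patterns -/

/-- In the circulant digraph on `ℤ/r` with steps `1, …, d`, where `d < r`, at least `d` edges leave any
nonempty proper subset. If every element of the subset has an edge out of it, a subset with `d`
elements or more is fine, and a smaller one has enough edges by counting; if some element has
none, it starts a run of more than `d` elements of the subset, and the `d` edges into the first
element after the run leave the subset. -/
theorem le_sum_circulant_cut {r d : ℕ} (hd : d < r) {T : Finset ℕ} (hT : T ⊆ Finset.range r)
    (hne : T.Nonempty) (hne' : T ≠ Finset.range r) :
    d ≤ ∑ l ∈ T, ((Finset.range d).filter fun t => (l + 1 + t) % r ∉ T).card := by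
  have hr : 0 < r := by omega
  by_cases hcross : ∀ l ∈ T, 1 ≤ ((Finset.range d).filter fun t => (l + 1 + t) % r ∉ T).card
  · rcases le_total d T.card with hdT | hdT
    · calc d ≤ T.card := hdT
        _ = ∑ l ∈ T, 1 := by simp
        _ ≤ _ := Finset.sum_le_sum hcross
    · have hpos : 1 ≤ T.card := hne.card_pos
      have hl : ∀ l ∈ T, d - (T.card - 1) ≤
          ((Finset.range d).filter fun t => (l + 1 + t) % r ∉ T).card := by
        intro l hl
        have h1 := Finset.card_filter_add_card_filter_not (s := Finset.range d)
          (fun t => (l + 1 + t) % r ∈ T)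
        have h2 : ((Finset.range d).filter fun t => (l + 1 + t) % r ∈ T).card ≤
            (T.erase l).card := by
          refine Finset.card_le_card_of_injOn (fun t => (l + 1 + t) % r) ?_ ?_
          · intro t ht
            simp only [Finset.coe_filter, Finset.mem_range, Set.mem_ofPred_eq] at ht
            refine Finset.mem_coe.mpr (Finset.mem_erase.mpr ⟨fun h => ?_, ht.2⟩)
            have hlr := Finset.mem_range.mp (hT hl)
            have h3 : (l + (1 + t)) % r = (l + 0) % r := by
              rw [add_zero, Nat.mod_eq_of_lt hlr, ← add_assoc]; exact h
            have h4 : (1 + t) % r = 0 % r := Nat.ModEq.add_left_cancel' l h3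
            rw [Nat.mod_eq_of_lt (by omega), Nat.zero_mod] at h4
            omega
          · intro t ht t' ht' h
            simp only [Finset.coe_filter, Finset.mem_range, Set.mem_ofPred_eq] at ht ht'
            have h4 : t % r = t' % r := Nat.ModEq.add_left_cancel' (l + 1) h
            rwa [Nat.mod_eq_of_lt (by omega), Nat.mod_eq_of_lt (by omega)] at h4
        rw [Finset.card_erase_of_mem hl] at h2
        rw [Finset.card_range] at h1
        omega
      have hsum := Finset.card_nsmul_le_sum T _ _ hl
      refine le_trans ?_ hsum
      rw [smul_eq_mul]
      obtain ⟨a, ha⟩ : ∃ a, T.card = a + 1 := ⟨T.card - 1, by omega⟩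
      obtain ⟨e, he⟩ : ∃ e, d = a + 1 + e := ⟨d - (a + 1), by omega⟩
      rw [ha, he, show a + 1 + e - (a + 1 - 1) = e + 1 by omega]
      nlinarith [Nat.zero_le (a * e)]
  · push Not at hcross
    obtain ⟨l, hl, hcard⟩ := hcross
    have hrun : ∀ t < d, (l + 1 + t) % r ∈ T := by
      intro t ht
      by_contra h
      have : ((Finset.range d).filter fun t => (l + 1 + t) % r ∉ T).Nonempty :=
        ⟨t, by simp [ht, h]⟩
      have := this.card_pos
      omega
    have hlr := Finset.mem_range.mp (hT hl)
    -- the first element after the run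
    have hex : ∃ y, (l + y) % r ∉ T := by
      by_contra! h
      apply hne'
      refine Finset.Subset.antisymm hT fun z hz => ?_
      rw [Finset.mem_range] at hz
      have := h (r - l + z)
      rwa [show l + (r - l + z) = z + r by omega, Nat.add_mod_right, Nat.mod_eq_of_lt hz] at this
    classical
    have hy := Nat.find_spec hex
    have hmin : ∀ z < Nat.find hex, (l + z) % r ∈ T := fun z hz => by
      simpa using Nat.find_min hex hz
    set y := Nat.find hex
    have hyd : d < y := by
      by_contra hle
      rcases Nat.eq_zero_or_pos y with h0 | h0
      · rw [h0, add_zero, Nat.mod_eq_of_lt hlr] at hy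
        exact hy hl
      · have := hrun (y - 1) (by omega)
        rw [show l + 1 + (y - 1) = l + y by omega] at this
        exact hy this
    have hinj : Set.InjOn (fun i => (l + (y - 1 - i)) % r) (Finset.range d) := by
      intro i hi i' hi' h
      simp only [Finset.coe_range, Set.mem_Iio] at hi hi'
      rcases le_total i i' with hle | hle
      · have h4 : (y - 1 - i) % r = (y - 1 - i') % r := Nat.ModEq.add_left_cancel' l h
        have h5 : (i' - i) % r = 0 % r := by
          refine Nat.ModEq.add_left_cancel' (y - 1 - i') ?_
          rw [add_zero, show y - 1 - i' + (i' - i) = y - 1 - i by omega]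
          exact h4
        rw [Nat.mod_eq_of_lt (by omega), Nat.zero_mod] at h5
        omega
      · have h4 : (y - 1 - i) % r = (y - 1 - i') % r := Nat.ModEq.add_left_cancel' l h
        have h5 : (i - i') % r = 0 % r := by
          refine Nat.ModEq.add_left_cancel' (y - 1 - i) ?_
          rw [add_zero, show y - 1 - i + (i - i') = y - 1 - i' by omega]
          exact h4.symm
        rw [Nat.mod_eq_of_lt (by omega), Nat.zero_mod] at h5
        omega
    have hsub : (Finset.range d).image (fun i => (l + (y - 1 - i)) % r) ⊆ T := by
      intro z hz
      obtain ⟨i, hi, rfl⟩ := Finset.mem_image.mp hz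
      have := Finset.mem_range.mp hi
      exact hmin _ (by omega)
    calc d = ∑ z ∈ (Finset.range d).image (fun i => (l + (y - 1 - i)) % r), 1 := by
          rw [Finset.sum_const, Finset.card_image_of_injOn hinj]; simp
      _ ≤ ∑ z ∈ (Finset.range d).image (fun i => (l + (y - 1 - i)) % r),
          ((Finset.range d).filter fun t => (z + 1 + t) % r ∉ T).card := by
        refine Finset.sum_le_sum fun z hz => ?_
        obtain ⟨i, hi, rfl⟩ := Finset.mem_image.mp hz
        have hi' := Finset.mem_range.mp hi
        refine Finset.card_pos.mpr ⟨i, Finset.mem_filter.mpr ⟨hi, ?_⟩⟩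
        rw [add_assoc, Nat.mod_add_mod, show l + (y - 1 - i) + (1 + i) = l + y by omega]
        exact hy
      _ ≤ _ := Finset.sum_le_sum_of_subset hsub

/-- Rows `a, …, a + rows - 1`, each with `d` consecutive columns of the cyclically ordered columns
`base, …, base + size - 1`; the first column moves on by one with each row, starting at `off`. -/
def linkBlock (a rows base size off d : ℕ) : Finset (ℕ × ℕ) :=
  (Finset.range rows ×ˢ Finset.range d).image
    fun e => (a + e.1, base + (e.1 + off + e.2) % size)

theorem mem_linkBlock {a rows base size off d : ℕ} {e : ℕ × ℕ} :
    e ∈ linkBlock a rows base size off d ↔ ∃ l < rows, ∃ t < d,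
      e = (a + l, base + (l + off + t) % size) := by
  simp only [linkBlock, Finset.mem_image, Finset.mem_product, Finset.mem_range, Prod.exists]
  constructor
  · rintro ⟨l, t, ⟨hl, ht⟩, rfl⟩; exact ⟨l, hl, t, ht, rfl⟩
  · rintro ⟨l, hl, t, ht, rfl⟩; exact ⟨l, t, ⟨hl, ht⟩, rfl⟩

theorem le_card_row_linkBlock {a rows base size off d : ℕ} (hd : d ≤ size) {l : ℕ} (hl : l < rows) :
    d ≤ ((linkBlock a rows base size off d).filter fun e => e.1 = a + l).card := by
  calc d = ((Finset.range d).image fun t => (a + l, base + (l + off + t) % size)).card := by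
        rw [Finset.card_image_of_injOn, Finset.card_range]
        intro t ht t' ht' h
        simp only [Finset.coe_range, Set.mem_Iio] at ht ht'
        simp only [Prod.mk.injEq, true_and, add_right_inj] at h
        have h4 : t % size = t' % size := Nat.ModEq.add_left_cancel' (l + off) h
        rwa [Nat.mod_eq_of_lt (by omega), Nat.mod_eq_of_lt (by omega)] at h4
    _ ≤ _ := by
        refine Finset.card_le_card fun e he => ?_
        obtain ⟨t, ht, rfl⟩ := Finset.mem_image.mp he
        exact Finset.mem_filter.mpr
          ⟨mem_linkBlock.mpr ⟨l, hl, t, Finset.mem_range.mp ht, rfl⟩, rfl⟩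

theorem le_card_col_linkBlock {a rows base size d : ℕ} (hd : d ≤ size) (hs : size ≤ rows) {u : ℕ}
    (hu : u < size) :
    d ≤ ((linkBlock a rows base size 0 d).filter fun e => e.2 = base + u).card := by
  calc d = ((Finset.range d).image fun t => (a + (u + size - t) % size, base + u)).card := by
        rw [Finset.card_image_of_injOn, Finset.card_range]
        intro t ht t' ht' h
        simp only [Finset.coe_range, Set.mem_Iio] at ht ht'
        simp only [Prod.mk.injEq, add_right_inj, and_true] at h
        have e1 : (u + size - t) + t = (u + size - t') + t' := by omega
        have h4 : t % size = t' % size := by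
          refine Nat.ModEq.add_left_cancel h ?_
          rw [e1]
        rwa [Nat.mod_eq_of_lt (by omega), Nat.mod_eq_of_lt (by omega)] at h4
    _ ≤ _ := by
        refine Finset.card_le_card fun e he => ?_
        obtain ⟨t, ht, rfl⟩ := Finset.mem_image.mp he
        rw [Finset.mem_range] at ht
        have hlt : (u + size - t) % size < size := Nat.mod_lt _ (by omega)
        refine Finset.mem_filter.mpr ⟨mem_linkBlock.mpr ⟨(u + size - t) % size, by omega, t, ht, ?_⟩, rfl⟩
        rw [add_zero, Nat.mod_add_mod, show u + size - t + t = u + size by omega, Nat.add_mod_right,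
          Nat.mod_eq_of_lt hu]

theorem le_card_cut_linkBlock {r d : ℕ} (hd : d < r) {T : Finset ℕ} (hT : T ⊆ Finset.range r)
    (hne : T.Nonempty) (hne' : T ≠ Finset.range r) :
    d ≤ ((linkBlock 0 r 0 r 1 d).filter fun e => e.1 ∈ T ∧ e.2 ∈ Finset.range r \ T).card := by
  refine (le_sum_circulant_cut hd hT hne hne').trans ?_
  rw [← Finset.card_sigma]
  refine Finset.card_le_card_of_injOn (fun x => (x.1, (x.1 + 1 + x.2) % r)) ?_ ?_
  · rintro ⟨l, t⟩ h
    simp only [Finset.mem_coe, Finset.mem_sigma, Finset.mem_filter, Finset.mem_range] at h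
    have hlr := Finset.mem_range.mp (hT h.1)
    simp only [Finset.mem_coe, Finset.mem_filter, Finset.mem_sdiff, Finset.mem_range]
    refine ⟨mem_linkBlock.mpr ⟨l, hlr, t, h.2.1, by simp⟩, h.1, Nat.mod_lt _ (by omega), h.2.2⟩
  · rintro ⟨l, t⟩ h ⟨l', t'⟩ h' heq
    simp only [Finset.mem_coe, Finset.mem_sigma, Finset.mem_filter, Finset.mem_range] at h h'
    simp only [Prod.mk.injEq] at heq
    obtain ⟨rfl, heq⟩ := heq
    have h4 : t % r = t' % r := Nat.ModEq.add_left_cancel' (l + 1) heq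
    rw [Nat.mod_eq_of_lt (by omega), Nat.mod_eq_of_lt (by omega)] at h4
    rw [h4]

/-- A set of links between `m` sensors and `p` actuators, the first `r` of each forming the core: each
sensor and each actuator has at least `d` links, and at least `d` links lead from any nonempty
proper part of the core to the rest of the core. -/
structure IsRobust (p m r d : ℕ) (L : Finset (ℕ × ℕ)) : Prop where
  bound : ∀ e ∈ L, e.1 < m ∧ e.2 < p
  sensor : ∀ j < m, d ≤ (L.filter fun e => e.1 = j).card
  actuator : ∀ i < p, d ≤ (L.filter fun e => e.2 = i).card
  core : ∀ T ⊆ Finset.range r, T.Nonempty → T ≠ Finset.range r →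
    d ≤ (L.filter fun e => e.1 ∈ T ∧ e.2 ∈ Finset.range r \ T).card

/-- Interchanging the roles of sensors and actuators. -/
theorem IsRobust.swap {p m r d : ℕ} {L : Finset (ℕ × ℕ)} (h : IsRobust p m r d L) :
    IsRobust m p r d (L.image Prod.swap) := by
  have hcard : ∀ P : ℕ × ℕ → Prop, ∀ [DecidablePred P],
      ((L.image Prod.swap).filter P).card = (L.filter fun e => P e.swap).card := by
    intro P _
    rw [Finset.filter_image, Finset.card_image_of_injective _ Prod.swap_injective]
  refine ⟨?_, ?_, ?_, ?_⟩
  · intro e he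
    obtain ⟨e', he', rfl⟩ := Finset.mem_image.mp he
    exact (h.bound e' he').symm
  · intro j hj
    rw [hcard]
    exact h.actuator j hj
  · intro i hi
    rw [hcard]
    exact h.sensor i hi
  · intro T hT hne hne'
    rw [hcard]
    refine (h.core (Finset.range r \ T) Finset.sdiff_subset ?_ ?_).trans (Finset.card_le_card ?_)
    · rw [Finset.sdiff_nonempty]
      exact fun h' => hne' (Finset.Subset.antisymm hT h')
    · intro h'
      obtain ⟨t, ht⟩ := hne
      have := hT ht
      rw [← h'] at this
      exact (Finset.mem_sdiff.mp this).2 ht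
    · intro e he
      rw [Finset.mem_filter, Finset.sdiff_sdiff_eq_self hT] at he
      exact Finset.mem_filter.mpr ⟨he.1, he.2.2, he.2.1⟩

/-- The pattern with a circulant core on `r` of `q` columns and further rows, linked to the columns
outside the core if there are any and to the core otherwise. -/
theorem isRobust_linkBlock {q R r d base size : ℕ} (hqR : q ≤ R) (hd0 : 0 < d) (hd : d < r) (hrq : r ≤ q)
    (hcase : (r = q ∧ base = 0 ∧ size = q) ∨ (base = r ∧ base + size = q ∧ d ≤ size)) :
    IsRobust q R r d (linkBlock 0 r 0 r 1 d ∪ linkBlock r (R - r) base size 0 d) := by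
  have hsize : d ≤ size ∧ 0 < size ∧ base + size = q := by omega
  have hmono : ∀ (P : ℕ × ℕ → Prop) [DecidablePred P],
      ((linkBlock 0 r 0 r 1 d).filter P).card ≤
        ((linkBlock 0 r 0 r 1 d ∪ linkBlock r (R - r) base size 0 d).filter P).card :=
    fun P _ => Finset.card_le_card (Finset.filter_subset_filter _ Finset.subset_union_left)
  have hmono' : ∀ (P : ℕ × ℕ → Prop) [DecidablePred P],
      ((linkBlock r (R - r) base size 0 d).filter P).card ≤
        ((linkBlock 0 r 0 r 1 d ∪ linkBlock r (R - r) base size 0 d).filter P).card :=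
    fun P _ => Finset.card_le_card (Finset.filter_subset_filter _ Finset.subset_union_right)
  refine ⟨?_, ?_, ?_, ?_⟩
  · intro e he
    rcases Finset.mem_union.mp he with he | he
    · obtain ⟨l, hl, t, ht, rfl⟩ := mem_linkBlock.mp he
      have := Nat.mod_lt (l + 1 + t) (show 0 < r by omega)
      simp only
      omega
    · obtain ⟨l, hl, t, ht, rfl⟩ := mem_linkBlock.mp he
      have := Nat.mod_lt (l + 0 + t) (show 0 < size by omega)
      simp only
      omega
  · intro j hj
    by_cases hjr : j < r
    · have := le_card_row_linkBlock (a := 0) (base := 0) (off := 1) hd.le hjr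
      rw [zero_add] at this
      exact this.trans (hmono _)
    · have := le_card_row_linkBlock (a := r) (rows := R - r) (base := base) (off := 0) (l := j - r)
        hsize.1 (by omega)
      rw [show r + (j - r) = j by omega] at this
      exact this.trans (hmono' _)
  · intro i hi
    by_cases hir : i < r
    · -- the links into `i` are those from the rest of the core
      have := le_card_cut_linkBlock hd (T := (Finset.range r).erase i) (Finset.erase_subset _ _)
        (by
          rw [← Finset.card_pos, Finset.card_erase_of_mem (Finset.mem_range.mpr hir),
            Finset.card_range]
          omega)
        (fun h => by
          have h' := Finset.mem_range.mpr hir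
          rw [← h] at h'
          simp at h')
      refine this.trans ((Finset.card_le_card ?_).trans (hmono _))
      intro e he
      rw [Finset.mem_filter] at he
      refine Finset.mem_filter.mpr ⟨he.1, ?_⟩
      by_contra hne
      have h1 := Finset.mem_sdiff.mp he.2.2
      exact h1.2 (Finset.mem_erase.mpr ⟨hne, h1.1⟩)
    · have := le_card_col_linkBlock (a := r) (rows := R - r) (base := base) (u := i - base)
        hsize.1 (by omega) (by omega)
      rw [show base + (i - base) = i by omega] at this
      exact this.trans (hmono' _)
  · intro T hT hne hne'
    exact (le_card_cut_linkBlock hd hT hne hne').trans (hmono _)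

/-- A set closed under the links of a robust pattern, up to fewer than `d` failures, contains all
actuators, if each actuator reaches the core and each sensor is reached from the core. -/
theorem IsRobust.forall_mem {p m r d : ℕ} {L : Finset (ℕ × ℕ)} (h : IsRobust p m r d L)
    (hr : 2 ≤ r) {J : Finset (ℕ × ℕ)} (hJ : J.card < d) {σ α : Set ℕ}
    (hlink : ∀ e ∈ L, e ∉ J → e.1 ∈ σ → e.2 ∈ α) (hpair : ∀ l < r, l ∈ α → l ∈ σ)
    (hout : ∀ i < p, i ∈ α → ∃ l < r, l ∈ σ) (hin : ∀ j < m, ∃ l < r, l ∈ α → j ∈ σ)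
    (hne : ∃ j < m, j ∈ σ) : ∀ i < p, i ∈ α := by
  classical
  have hsurv : ∀ (P : ℕ × ℕ → Prop) [DecidablePred P], d ≤ (L.filter P).card → ∃ e ∈ L, P e ∧ e ∉ J := by
    intro P _ hP
    obtain ⟨e, he, he'⟩ := Finset.exists_mem_notMem_of_card_lt_card (lt_of_lt_of_le hJ hP)
    exact ⟨e, (Finset.mem_filter.mp he).1, (Finset.mem_filter.mp he).2, he'⟩
  obtain ⟨j, hj, hjσ⟩ := hne
  obtain ⟨e, he, hej, heJ⟩ := hsurv _ (h.sensor j hj)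
  obtain ⟨l₀, hl₀, hl₀σ⟩ := hout e.2 (h.bound e he).2 (hlink e he heJ (by rw [hej]; exact hjσ))
  -- no proper part of the core is closed
  have hcut : ∀ T ⊆ Finset.range r, T.Nonempty → (∀ l ∈ T, l ∈ σ) →
      (∀ l < r, l ∈ α → l ∈ T) → T = Finset.range r := by
    intro T hT hTne hTσ hTα
    by_contra hTr
    obtain ⟨e, he, heT, heJ⟩ := hsurv _ (h.core T hT hTne hTr)
    have h1 := Finset.mem_sdiff.mp heT.2
    exact h1.2 (hTα _ (Finset.mem_range.mp h1.1) (hlink e he heJ (hTσ _ heT.1)))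
  have hσ : (Finset.range r).filter (· ∈ σ) = Finset.range r :=
    hcut _ (Finset.filter_subset _ _) ⟨l₀, by simp [hl₀, hl₀σ]⟩
      (fun l hl => (Finset.mem_filter.mp hl).2)
      (fun l hl hα => Finset.mem_filter.mpr ⟨Finset.mem_range.mpr hl, hpair l hl hα⟩)
  have hσ' : ∀ l < r, l ∈ σ := fun l hl => by
    have h' := Finset.mem_range.mpr hl
    rw [← hσ] at h'
    exact (Finset.mem_filter.mp h').2
  have hα : ∀ l < r, l ∈ α := by
    by_contra! hcon
    obtain ⟨l, hl, hlα⟩ := hcon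
    have := hcut ((Finset.range r).erase l) (Finset.erase_subset _ _)
      (by
        rw [← Finset.card_pos, Finset.card_erase_of_mem (Finset.mem_range.mpr hl),
          Finset.card_range]
        omega)
      (fun x hx => hσ' x (Finset.mem_range.mp (Finset.mem_of_mem_erase hx)))
      (fun x hx hxα => Finset.mem_erase.mpr
        ⟨fun hxl => hlα (hxl ▸ hxα), Finset.mem_range.mpr hx⟩)
    have h' := Finset.mem_range.mpr hl
    rw [← this] at h'
    simp at h'
  have hall : ∀ j < m, j ∈ σ := fun j hj => by
    obtain ⟨l, hl, h'⟩ := hin j hj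
    exact h' (hα l hl)
  intro i hi
  obtain ⟨e, he, hei, heJ⟩ := hsurv _ (h.actuator i hi)
  rw [← hei]
  exact hlink e he heJ (hall _ (h.bound e he).1)

end ResilientControl

namespace ResilientControl

theorem surjOn_of_injOn_iio {N : ℕ} {f : ℕ → ℕ} (hf : ∀ l < N, f l < N)
    (hinj : ∀ l < N, ∀ l' < N, f l = f l' → l = l') {y : ℕ} (hy : y < N) : ∃ l < N, f l = y := by
  have h := Finset.surj_on_of_inj_on_of_card_le (s := Finset.range N) (t := Finset.range N)
    (fun a _ => f a) (fun a ha => Finset.mem_range.mpr (hf a (Finset.mem_range.mp ha)))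
    (fun a a' ha ha' h => hinj a (Finset.mem_range.mp ha) a' (Finset.mem_range.mp ha') h) le_rfl
    y (Finset.mem_range.mpr hy)
  obtain ⟨l, hl, h⟩ := h
  exact ⟨l, Finset.mem_range.mp hl, h.symm⟩

/-- A robust set of links gives a sparsest resilient pattern, for any enumerations `oS` and `oA` of the
sensors and the actuators such that the first `r` of them are connected in pairs, each actuator reaches
one of the first `r` sensors, and each sensor is reached from one of the first `r` actuators. -/
theorem isSparsestResilient_of_isRobust {n p m : ℕ} {Abar : Matrix (Fin n) (Fin n) Bool}
    {b : Fin p → Fin n} {c : Fin m → Fin n} {k r : ℕ} (hA : HasPerfectStateMatching Abar)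
    (hb : IsMinimumActuation Abar b) (hc : IsMinimumSensing Abar c) (hr : 2 ≤ r)
    (hrm : r ≤ m) {L : Finset (ℕ × ℕ)} (hL : IsRobust p m r (k + 1) L) {oS oA : ℕ → ℕ}
    (hS : ∀ l < m, oS l < m) (hS' : ∀ l < m, ∀ l' < m, oS l = oS l' → l = l')
    (hI : ∀ l < p, oA l < p) (hI' : ∀ l < p, ∀ l' < p, oA l = oA l' → l = l')
    (hpair : ∀ l < r, ∀ (i : Fin p) (j : Fin m), i.val = oA l → j.val = oS l →
      StateReach Abar (b i) (c j))
    (hout : ∀ i : Fin p, ∃ l < r, ∀ j : Fin m, j.val = oS l → StateReach Abar (b i) (c j))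
    (hin : ∀ j : Fin m, ∃ l < r, ∀ i : Fin p, i.val = oA l → StateReach Abar (b i) (c j))
    {K : Finset (Fin m × Fin p)} (hcard : K.card ≤ (k + 1) * max p m)
    (hK : K.image (fun e => (e.1.val, e.2.val)) = L.image fun e => (oS e.1, oA e.2)) :
    IsSparsestResilient Abar b c k K := by
  have hval : Function.Injective fun e : Fin m × Fin p => (e.1.val, e.2.val) := by
    rintro ⟨j, i⟩ ⟨j', i'⟩ h
    simp only [Prod.mk.injEq] at h
    exact Prod.ext (Fin.ext h.1) (Fin.ext h.2)
  have hinj : Set.InjOn (fun e : ℕ × ℕ => (oS e.1, oA e.2)) L := by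
    intro e he e' he' h
    simp only [Prod.mk.injEq] at h
    have h1 := hL.bound e he
    have h2 := hL.bound e' he'
    exact Prod.ext (hS' _ h1.1 _ h2.1 h.1) (hI' _ h1.2 _ h2.2 h.2)
  have hcardKL : K.card = L.card := by
    rw [← Finset.card_image_of_injective K hval, hK, Finset.card_image_of_injOn hinj]
  refine isSparsestResilient_of_ae hA hb hc
    (ae_fixedModesAt_eq_empty_of_closed hA hb hc (fun J hJ hJk X hX hXA hXK => ?_) fun _ => ?_) hcard
  · let J' := L.filter fun e => (oS e.1, oA e.2) ∈ J.image fun e => (e.1.val, e.2.val)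
    have hJ' : J'.card < k + 1 := by
      have : J'.card ≤ (J.image fun e => (e.1.val, e.2.val)).card :=
        Finset.card_le_card_of_injOn (fun e => (oS e.1, oA e.2))
          (fun e he => Finset.mem_coe.mpr (Finset.mem_filter.mp he).2)
          (fun e he e' he' h => hinj (Finset.mem_filter.mp he).1 (Finset.mem_filter.mp he').1 h)
      have h2 := Finset.card_image_le (s := J) (f := fun e : Fin m × Fin p => (e.1.val, e.2.val))
      omega
    have hall := hL.forall_mem hr hJ' (σ := {l | ∃ j : Fin m, j.val = oS l ∧ c j ∈ X})
      (α := {l | ∃ i : Fin p, i.val = oA l ∧ b i ∈ X})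
      (by
        rintro e he heJ ⟨j, hj, hjX⟩
        have hmem : (oS e.1, oA e.2) ∈ K.image fun e => (e.1.val, e.2.val) := by
          rw [hK]; exact Finset.mem_image_of_mem _ he
        obtain ⟨e', he', heq⟩ := Finset.mem_image.mp hmem
        simp only [Prod.mk.injEq] at heq
        refine ⟨e'.2, heq.2, hXK e' (Finset.mem_sdiff.mpr ⟨he', fun h => heJ ?_⟩) ?_⟩
        · refine Finset.mem_filter.mpr ⟨he, Finset.mem_image.mpr ⟨e', h, ?_⟩⟩
          rw [heq.1, heq.2]
        · rwa [show e'.1 = j from Fin.ext (heq.1.trans hj.symm)])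
      (by
        rintro l hl ⟨i, hi, hiX⟩
        exact ⟨⟨oS l, hS l (by omega)⟩, rfl,
          mem_of_stateReach hXA hiX (hpair l hl i _ hi rfl)⟩)
      (by
        rintro l hl ⟨i, hi, hiX⟩
        obtain ⟨l', hl', h⟩ := hout i
        exact ⟨l', hl', ⟨oS l', hS l' (by omega)⟩, rfl, mem_of_stateReach hXA hiX (h _ rfl)⟩)
      (by
        intro l hl
        obtain ⟨l', hl', h⟩ := hin ⟨oS l, hS l hl⟩
        refine ⟨l', hl', ?_⟩
        rintro ⟨i, hi, hiX⟩
        exact ⟨_, rfl, mem_of_stateReach hXA hiX (h i hi)⟩)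
      (by
        obtain ⟨x, hx⟩ := hX
        obtain ⟨j, hj⟩ := hc.exists_reach x
        obtain ⟨l, hl, hlj⟩ := surjOn_of_injOn_iio hS hS' j.2
        exact ⟨l, hl, j, hlj.symm, mem_of_stateReach hXA hx hj⟩)
    refine Set.eq_univ_of_forall fun y => ?_
    obtain ⟨i, hi⟩ := hb.exists_reach y
    obtain ⟨l, hl, hli⟩ := surjOn_of_injOn_iio hI hI' i.2
    obtain ⟨i', hi', hX'⟩ := hall l hl
    rw [show i' = i from Fin.ext (hi'.trans hli)] at hX'
    exact mem_of_stateReach hXA hX' hi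
  · rw [hcardKL]
    have h1 := hL.sensor 0 (by omega)
    have h2 := Finset.card_filter_le L fun e => e.1 = 0
    omega

end ResilientControl

namespace ResilientControl

/-! ### Depth-first search for augmenting paths -/

/-- The data on which the search works: the digraph on the states `0, …, n - 1` by adjacency lists, the
actuated states `b i` and the measured states `c j`. -/
structure Net where
  n : ℕ
  p : ℕ
  m : ℕ
  st : ℕ → ℕ
  adj : ℕ → ℕ
  b : ℕ → ℕ
  c : ℕ → ℕ
  b_lt : ∀ i < p, b i < n
  c_lt : ∀ j < m, c j < n
  c_inj : ∀ j < m, ∀ j' < m, c j = c j' → j = j'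
  adj_lt : ∀ x < n, ∀ t, st x ≤ t → t < st (x + 1) → adj t < n
  st_le : ∀ x < n, st x ≤ st (x + 1)

namespace Net

variable (N : Net)

/-- The edges of the digraph. -/
def E (x y : ℕ) : Prop := x < N.n ∧ ∃ t, N.st x ≤ t ∧ t < N.st (x + 1) ∧ N.adj t = y

/-- There is a directed walk. -/
def Reach : ℕ → ℕ → Prop := Relation.ReflTransGen N.E

theorem E.lt {N : Net} {x y : ℕ} (h : N.E x y) : y < N.n := by
  obtain ⟨hx, t, h1, h2, rfl⟩ := h
  exact N.adj_lt x hx t h1 h2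

/-- Mutually inverse partial maps `mA` from actuators to sensors and `mS` back, along the reachability
relation. The value `0` stands for an unmatched vertex, and `j + 1` for the partner `j`. -/
structure Valid (mA mS : ℕ → ℕ) : Prop where
  A : ∀ i < N.p, ∀ j, mA i = j + 1 → j < N.m ∧ mS j = i + 1 ∧ N.Reach (N.b i) (N.c j)
  S : ∀ j < N.m, ∀ i, mS j = i + 1 → i < N.p ∧ mA i = j + 1

/-- The number of matched actuators. -/
def matched (mA : ℕ → ℕ) : ℕ := ((Finset.range N.p).filter fun i => mA i ≠ 0).card

/-- The states after `x` are marked: the heads of its edges, and the state of the actuator matched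
with a sensor at `x`. -/
def Closed (mark mA : ℕ → ℕ) (x : ℕ) : Prop :=
  (∀ y, N.E x y → mark y ≠ 0) ∧
    ∀ i < N.p, ∀ j < N.m, N.c j = x → mA i = j + 1 → mark (N.b i) ≠ 0

/-- `x` lies between an actuator in `SA` and a sensor in `SS`. -/
def Between (SA SS : ℕ → Prop) (x : ℕ) : Prop :=
  (∃ i < N.p, SA i ∧ N.Reach (N.b i) x) ∧ ∃ j < N.m, SS j ∧ N.Reach x (N.c j)

/-- The code of the top of the stack: `0` for the empty stack. -/
def top : List ℕ → ℕ
  | [] => 0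
  | x :: _ => x + 1

/-- The step by which the search from actuator `i₀` came to `x`, where `l` is the stack below: an edge
if the mark is `1`; the link from a sensor to the actuator `i` matched with it, or the start of
the search, if the mark is `i + 2`. -/
def Step (i₀ : ℕ) (mark mA : ℕ → ℕ) (x : ℕ) : List ℕ → Prop
  | [] => mark x = i₀ + 2 ∧ x = N.b i₀
  | y :: _ => (mark x = 1 ∧ N.E y x) ∨
      ∃ i < N.p, ∃ j < N.m, mark x = i + 2 ∧ x = N.b i ∧ y = N.c j ∧ mA i = j + 1

/-- The stack is a path of search steps, recorded by the parent pointers. -/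
def Chain (i₀ : ℕ) (mark par mA : ℕ → ℕ) : List ℕ → Prop
  | [] => True
  | x :: l => par x = top l ∧ x < N.n ∧ mark x ≠ 0 ∧ N.Step i₀ mark mA x l ∧ Chain i₀ mark par mA l

/-- The edges before the pointer of a marked state lead to marked states. -/
def Explored (mark ptr : ℕ → ℕ) : Prop :=
  ∀ x < N.n, mark x ≠ 0 → N.st x ≤ ptr x ∧ ptr x ≤ N.st (x + 1) ∧
    ∀ t, N.st x ≤ t → t < ptr x → mark (N.adj t) ≠ 0

/-- The invariants of the search that do not depend on its outcome. States which have left the stack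
are closed or have the property `G`. -/
structure Core (G : ℕ → Prop) (i₀ : ℕ) (mark ptr par mA mS : ℕ → ℕ) (l : List ℕ) : Prop where
  valid : N.Valid mA mS
  i₀_lt : i₀ < N.p
  free : mA i₀ = 0
  chain : N.Chain i₀ mark par mA l
  nodup : l.Nodup
  explored : N.Explored mark ptr
  off : ∀ x < N.n, mark x ≠ 0 → x ∉ l → N.Closed mark mA x ∨ G x

variable {N}

theorem Closed.mono {mark mark' mA mA' : ℕ → ℕ} {x : ℕ} (h : N.Closed mark mA x)
    (hm : ∀ y, mark y ≠ 0 → mark' y ≠ 0)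
    (hA : ∀ i < N.p, mA' i = mA i ∨ mark' (N.b i) ≠ 0) : N.Closed mark' mA' x := by
  refine ⟨fun y hy => hm y (h.1 y hy), fun i hi j hj hc hij => ?_⟩
  rcases hA i hi with h' | h'
  · exact hm _ (h.2 i hi j hj hc (h' ▸ hij))
  · exact h'

theorem Between.mono {SA SS SA' SS' : ℕ → Prop} {x : ℕ} (h : N.Between SA SS x)
    (hA : ∀ i < N.p, SA i → SA' i) (hS : ∀ j < N.m, SS j → SS' j) : N.Between SA' SS' x := by
  obtain ⟨⟨i, hi, h1, h2⟩, j, hj, h3, h4⟩ := h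
  exact ⟨⟨i, hi, hA i hi h1, h2⟩, j, hj, hS j hj h3, h4⟩

theorem Chain.lt {i₀ : ℕ} {mark par mA : ℕ → ℕ} {l : List ℕ} (h : N.Chain i₀ mark par mA l) :
    ∀ x ∈ l, x < N.n ∧ mark x ≠ 0 := by
  induction l with
  | nil => simp
  | cons y l ih =>
    obtain ⟨-, h1, h2, -, h3⟩ := h
    intro x hx
    rcases List.mem_cons.mp hx with rfl | hx
    · exact ⟨h1, h2⟩
    · exact ih h3 x hx

theorem Chain.congr {i₀ : ℕ} {mark mark' par par' mA mA' : ℕ → ℕ} {l : List ℕ}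
    (h : N.Chain i₀ mark par mA l) (h1 : ∀ x ∈ l, mark' x = mark x) (h2 : ∀ x ∈ l, par' x = par x)
    (h3 : ∀ i < N.p, N.b i ∈ l → mA' i = mA i) : N.Chain i₀ mark' par' mA' l := by
  induction l with
  | nil => trivial
  | cons y l ih =>
    obtain ⟨g1, g2, g3, g4, g5⟩ := h
    refine ⟨by rw [h2 y (by simp), g1], g2, by rw [h1 y (by simp)]; exact g3, ?_,
      ih g5 (fun x hx => h1 x (by simp [hx])) (fun x hx => h2 x (by simp [hx]))
        (fun i hi hx => h3 i hi (by simp [hx]))⟩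
    cases l with
    | nil => exact ⟨by rw [h1 y (by simp)]; exact g4.1, g4.2⟩
    | cons z l =>
      rcases g4 with ⟨e1, e2⟩ | ⟨i, hi, j, hj, e1, e2, e3, e4⟩
      · exact Or.inl ⟨by rw [h1 y (by simp)]; exact e1, e2⟩
      · exact Or.inr ⟨i, hi, j, hj, by rw [h1 y (by simp)]; exact e1, e2, e3,
          by rw [h3 i hi (by simp [← e2])]; exact e4⟩

/-- Every state on the stack is reached from an actuator that is matched or the start. -/
theorem Chain.exists_reach {i₀ : ℕ} (hi₀ : i₀ < N.p) {mark par mA : ℕ → ℕ} {l : List ℕ}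
    (h : N.Chain i₀ mark par mA l) :
    ∀ x ∈ l, ∃ i < N.p, (mA i ≠ 0 ∨ i = i₀) ∧ N.Reach (N.b i) x := by
  induction l with
  | nil => simp
  | cons y l ih =>
    obtain ⟨-, -, -, g4, g5⟩ := h
    intro x hx
    rcases List.mem_cons.mp hx with rfl | hx
    · cases l with
      | nil => exact ⟨i₀, hi₀, Or.inr rfl, g4.2 ▸ .refl⟩
      | cons z l =>
        rcases g4 with ⟨e1, e2⟩ | ⟨i, hi, j, hj, e1, e2, e3, e4⟩
        · obtain ⟨i, hi, h1, h2⟩ := ih g5 z (by simp)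
          exact ⟨i, hi, h1, h2.tail e2⟩
        · exact ⟨i, hi, Or.inl (by omega), e2 ▸ .refl⟩
    · exact ih g5 x hx

theorem Core.mono {G G' : ℕ → Prop} {i₀ : ℕ} {mark ptr par mA mS : ℕ → ℕ} {l : List ℕ}
    (h : N.Core G i₀ mark ptr par mA mS l) (hG : ∀ x < N.n, G x → G' x) :
    N.Core G' i₀ mark ptr par mA mS l :=
  ⟨h.valid, h.i₀_lt, h.free, h.chain, h.nodup, h.explored,
    fun x hx hm hl => (h.off x hx hm hl).imp_right (hG x hx)⟩

/-- A new state is put on the stack. -/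
theorem Core.push {G : ℕ → Prop} {i₀ : ℕ} {mark ptr ptr' par mA mS : ℕ → ℕ} {l : List ℕ} {y v : ℕ}
    (h : N.Core G i₀ mark ptr par mA mS l) (hy : y < N.n) (hmy : mark y = 0) (hv : v ≠ 0)
    (hstep : N.Step i₀ (Function.update mark y v) mA y l)
    (hptr : ∀ x < N.n, mark x ≠ 0 → N.st x ≤ ptr' x ∧ ptr' x ≤ N.st (x + 1) ∧
      ∀ t, N.st x ≤ t → t < ptr' x → mark (N.adj t) ≠ 0 ∨ N.adj t = y) :
    N.Core G i₀ (Function.update mark y v) (Function.update ptr' y (N.st y))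
      (Function.update par y (top l)) mA mS (y :: l) := by
  have hyl : y ∉ l := fun hyl => (h.chain.lt y hyl).2 hmy
  have hm : ∀ x, mark x ≠ 0 → Function.update mark y v x ≠ 0 := by
    intro x hx
    rw [Function.update_of_ne (by rintro rfl; exact hx hmy)]
    exact hx
  refine ⟨h.valid, h.i₀_lt, h.free, ?_, List.nodup_cons.mpr ⟨hyl, h.nodup⟩, ?_, ?_⟩
  · refine ⟨by simp, hy, by simpa using hv, hstep, h.chain.congr ?_ ?_ fun _ _ _ => rfl⟩
    · intro x hx
      rw [Function.update_of_ne (by rintro rfl; exact hyl hx)]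
    · intro x hx
      rw [Function.update_of_ne (by rintro rfl; exact hyl hx)]
  · intro x hx hmx
    by_cases hxy : x = y
    · subst hxy
      rw [Function.update_self]
      exact ⟨le_rfl, N.st_le x hx, fun t h1 h2 => absurd h2 (by omega)⟩
    · rw [Function.update_of_ne hxy] at hmx ⊢
      obtain ⟨h1, h2, h3⟩ := hptr x hx hmx
      refine ⟨h1, h2, fun t ht ht' => ?_⟩
      rcases h3 t ht ht' with h4 | h4
      · exact hm _ h4
      · rw [h4, Function.update_self]
        exact hv
  · intro x hx hmx hxl
    rw [List.mem_cons, not_or] at hxl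
    rw [Function.update_of_ne hxl.1] at hmx
    exact (h.off x hx hmx hxl.2).imp_left fun hc => hc.mono hm fun _ _ => Or.inl rfl

/-- The top of the stack is removed. -/
theorem Core.pop {G : ℕ → Prop} {i₀ : ℕ} {mark ptr par mA mS : ℕ → ℕ} {l : List ℕ} {x : ℕ}
    (h : N.Core G i₀ mark ptr par mA mS (x :: l)) (hx : N.Closed mark mA x ∨ G x) :
    N.Core G i₀ mark ptr par mA mS l := by
  refine ⟨h.valid, h.i₀_lt, h.free, h.chain.2.2.2.2, (List.nodup_cons.mp h.nodup).2, h.explored,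
    fun y hy hmy hyl => ?_⟩
  by_cases hxy : y = x
  · rw [hxy]; exact hx
  · exact h.off y hy hmy (by simp [hxy, hyl])

/-- The matched vertices. -/
abbrev Good (N : Net) (mA mS : ℕ → ℕ) : ℕ → Prop := N.Between (fun i => mA i ≠ 0) fun j => mS j ≠ 0

/-- The invariant while no unmatched sensor has been found. `F` says whether an earlier search
of the same phase was successful. -/
structure Searching (N : Net) (F : Prop) (i₀ : ℕ) (mark ptr par mA mS : ℕ → ℕ) (l : List ℕ) :
    Prop where
  core : N.Core (fun x => F ∧ N.Good mA mS x) i₀ mark ptr par mA mS l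
  sens : ∀ j < N.m, mark (N.c j) ≠ 0 → mS j ≠ 0

/-- The invariant on the way back along the stack: `j` is the sensor to be matched next, the only free
one of those that will be matched. -/
structure Returning (N : Net) (i₀ j : ℕ) (mark ptr par mA mS : ℕ → ℕ) (l : List ℕ) : Prop where
  core : N.Core (N.Between (fun i => mA i ≠ 0 ∨ i = i₀) fun j' => mS j' ≠ 0 ∨ j' = j)
    i₀ mark ptr par mA mS l
  j_lt : j < N.m
  free : mS j = 0
  reach : ∀ x l', l = x :: l' → N.Reach x (N.c j)
  sens : ∀ j' < N.m, mark (N.c j') ≠ 0 → mS j' ≠ 0 ∨ j' = j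

/-- The invariant between two searches of a phase. -/
structure Rest (N : Net) (F : Prop) (mark ptr mA mS : ℕ → ℕ) : Prop where
  valid : N.Valid mA mS
  explored : N.Explored mark ptr
  off : ∀ x < N.n, mark x ≠ 0 → N.Closed mark mA x ∨ (F ∧ N.Good mA mS x)
  sens : ∀ j < N.m, mark (N.c j) ≠ 0 → mS j ≠ 0

theorem Searching.rest {F : Prop} {i₀ : ℕ} {mark ptr par mA mS : ℕ → ℕ}
    (h : N.Searching F i₀ mark ptr par mA mS []) : N.Rest F mark ptr mA mS :=
  ⟨h.core.valid, h.core.explored, fun x hx hm => h.core.off x hx hm (by simp), h.sens⟩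

theorem Rest.searching {F : Prop} {mark ptr mA mS : ℕ → ℕ} (h : N.Rest F mark ptr mA mS) {i₀ : ℕ}
    (hi₀ : i₀ < N.p) (hfree : mA i₀ = 0) (par : ℕ → ℕ) :
    N.Searching F i₀ mark ptr par mA mS [] :=
  ⟨⟨h.valid, hi₀, hfree, trivial, List.nodup_nil, h.explored, fun x hx hm _ => h.off x hx hm⟩, h.sens⟩

/-- A push without success. -/
theorem Searching.push {F : Prop} {i₀ : ℕ} {mark ptr ptr' par mA mS : ℕ → ℕ} {l : List ℕ} {y v : ℕ}
    (h : N.Searching F i₀ mark ptr par mA mS l) (hy : y < N.n) (hmy : mark y = 0) (hv : v ≠ 0)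
    (hstep : N.Step i₀ (Function.update mark y v) mA y l)
    (hptr : ∀ x < N.n, mark x ≠ 0 → N.st x ≤ ptr' x ∧ ptr' x ≤ N.st (x + 1) ∧
      ∀ t, N.st x ≤ t → t < ptr' x → mark (N.adj t) ≠ 0 ∨ N.adj t = y)
    (hs : ∀ j < N.m, N.c j = y → mS j ≠ 0) :
    N.Searching F i₀ (Function.update mark y v) (Function.update ptr' y (N.st y))
      (Function.update par y (top l)) mA mS (y :: l) := by
  refine ⟨h.core.push hy hmy hv hstep hptr, fun j hj hm => ?_⟩
  by_cases hc : N.c j = y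
  · exact hs j hj hc
  · rw [Function.update_of_ne hc] at hm
    exact h.sens j hj hm

/-- A push that finds an unmatched sensor. -/
theorem Searching.push_found {F : Prop} {i₀ : ℕ} {mark ptr ptr' par mA mS : ℕ → ℕ} {l : List ℕ}
    {y v j : ℕ} (h : N.Searching F i₀ mark ptr par mA mS l) (hy : y < N.n) (hmy : mark y = 0)
    (hv : v ≠ 0) (hstep : N.Step i₀ (Function.update mark y v) mA y l)
    (hptr : ∀ x < N.n, mark x ≠ 0 → N.st x ≤ ptr' x ∧ ptr' x ≤ N.st (x + 1) ∧
      ∀ t, N.st x ≤ t → t < ptr' x → mark (N.adj t) ≠ 0 ∨ N.adj t = y)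
    (hj : j < N.m) (hjy : N.c j = y) (hfree : mS j = 0) :
    N.Returning i₀ j (Function.update mark y v) (Function.update ptr' y (N.st y))
      (Function.update par y (top l)) mA mS (y :: l) := by
  refine ⟨(h.core.push hy hmy hv hstep hptr).mono fun x _ hx => hx.2.mono
    (fun _ _ h => Or.inl h) (fun _ _ h => Or.inl h), hj, hfree, ?_, fun j' hj' hm => ?_⟩
  · rintro x l' h'
    obtain ⟨rfl, -⟩ := List.cons.inj h'
    rw [hjy]; exact .refl
  · by_cases hc : N.c j' = y
    · exact Or.inr (N.c_inj j' hj' j hj (hc.trans hjy.symm))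
    · rw [Function.update_of_ne hc] at hm
      exact Or.inl (h.sens j' hj' hm)

/-- The pointer of the top of the stack moves past an edge to a marked state. -/
theorem Searching.advance {F : Prop} {i₀ : ℕ} {mark ptr par mA mS : ℕ → ℕ} {l : List ℕ} {x : ℕ}
    (h : N.Searching F i₀ mark ptr par mA mS l) (hx : x < N.n) (hlt : ptr x < N.st (x + 1))
    (hm : mark (N.adj (ptr x)) ≠ 0) :
    N.Searching F i₀ mark (Function.update ptr x (ptr x + 1)) par mA mS l := by
  refine ⟨⟨h.core.valid, h.core.i₀_lt, h.core.free, h.core.chain, h.core.nodup, ?_, h.core.off⟩,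
    h.sens⟩
  intro z hz hmz
  obtain ⟨h1, h2, h3⟩ := h.core.explored z hz hmz
  by_cases hzx : z = x
  · subst hzx
    rw [Function.update_self]
    refine ⟨by omega, by omega, fun t ht ht' => ?_⟩
    rcases Nat.lt_succ_iff_lt_or_eq.mp ht' with h4 | h4
    · exact h3 t ht h4
    · rw [h4]; exact hm
  · rw [Function.update_of_ne hzx]
    exact ⟨h1, h2, h3⟩

theorem Core.explored_update {G : ℕ → Prop} {i₀ : ℕ} {mark ptr par mA mS : ℕ → ℕ} {l : List ℕ}
    {x : ℕ} (h : N.Core G i₀ mark ptr par mA mS l) (hlt : ptr x < N.st (x + 1)) :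
    ∀ z < N.n, mark z ≠ 0 → N.st z ≤ Function.update ptr x (ptr x + 1) z ∧
      Function.update ptr x (ptr x + 1) z ≤ N.st (z + 1) ∧
      ∀ t, N.st z ≤ t → t < Function.update ptr x (ptr x + 1) z →
        mark (N.adj t) ≠ 0 ∨ N.adj t = N.adj (ptr x) := by
  intro z hz hmz
  obtain ⟨h1, h2, h3⟩ := h.explored z hz hmz
  by_cases hzx : z = x
  · subst hzx
    rw [Function.update_self]
    refine ⟨by omega, by omega, fun t ht ht' => ?_⟩
    rcases Nat.lt_succ_iff_lt_or_eq.mp ht' with h4 | h4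
    · exact Or.inl (h3 t ht h4)
    · exact Or.inr (by rw [h4])
  · rw [Function.update_of_ne hzx]
    exact ⟨h1, h2, fun t ht ht' => Or.inl (h3 t ht ht')⟩

theorem Searching.pop {F : Prop} {i₀ : ℕ} {mark ptr par mA mS : ℕ → ℕ} {l : List ℕ} {x : ℕ}
    (h : N.Searching F i₀ mark ptr par mA mS (x :: l)) (hend : ¬ ptr x < N.st (x + 1))
    (hmate : ∀ j < N.m, N.c j = x → mark (N.b (mS j - 1)) ≠ 0) :
    N.Searching F i₀ mark ptr par mA mS l := by
  refine ⟨h.core.pop (Or.inl ⟨?_, ?_⟩), h.sens⟩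
  · rintro y ⟨hx, t, h1, h2, rfl⟩
    exact (h.core.explored x hx h.core.chain.2.2.1).2.2 t h1 (by omega)
  · intro i hi j hj hc hij
    have h1 := (h.core.valid.A i hi j hij).2.1
    have h2 := hmate j hj hc
    rwa [h1, Nat.add_sub_cancel] at h2

/-- On the way back, an edge is passed. -/
theorem Returning.pop_edge {i₀ j : ℕ} {mark ptr par mA mS : ℕ → ℕ} {l : List ℕ} {x : ℕ}
    (h : N.Returning i₀ j mark ptr par mA mS (x :: l)) (hm : mark x = 1) :
    N.Returning i₀ j mark ptr par mA mS l ∧ l ≠ [] := by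
  have hstep := h.core.chain.2.2.2.1
  refine ⟨⟨h.core.pop (Or.inr ⟨h.core.chain.exists_reach h.core.i₀_lt x (by simp), j, h.j_lt,
    Or.inr rfl, h.reach x l rfl⟩), h.j_lt, h.free, ?_, h.sens⟩, ?_⟩
  · rintro z l' rfl
    rcases hstep with ⟨-, he⟩ | ⟨i, -, j', -, h1, -⟩
    · exact Relation.ReflTransGen.head he (h.reach x _ rfl)
    · omega
  · rintro rfl
    have := hstep.1
    omega

/-- Matching `i` with the free sensor `j`, after `i` has been separated from its partner. -/
theorem Valid.update {mA mS mS' : ℕ → ℕ} (h : N.Valid mA mS) {i j : ℕ} (hi : i < N.p) (hj : j < N.m)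
    (hfree : mS j = 0) (hr : N.Reach (N.b i) (N.c j)) (hSj : mS' j = i + 1)
    (hS : ∀ j' < N.m, j' ≠ j → mS' j' = if mS j' = i + 1 then 0 else mS j') :
    N.Valid (Function.update mA i (j + 1)) mS' := by
  refine ⟨fun i' hi' j' hij => ?_, fun j' hj' i' hji => ?_⟩
  · by_cases hii : i' = i
    · subst hii
      rw [Function.update_self] at hij
      obtain rfl : j = j' := by omega
      exact ⟨hj, hSj, hr⟩
    · rw [Function.update_of_ne hii] at hij
      obtain ⟨h1, h2, h3⟩ := h.A i' hi' j' hij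
      have hne : j' ≠ j := by rintro rfl; omega
      rw [hS j' h1 hne, if_neg (by omega)]
      exact ⟨h1, h2, h3⟩
  · by_cases hjj : j' = j
    · subst hjj
      obtain rfl : i = i' := by omega
      exact ⟨hi, by simp⟩
    · rw [hS j' hj' hjj] at hji
      split_ifs at hji with h'
      obtain ⟨h1, h2⟩ := h.S j' hj' i' hji
      refine ⟨h1, ?_⟩
      rw [Function.update_of_ne]
      · exact h2
      · rintro rfl; exact h' hji

/-- On the way back, the link from a sensor `j'` to its actuator `i` is passed: `i` is matched with `j`
instead, and `j'` is to be matched next. -/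
theorem Returning.pop_mate {i₀ j : ℕ} {mark ptr par mA mS : ℕ → ℕ} {l : List ℕ} {x y i : ℕ}
    (h : N.Returning i₀ j mark ptr par mA mS (x :: y :: l)) (hm : mark x = i + 2) :
    i < N.p ∧ mA i ≠ 0 ∧ ∃ j' < N.m, N.c j' = y ∧ N.Returning i₀ j' mark ptr par
      (Function.update mA i (j + 1)) (Function.update (Function.update mS j (i + 1)) j' 0)
      (y :: l) := by
  rcases h.core.chain.2.2.2.1 with ⟨h1, -⟩ | ⟨i', hi', j', hj', h1, h2, h3, h4⟩
  · omega
  obtain rfl : i' = i := by omega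
  obtain ⟨-, hmj', -⟩ := h.core.valid.A i' hi' j' h4
  have hjj : j' ≠ j := by rintro rfl; have := h.free; omega
  have hne : i₀ ≠ i' := by rintro rfl; have := h.core.free; omega
  have hvalid : N.Valid (Function.update mA i' (j + 1))
      (Function.update (Function.update mS j (i' + 1)) j' 0) := by
    refine h.core.valid.update hi' h.j_lt h.free (h2 ▸ h.reach x _ rfl) ?_ ?_
    · rw [Function.update_of_ne hjj.symm, Function.update_self]
    · intro j'' hj'' hne''
      by_cases hj3 : j'' = j'
      · rw [hj3, Function.update_self, if_pos hmj']
      · rw [Function.update_of_ne hj3, Function.update_of_ne hne'', if_neg]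
        intro h5
        have := (h.core.valid.S j'' hj'' i' h5).2
        omega
  have hSS : ∀ j'', mS j'' ≠ 0 ∨ j'' = j →
      Function.update (Function.update mS j (i' + 1)) j' 0 j'' ≠ 0 ∨ j'' = j' := by
    intro j'' h5
    by_cases h6 : j'' = j'
    · exact Or.inr h6
    · left
      rw [Function.update_of_ne h6]
      by_cases h7 : j'' = j
      · rw [h7, Function.update_self]; omega
      · rw [Function.update_of_ne h7]
        exact h5.resolve_right h7
  refine ⟨hi', by omega, j', hj', h3.symm, ⟨⟨hvalid, h.core.i₀_lt, ?_, ?_,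
    (List.nodup_cons.mp h.core.nodup).2, h.core.explored, ?_⟩, hj', by simp, ?_, ?_⟩⟩
  · rw [Function.update_of_ne hne]; exact h.core.free
  · refine h.core.chain.2.2.2.2.congr (fun _ _ => rfl) (fun _ _ => rfl) fun i'' _ hmem => ?_
    rw [Function.update_of_ne]
    rintro rfl
    exact (List.nodup_cons.mp h.core.nodup).1 (h2 ▸ hmem)
  · intro z hz hmz hzl
    have hbet : N.Closed mark mA z ∨
        N.Between (fun i => mA i ≠ 0 ∨ i = i₀) (fun j' => mS j' ≠ 0 ∨ j' = j) z := by
      by_cases hzx : z = x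
      · subst hzx
        exact Or.inr ⟨h.core.chain.exists_reach h.core.i₀_lt z (by simp), j, h.j_lt, Or.inr rfl,
          h.reach z _ rfl⟩
      · exact h.core.off z hz hmz (by rw [List.mem_cons, not_or]; exact ⟨hzx, hzl⟩)
    refine hbet.imp (fun hc => hc.mono (fun _ h => h) fun i'' _ => ?_) fun hb => hb.mono ?_ ?_
    · by_cases hii : i'' = i'
      · right
        rw [hii, ← h2]
        exact h.core.chain.2.2.1
      · left
        rw [Function.update_of_ne hii]
    · rintro i'' - (h5 | h5)
      · left
        by_cases hii : i'' = i'
        · rw [hii, Function.update_self]; omega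
        · rwa [Function.update_of_ne hii]
      · exact Or.inr h5
    · exact fun j'' _ => hSS j''
  · rintro z l' h5
    obtain ⟨rfl, -⟩ := List.cons.inj h5
    rw [h3]; exact .refl
  · exact fun j'' hj'' h5 => hSS j'' (h.sens j'' hj'' h5)

theorem matched_update {mA : ℕ → ℕ} {i v : ℕ} (h : mA i ≠ 0) (hv : v ≠ 0) :
    N.matched (Function.update mA i v) = N.matched mA := by
  unfold matched
  congr 1
  refine Finset.filter_congr fun i' _ => ?_
  by_cases hi : i' = i
  · rw [hi, Function.update_self]; exact ⟨fun _ => h, fun _ => hv⟩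
  · rw [Function.update_of_ne hi]

theorem matched_update_free {mA : ℕ → ℕ} {i v : ℕ} (hi : i < N.p) (h : mA i = 0) (hv : v ≠ 0) :
    N.matched (Function.update mA i v) = N.matched mA + 1 := by
  unfold matched
  have : (Finset.range N.p).filter (fun i' => Function.update mA i v i' ≠ 0) =
      insert i ((Finset.range N.p).filter fun i' => mA i' ≠ 0) := by
    ext i'
    simp only [Finset.mem_filter, Finset.mem_range, Finset.mem_insert]
    by_cases hii : i' = i
    · subst hii
      simp [hi, hv]
    · rw [Function.update_of_ne hii]
      simp [hii]
  rw [this, Finset.card_insert_of_notMem (by simp [h])]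

/-- On the way back, the start is reached: it is matched. -/
theorem Returning.pop_root {i₀ j : ℕ} {mark ptr par mA mS : ℕ → ℕ} {x : ℕ}
    (h : N.Returning i₀ j mark ptr par mA mS [x]) :
    mark x = i₀ + 2 ∧ N.Rest True mark ptr (Function.update mA i₀ (j + 1))
      (Function.update mS j (i₀ + 1)) ∧
      N.matched (Function.update mA i₀ (j + 1)) = N.matched mA + 1 := by
  obtain ⟨hm, hx⟩ := h.core.chain.2.2.2.1
  have hSS : ∀ j', mS j' ≠ 0 ∨ j' = j → Function.update mS j (i₀ + 1) j' ≠ 0 := by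
    intro j' h'
    by_cases hjj : j' = j
    · rw [hjj, Function.update_self]; omega
    · rw [Function.update_of_ne hjj]
      exact h'.resolve_right hjj
  have hAA : ∀ i, mA i ≠ 0 ∨ i = i₀ → Function.update mA i₀ (j + 1) i ≠ 0 := by
    intro i h'
    by_cases hii : i = i₀
    · rw [hii, Function.update_self]; omega
    · rw [Function.update_of_ne hii]
      exact h'.resolve_right hii
  refine ⟨hm, ⟨h.core.valid.update h.core.i₀_lt h.j_lt h.free (hx ▸ h.reach x _ rfl) (by simp) ?_,
    h.core.explored, ?_, fun j' hj' h' => hSS j' (h.sens j' hj' h')⟩,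
    matched_update_free h.core.i₀_lt h.core.free (by omega)⟩
  · intro j' hj' hne
    rw [Function.update_of_ne hne, if_neg]
    intro h'
    have h1 := (h.core.valid.S j' hj' i₀ h').2
    have h2 := h.core.free
    omega
  · intro z hz hmz
    have hbet : N.Closed mark mA z ∨
        N.Between (fun i => mA i ≠ 0 ∨ i = i₀) (fun j' => mS j' ≠ 0 ∨ j' = j) z := by
      by_cases hzx : z = x
      · subst hzx
        exact Or.inr ⟨h.core.chain.exists_reach h.core.i₀_lt z (by simp), j, h.j_lt, Or.inr rfl,
          h.reach z _ rfl⟩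
      · exact h.core.off z hz hmz (by simpa using hzx)
    refine hbet.imp (fun hc => hc.mono (fun _ h => h) fun i _ => ?_) fun hb =>
      ⟨trivial, hb.mono (fun i _ => hAA i) fun j _ => hSS j⟩
    by_cases hii : i = i₀
    · right
      rw [hii, ← hx]
      exact h.core.chain.2.2.1
    · left
      rw [Function.update_of_ne hii]

/-! ### The result of a phase -/

theorem Rest.exists_sensor {F : Prop} {mark ptr mA mS : ℕ → ℕ} (h : N.Rest F mark ptr mA mS)
    (hsnk : ∀ x < N.n, ∃ j < N.m, N.Reach x (N.c j))
    (hall : ∀ i < N.p, mA i = 0 → mark (N.b i) ≠ 0) {i : ℕ} (hi : i < N.p) :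
    ∃ j < N.m, mS j ≠ 0 ∧ N.Reach (N.b i) (N.c j) := by
  by_cases hmi : mA i = 0
  · -- otherwise the marked states that reach no matched sensor would be closed under edges
    by_contra! hcon
    have hcl : ∀ x, N.Reach (N.b i) x → x < N.n ∧ mark x ≠ 0 := by
      intro x hx
      induction hx with
      | refl => exact ⟨N.b_lt i hi, hall i hi hmi⟩
      | tail hr he ih =>
        rcases h.off _ ih.1 ih.2 with hc | ⟨-, -, j, hj, hSj, hrj⟩
        · exact ⟨he.lt, hc.1 _ he⟩
        · exact absurd (hr.trans hrj) (hcon j hj hSj)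
    obtain ⟨j, hj, hr⟩ := hsnk _ (N.b_lt i hi)
    exact hcon j hj (h.sens j hj (hcl _ hr).2) hr
  · obtain ⟨j, hj⟩ := Nat.exists_eq_succ_of_ne_zero hmi
    obtain ⟨h1, h2, h3⟩ := h.valid.A i hi j hj
    exact ⟨j, h1, by omega, h3⟩

theorem Rest.exists_actuator {F : Prop} {mark ptr mA mS : ℕ → ℕ} (h : N.Rest F mark ptr mA mS)
    (hsrc : ∀ y < N.n, ∃ i < N.p, N.Reach (N.b i) y)
    (hall : ∀ i < N.p, mA i = 0 → mark (N.b i) ≠ 0) {j : ℕ} (hj : j < N.m) :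
    ∃ i < N.p, mA i ≠ 0 ∧ N.Reach (N.b i) (N.c j) := by
  by_cases hmj : mS j = 0
  · obtain ⟨i, hi, hr⟩ := hsrc _ (N.c_lt j hj)
    by_cases hmi : mA i = 0
    · -- the last marked state on the way is not closed
      by_contra! hcon
      have hcl : ∀ x, N.Reach (N.b i) x → N.Reach x (N.c j) → x < N.n ∧ mark x ≠ 0 := by
        intro x hx
        induction hx with
        | refl => exact fun _ => ⟨N.b_lt i hi, hall i hi hmi⟩
        | tail _ he ih =>
          intro hxj
          have hyj := Relation.ReflTransGen.head he hxj
          have ih' := ih hyj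
          rcases h.off _ ih'.1 ih'.2 with hc | ⟨-, ⟨i', hi', hAi', hri'⟩, -⟩
          · exact ⟨he.lt, hc.1 _ he⟩
          · exact absurd (hri'.trans hyj) (hcon i' hi' hAi')
      exact h.sens j hj (hcl _ hr .refl).2 hmj
    · exact ⟨i, hi, hmi, hr⟩
  · obtain ⟨i, hi⟩ := Nat.exists_eq_succ_of_ne_zero hmj
    obtain ⟨h1, h2⟩ := h.valid.S j hj i hi
    exact ⟨i, h1, by omega, (h.valid.A i h1 j h2).2.2⟩

/-- After a phase without success the matching is maximum: the unmarked actuators and the marked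
sensors cover all edges of the reachability graph, and each of them is on its own matching edge. -/
theorem Rest.card_le {mark ptr mA mS : ℕ → ℕ} (h : N.Rest False mark ptr mA mS)
    (hall : ∀ i < N.p, mA i = 0 → mark (N.b i) ≠ 0) {M : Finset (ℕ × ℕ)}
    (hM : ∀ e ∈ M, e.1 < N.p ∧ e.2 < N.m ∧ N.Reach (N.b e.1) (N.c e.2))
    (hM₁ : ∀ e ∈ M, ∀ e' ∈ M, e.1 = e'.1 → e = e') (hM₂ : ∀ e ∈ M, ∀ e' ∈ M, e.2 = e'.2 → e = e') :
    M.card ≤ N.matched mA := by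
  have hcl : ∀ x, x < N.n → mark x ≠ 0 → ∀ y, N.Reach x y → mark y ≠ 0 := by
    intro x hx hm y hr
    have : y < N.n ∧ mark y ≠ 0 := by
      induction hr with
      | refl => exact ⟨hx, hm⟩
      | tail _ he ih =>
        rcases h.off _ ih.1 ih.2 with hc | ⟨hf, -⟩
        · exact ⟨he.lt, hc.1 _ he⟩
        · exact hf.elim
    exact this.2
  have hmate : ∀ j < N.m, mark (N.c j) ≠ 0 →
      ∃ i < N.p, mS j = i + 1 ∧ mA i = j + 1 ∧ mark (N.b i) ≠ 0 := by
    intro j hj hm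
    obtain ⟨i, hi⟩ := Nat.exists_eq_succ_of_ne_zero (h.sens j hj hm)
    obtain ⟨h1, h2⟩ := h.valid.S j hj i hi
    rcases h.off _ (N.c_lt j hj) hm with hc | ⟨hf, -⟩
    · exact ⟨i, h1, hi, h2, hc.2 i h1 j hj rfl h2⟩
    · exact hf.elim
  refine Finset.card_le_card_of_injOn
    (fun e => if mark (N.c e.2) = 0 then e.1 else mS e.2 - 1) ?_ ?_
  · intro e he
    obtain ⟨h1, h2, h3⟩ := hM e he
    simp only [Finset.coe_filter, Finset.mem_range, Set.mem_ofPred_eq]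
    split_ifs with hm
    · refine ⟨h1, fun h0 => ?_⟩
      exact hcl _ (N.b_lt _ h1) (hall _ h1 h0) _ h3 hm
    · obtain ⟨i, hi, h4, h5, -⟩ := hmate _ h2 hm
      rw [h4, Nat.add_sub_cancel]
      exact ⟨hi, by omega⟩
  · intro e he e' he' heq
    obtain ⟨h1, h2, h3⟩ := hM e he
    obtain ⟨h1', h2', h3'⟩ := hM e' he'
    simp only at heq
    split_ifs at heq with hm hm' hm'
    · exact hM₁ e he e' he' heq
    · obtain ⟨i, hi, h4, h5, h6⟩ := hmate _ h2' hm'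
      rw [h4, Nat.add_sub_cancel] at heq
      exact absurd hm (hcl _ (N.b_lt _ h1) (by rw [heq]; exact h6) _ h3)
    · obtain ⟨i, hi, h4, h5, h6⟩ := hmate _ h2 hm
      rw [h4, Nat.add_sub_cancel] at heq
      exact absurd hm' (hcl _ (N.b_lt _ h1') (by rw [← heq]; exact h6) _ h3')
    · obtain ⟨i, hi, h4, h5, h6⟩ := hmate _ h2 hm
      obtain ⟨i', hi', h4', h5', h6'⟩ := hmate _ h2' hm'
      rw [h4, h4', Nat.add_sub_cancel, Nat.add_sub_cancel] at heq
      subst heq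
      exact hM₂ e he e' he' (by omega)

end Net

end ResilientControl

namespace ResilientControl

/-! ### A program logic with time credits -/

theorem Test.cost_pos (b : Test) : 0 < b.cost := by
  cases b <;> simp [Test.cost]

namespace Store

@[simp] theorem reg_setReg (s : Store) (x v y : ℕ) :
    (s.setReg x v).reg y = if y = x then v else s.reg y := by
  simp [setReg, Function.update_apply]

@[simp] theorem arr_setReg (s : Store) (x v a : ℕ) : (s.setReg x v).arr a = s.arr a := rfl

@[simp] theorem reg_setArr (s : Store) (a i v x : ℕ) : (s.setArr a i v).reg x = s.reg x := rfl

@[simp] theorem arr_setArr (s : Store) (a i v a' : ℕ) :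
    (s.setArr a i v).arr a' = if a' = a then Function.update (s.arr a) i v else s.arr a' := by
  simp [setArr, Function.update_apply]

end Store

namespace Prog

/-- The register `x` is not assigned to. -/
def avoidsReg (x : ℕ) : Prog → Bool
  | assign y _ => x != y
  | store _ _ _ => true
  | seq P Q => P.avoidsReg x && Q.avoidsReg x
  | ite _ P Q => P.avoidsReg x && Q.avoidsReg x
  | loop _ P => P.avoidsReg x

/-- The array `a` is not written to. -/
def avoidsArr (a : ℕ) : Prog → Bool
  | assign _ _ => true
  | store a' _ _ => a != a'
  | seq P Q => P.avoidsArr a && Q.avoidsArr a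
  | ite _ P Q => P.avoidsArr a && Q.avoidsArr a
  | loop _ P => P.avoidsArr a

/-- The stores agree on the registers and arrays that `P` does not write to. -/
structure Frame (P : Prog) (s s' : Store) : Prop where
  reg : ∀ x, P.avoidsReg x = true → s'.reg x = s.reg x
  arr : ∀ a, P.avoidsArr a = true → s'.arr a = s.arr a

/-- There are no loops. -/
def loopFree : Prog → Bool
  | assign _ _ => true
  | store _ _ _ => true
  | seq P Q => P.loopFree && Q.loopFree
  | ite _ P Q => P.loopFree && Q.loopFree
  | loop _ _ => false

/-- The effect of a program without loops. -/
def run : Prog → Store → Store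
  | assign x e, s => s.setReg x (e.eval s)
  | store a i e, s => s.setArr a (i.eval s) (e.eval s)
  | seq P Q, s => Q.run (P.run s)
  | ite b P Q, s => if b.eval s = true then P.run s else Q.run s
  | loop _ _, s => s

attribute [simp] Expr.eval Test.eval run

theorem run_seq (P Q : Prog) (s : Store) : (P.seq Q).run s = Q.run (P.run s) := rfl

theorem run_assign (x : ℕ) (e : Expr) (s : Store) :
    (assign x e).run s = s.setReg x (e.eval s) := rfl

/-- An upper bound for the number of steps of a program without loops. -/
def bound : Prog → ℕ
  | assign _ e => e.cost + 1
  | store _ i e => i.cost + e.cost + 1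
  | seq P Q => P.bound + Q.bound
  | ite b P Q => b.cost + max P.bound Q.bound
  | loop _ _ => 0

theorem runs_run {P : Prog} (h : P.loopFree = true) (s : Store) :
    ∃ t ≤ P.bound, Runs P s (P.run s) t := by
  induction P generalizing s with
  | assign x e => exact ⟨_, le_rfl, .assign x e s⟩
  | store a i e => exact ⟨_, le_rfl, .store a i e s⟩
  | seq P Q ihP ihQ =>
    simp only [loopFree, Bool.and_eq_true] at h
    obtain ⟨t, ht, h1⟩ := ihP h.1 s
    obtain ⟨t', ht', h2⟩ := ihQ h.2 (P.run s)
    exact ⟨_, Nat.add_le_add ht ht', h1.seq h2⟩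
  | ite b P Q ihP ihQ =>
    simp only [loopFree, Bool.and_eq_true] at h
    simp only [run, bound]
    split_ifs with hb
    · obtain ⟨t, ht, h1⟩ := ihP h.1 s
      exact ⟨_, by omega, .ite_true hb h1⟩
    · obtain ⟨t, ht, h1⟩ := ihQ h.2 s
      exact ⟨_, by omega, .ite_false (by simpa using hb) h1⟩
  | loop b P => simp [loopFree] at h

end Prog

theorem Runs.frame {P : Prog} {s s' : Store} {t : ℕ} (h : Runs P s s' t) : P.Frame s s' := by
  induction h with
  | assign x e s =>
    refine ⟨fun y hy => ?_, fun _ _ => rfl⟩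
    simp only [Prog.avoidsReg, bne_iff_ne] at hy
    simp [hy]
  | store a i e s =>
    refine ⟨fun _ _ => rfl, fun a' ha => ?_⟩
    simp only [Prog.avoidsArr, bne_iff_ne] at ha
    simp [ha]
  | seq h₁ h₂ ih₁ ih₂ =>
    refine ⟨fun y hy => ?_, fun a ha => ?_⟩
    · simp only [Prog.avoidsReg, Bool.and_eq_true] at hy
      rw [ih₂.reg y hy.2, ih₁.reg y hy.1]
    · simp only [Prog.avoidsArr, Bool.and_eq_true] at ha
      rw [ih₂.arr a ha.2, ih₁.arr a ha.1]
  | ite_true hb h ih =>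
    refine ⟨fun y hy => ?_, fun a ha => ?_⟩
    · simp only [Prog.avoidsReg, Bool.and_eq_true] at hy
      exact ih.reg y hy.1
    · simp only [Prog.avoidsArr, Bool.and_eq_true] at ha
      exact ih.arr a ha.1
  | ite_false hb h ih =>
    refine ⟨fun y hy => ?_, fun a ha => ?_⟩
    · simp only [Prog.avoidsReg, Bool.and_eq_true] at hy
      exact ih.reg y hy.2
    · simp only [Prog.avoidsArr, Bool.and_eq_true] at ha
      exact ih.arr a ha.2
  | loop_false hb => exact ⟨fun _ _ => rfl, fun _ _ => rfl⟩
  | loop_true hb h₁ h₂ ih₁ ih₂ =>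
    exact ⟨fun y hy => (ih₂.reg y hy).trans (ih₁.reg y hy),
      fun a ha => (ih₂.arr a ha).trans (ih₁.arr a ha)⟩

/-- Started in `s` with a budget of `v` steps, `P` halts within the budget, and the final store and
some lower bound for the unspent steps satisfy `Q`. -/
def Wp (P : Prog) (s : Store) (v : ℕ) (Q : Store → ℕ → Prop) : Prop :=
  ∃ s' t v', Runs P s s' t ∧ t + v' ≤ v ∧ Q s' v'

namespace Wp

variable {P P' : Prog} {b : Test} {s : Store} {v : ℕ} {Q R : Store → ℕ → Prop}

theorem mono (h : Wp P s v Q) (hQ : ∀ s' v', P.Frame s s' → Q s' v' → R s' v') : Wp P s v R := by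
  obtain ⟨s', t, v', h1, h2, h3⟩ := h
  exact ⟨s', t, v', h1, h2, hQ s' v' h1.frame h3⟩

theorem seq (h : Wp P s v fun s' v' => Wp P' s' v' Q) : Wp (P.seq P') s v Q := by
  obtain ⟨s', t, v', h1, h2, s'', t', v'', h3, h4, h5⟩ := h
  exact ⟨s'', t + t', v'', h1.seq h3, by omega, h5⟩

theorem ite (hc : b.cost ≤ v) (h₁ : b.eval s = true → Wp P s (v - b.cost) Q)
    (h₂ : b.eval s = false → Wp P' s (v - b.cost) Q) : Wp (.ite b P P') s v Q := by
  cases hb : b.eval s with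
  | true =>
    obtain ⟨s', t, v', h1, h2, h3⟩ := h₁ hb
    exact ⟨s', _, v', .ite_true hb h1, by omega, h3⟩
  | false =>
    obtain ⟨s', t, v', h1, h2, h3⟩ := h₂ hb
    exact ⟨s', _, v', .ite_false hb h1, by omega, h3⟩

theorem of_run (hP : P.loopFree = true) (hv : P.bound ≤ v) (h : Q (P.run s) (v - P.bound)) :
    Wp P s v Q := by
  obtain ⟨t, ht, h1⟩ := Prog.runs_run hP s
  exact ⟨_, t, _, h1, by omega, h⟩

/-- The rule for loops. Since every test costs a step, the credits prove termination. -/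
theorem loop {I : Store → ℕ → Prop} (hI : I s v)
    (h : ∀ s' v', P.Frame s s' → I s' v' → b.cost ≤ v' ∧
      (b.eval s' = true → Wp P s' (v' - b.cost) I) ∧ (b.eval s' = false → Q s' (v' - b.cost))) :
    Wp (.loop b P) s v Q := by
  have key : ∀ v' s', P.Frame s s' → I s' v' → Wp (.loop b P) s' v' Q := by
    intro v'
    induction v' using Nat.strong_induction_on with
    | _ v' ih =>
      intro s' hf hI'
      obtain ⟨hc, h1, h2⟩ := h s' v' hf hI'
      have hpos := b.cost_pos
      cases hb : b.eval s' with
      | true =>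
        obtain ⟨s'', t, v'', h3, h4, h5⟩ := h1 hb
        have hf' : P.Frame s s'' := ⟨fun x hx => (h3.frame.reg x hx).trans (hf.reg x hx),
          fun a ha => (h3.frame.arr a ha).trans (hf.arr a ha)⟩
        obtain ⟨s₃, t', v₃, h6, h7, h8⟩ := ih v'' (by omega) s'' hf' h5
        exact ⟨s₃, _, v₃, .loop_true hb h3 h6, by omega, h8⟩
      | false => exact ⟨s', _, _, .loop_false hb, by omega, h2 hb⟩
  exact key v s ⟨fun _ _ => rfl, fun _ _ => rfl⟩ hI

/-- A larger budget leaves more unspent. -/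
theorem call {D : ℕ} {Post : Store → Prop} (h : Wp P s D fun s' _ => Post s') (hD : D ≤ v)
    (hQ : ∀ s', P.Frame s s' → Post s' → Q s' (v - D)) : Wp P s v Q := by
  obtain ⟨s', t, v', h1, h2, h3⟩ := h
  exact ⟨s', t, v - D, h1, by omega, hQ s' h1.frame h3⟩

end Wp

/-! ### The search as a program -/

namespace Machine

open ResilientControl.Expr (reg const read)
open ResilientControl.Test (lt eq)
open ResilientControl.Prog (assign store ite loop)

infixr:30 " ;; " => Prog.seq

/-- The statement without effect. -/
def nop : Prog := assign 16 (reg 16)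

/-- Puts the unmarked state in register 14 on the stack, with the mark in register 15. If a free sensor
measures it, register 12 is set and the code of the sensor is put into register 13. Register 11
holds the code of the top of the stack; the arrays 9, 10, 11 hold marks, edge pointers and parents,
array 6 the code of the sensor at a state, and the arrays 7 and 8 the partners of sensors and
actuators. -/
def visit : Prog :=
  store 9 (reg 14) (reg 15) ;;
  store 11 (reg 14) (reg 11) ;;
  store 10 (reg 14) (read 0 (reg 14)) ;;
  assign 11 (.succ (reg 14)) ;;
  ite (lt (const 0) (read 6 (reg 14)))
    (ite (eq (read 7 (.pred (read 6 (reg 14)))) (const 0))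
      (assign 12 (const 1) ;; assign 13 (read 6 (reg 14))) nop) nop

/-- One step back along the stack, after success. -/
def retreat : Prog :=
  ite (lt (const 1) (read 9 (reg 16)))
    (assign 17 (.pred (.pred (read 9 (reg 16)))) ;;
      store 7 (.pred (reg 13)) (.succ (reg 17)) ;;
      store 8 (reg 17) (reg 13) ;;
      ite (lt (const 0) (read 11 (reg 16)))
        (assign 13 (read 6 (.pred (read 11 (reg 16)))) ;; store 7 (.pred (reg 13)) (const 0)) nop)
    nop ;;
  assign 11 (read 11 (reg 16))

/-- One step of the search at the top of the stack, before success: an edge, the link from the sensor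
at the state to its partner, or a step back. -/
def explore : Prog :=
  ite (lt (read 10 (reg 16)) (read 0 (.succ (reg 16))))
    (assign 14 (read 1 (read 10 (reg 16))) ;;
      store 10 (reg 16) (.succ (read 10 (reg 16))) ;;
      assign 15 (const 1) ;;
      ite (eq (read 9 (reg 14)) (const 0)) visit nop)
    (ite (lt (const 0) (read 6 (reg 16)))
      (assign 17 (.pred (read 7 (.pred (read 6 (reg 16))))) ;;
        assign 14 (read 2 (reg 17)) ;;
        assign 15 (.succ (.succ (reg 17))) ;;
        ite (eq (read 9 (reg 14)) (const 0)) visit (assign 11 (read 11 (reg 16))))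
      (assign 11 (read 11 (reg 16))))

/-- One step of the search, with the state at the top of the stack in register 16. -/
def step : Prog :=
  assign 16 (.pred (reg 11)) ;; ite (lt (const 0) (reg 12)) retreat explore

/-- The search from the free actuator in register 5 begins. -/
def start : Prog :=
  assign 14 (read 2 (reg 5)) ;;
  assign 15 (.succ (.succ (reg 5))) ;;
  assign 11 (const 0) ;;
  assign 12 (const 0) ;;
  visit

/-- The counters are adjusted after success. -/
def finish : Prog :=
  ite (lt (const 0) (reg 12)) (assign 6 (.succ (reg 6)) ;; assign 7 (.pred (reg 7))) nop

/-- The search for an augmenting path. The registers 6 and 7 hold the size of the matching and its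
distance from the largest conceivable size. -/
def search : Prog :=
  start ;;
  loop (lt (const 0) (reg 11)) step ;;
  finish

/-- All marks are removed. -/
def unmark : Prog :=
  assign 5 (const 0) ;;
  loop (lt (reg 5) (reg 0)) (store 9 (reg 5) (const 0) ;; assign 5 (.succ (reg 5)))

/-- One phase: the searches from all free actuators whose states are not marked. -/
def phase : Prog :=
  unmark ;;
  assign 5 (const 0) ;;
  loop (lt (reg 5) (reg 1))
    (ite (eq (read 8 (reg 5)) (const 0))
      (ite (eq (read 9 (read 2 (reg 5))) (const 0)) search nop) nop ;;
    assign 5 (.succ (reg 5)))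

end Machine

open Machine

/-- The store holds the data of `N`, the number `k`, the smaller and the larger one of the numbers
of actuators and sensors, and the codes of the sensors at the states. -/
structure Holds (N : Net) (k : ℕ) (s : Store) : Prop where
  n : s.reg 0 = N.n
  p : s.reg 1 = N.p
  m : s.reg 2 = N.m
  k : s.reg 3 = k
  q : s.reg 9 = min N.p N.m
  R : s.reg 10 = max N.p N.m
  st : s.arr 0 = N.st
  adj : s.arr 1 = N.adj
  b : s.arr 2 = N.b
  c : s.arr 3 = N.c
  code : ∀ x j, s.arr 6 x = j + 1 ↔ j < N.m ∧ N.c j = x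

theorem Holds.frame {N : Net} {k : ℕ} {P : Prog} {s s' : Store} (h : Holds N k s) (hf : P.Frame s s')
    (hr : ([0, 1, 2, 3, 9, 10].all fun x => P.avoidsReg x) = true)
    (ha : ([0, 1, 2, 3, 6].all fun a => P.avoidsArr a) = true) : Holds N k s' := by
  simp only [List.all_cons, List.all_nil, Bool.and_eq_true] at hr ha
  obtain ⟨h0, h1, h2, h3, h9, h10, -⟩ := hr
  obtain ⟨a0, a1, a2, a3, a6, -⟩ := ha
  exact ⟨(hf.reg _ h0).trans h.n, (hf.reg _ h1).trans h.p, (hf.reg _ h2).trans h.m,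
    (hf.reg _ h3).trans h.k, (hf.reg _ h9).trans h.q, (hf.reg _ h10).trans h.R,
    (hf.arr _ a0).trans h.st, (hf.arr _ a1).trans h.adj, (hf.arr _ a2).trans h.b,
    (hf.arr _ a3).trans h.c, by rw [hf.arr _ a6]; exact h.code⟩

theorem Holds.setReg {N : Net} {k : ℕ} {s : Store} (h : Holds N k s) {x : ℕ} (v : ℕ)
    (hx : x ∉ [0, 1, 2, 3, 9, 10]) : Holds N k (s.setReg x v) := by
  simp only [List.mem_cons, not_or] at hx
  obtain ⟨h0, h1, h2, h3, h9, h10, -⟩ := hx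
  constructor <;> simp [h.n, h.p, h.m, h.k, h.q, h.R, h.st, h.adj, h.b, h.c, h.code, Ne.symm h0,
    Ne.symm h1, Ne.symm h2, Ne.symm h3, Ne.symm h9, Ne.symm h10]

theorem Holds.setArr {N : Net} {k : ℕ} {s : Store} (h : Holds N k s) {a : ℕ} (i v : ℕ)
    (ha : a ∉ [0, 1, 2, 3, 6]) : Holds N k (s.setArr a i v) := by
  simp only [List.mem_cons, not_or] at ha
  obtain ⟨h0, h1, h2, h3, h6, -⟩ := ha
  constructor <;> simp [h.n, h.p, h.m, h.k, h.q, h.R, h.st, h.adj, h.b, h.c, h.code, Ne.symm h0,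
    Ne.symm h1, Ne.symm h2, Ne.symm h3, Ne.symm h6]

namespace Net

variable {N : Net}

/-- The states of the free actuators before `i` are marked. -/
def MarkedBelow (N : Net) (mark mA : ℕ → ℕ) (i : ℕ) : Prop :=
  ∀ i' < i, i' < N.p → mA i' = 0 → mark (N.b i') ≠ 0

theorem MarkedBelow.mono {mark mark' mA mA' : ℕ → ℕ} {i : ℕ} (h : N.MarkedBelow mark mA i)
    (hm : ∀ y, mark y ≠ 0 → mark' y ≠ 0) (hA : ∀ i', mA' i' = 0 → mA i' = 0) :
    N.MarkedBelow mark' mA' i :=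
  fun i' h1 h2 h3 => hm _ (h i' h1 h2 (hA i' h3))

/-- The number of steps of the search still to be made, apart from those back along the stack. -/
def potential (N : Net) (mark ptr : ℕ → ℕ) : ℕ :=
  ∑ x ∈ Finset.range N.n,
    if mark x = 0 then N.st (x + 1) - N.st x + 2 else N.st (x + 1) - ptr x

theorem potential_advance {mark ptr : ℕ → ℕ} {x : ℕ} (hx : x < N.n) (hm : mark x ≠ 0)
    (hlt : ptr x < N.st (x + 1)) :
    N.potential mark (Function.update ptr x (ptr x + 1)) + 1 = N.potential mark ptr := by
  unfold potential
  rw [← Finset.add_sum_erase _ _ (Finset.mem_range.mpr hx),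
    ← Finset.add_sum_erase _ _ (Finset.mem_range.mpr hx), if_neg hm, if_neg hm,
    Finset.sum_congr rfl fun z hz => by rw [Function.update_of_ne (Finset.ne_of_mem_erase hz)],
    Function.update_self]
  omega

theorem potential_push {mark ptr : ℕ → ℕ} {y v : ℕ} (hy : y < N.n) (hm : mark y = 0) (hv : v ≠ 0) :
    N.potential (Function.update mark y v) (Function.update ptr y (N.st y)) + 2 =
      N.potential mark ptr := by
  unfold potential
  rw [← Finset.add_sum_erase _ _ (Finset.mem_range.mpr hy),
    ← Finset.add_sum_erase _ _ (Finset.mem_range.mpr hy), if_pos hm,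
    Finset.sum_congr rfl fun z hz => by
      rw [Function.update_of_ne (Finset.ne_of_mem_erase hz),
        Function.update_of_ne (Finset.ne_of_mem_erase hz)],
    Function.update_self, Function.update_self, if_neg hv]
  omega

theorem potential_zero {mark ptr : ℕ → ℕ} (h : ∀ x < N.n, mark x = 0) :
    N.potential mark ptr + N.st 0 = N.st N.n + 2 * N.n := by
  have key : ∀ a ≤ N.n, (∑ x ∈ Finset.range a,
      if mark x = 0 then N.st (x + 1) - N.st x + 2 else N.st (x + 1) - ptr x) + N.st 0 =
        N.st a + 2 * a := by
    intro a ha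
    induction a with
    | zero => simp
    | succ a ih =>
      have := N.st_le a ha
      rw [Finset.sum_range_succ, if_pos (h a ha)]
      have := ih (by omega)
      omega
  exact key N.n le_rfl

/-- The state of the search from `i` with the stack `l`, when it began with `r` matched actuators. -/
def SearchState (N : Net) (F : Prop) (i r : ℕ) (s : Store) (l : List ℕ) : Prop :=
  s.reg 11 = top l ∧ N.MarkedBelow (s.arr 9) (s.arr 8) (i + 1) ∧
    ((s.reg 12 = 0 ∧ N.matched (s.arr 8) = r ∧
        N.Searching F i (s.arr 9) (s.arr 10) (s.arr 11) (s.arr 8) (s.arr 7) l) ∨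
      (s.reg 12 ≠ 0 ∧ l ≠ [] ∧ N.matched (s.arr 8) = r ∧ ∃ j, s.reg 13 = j + 1 ∧
        N.Returning i j (s.arr 9) (s.arr 10) (s.arr 11) (s.arr 8) (s.arr 7) l) ∨
      (s.reg 12 ≠ 0 ∧ l = [] ∧ N.matched (s.arr 8) = r + 1 ∧
        N.Rest True (s.arr 9) (s.arr 10) (s.arr 8) (s.arr 7)))

theorem update_ne_zero {mark : ℕ → ℕ} {y v : ℕ} (hv : v ≠ 0) (x : ℕ) (hx : mark x ≠ 0) :
    Function.update mark y v x ≠ 0 := by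
  rw [Function.update_apply]
  split_ifs
  exacts [hv, hx]

end Net
end ResilientControl

namespace ResilientControl
open Machine
namespace Net
variable {N : Net}

theorem run_visit (s : Store) :
    ((visit.run s).arr 7 = s.arr 7 ∧ (visit.run s).arr 8 = s.arr 8) ∧
      (visit.run s).arr 9 = Function.update (s.arr 9) (s.reg 14) (s.reg 15) ∧
      (visit.run s).arr 10 = Function.update (s.arr 10) (s.reg 14) (s.arr 0 (s.reg 14)) ∧
      (visit.run s).arr 11 = Function.update (s.arr 11) (s.reg 14) (s.reg 11) ∧
      (visit.run s).reg 11 = s.reg 14 + 1 ∧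
      ((0 < s.arr 6 (s.reg 14) ∧ s.arr 7 (s.arr 6 (s.reg 14) - 1) = 0 ∧ (visit.run s).reg 12 = 1 ∧
        (visit.run s).reg 13 = s.arr 6 (s.reg 14)) ∨
      (¬ (0 < s.arr 6 (s.reg 14) ∧ s.arr 7 (s.arr 6 (s.reg 14) - 1) = 0) ∧
        (visit.run s).reg 12 = s.reg 12)) := by
  by_cases h6 : 0 < s.arr 6 (s.reg 14)
  · by_cases h7 : s.arr 7 (s.arr 6 (s.reg 14) - 1) = 0 <;> simp [visit, nop, h6, h7]
  · simp [visit, nop, h6]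

theorem searchState_visit {F : Prop} {i r k : ℕ} {s : Store} {l : List ℕ} {ptr : ℕ → ℕ}
    (hD : Holds N k s)
    (h : N.Searching F i (s.arr 9) ptr (s.arr 11) (s.arr 8) (s.arr 7) l)
    (hcur : s.reg 11 = top l) (hfound : s.reg 12 = 0) (hy : s.reg 14 < N.n)
    (hmy : s.arr 9 (s.reg 14) = 0) (hv : s.reg 15 ≠ 0)
    (hstep : N.Step i (Function.update (s.arr 9) (s.reg 14) (s.reg 15)) (s.arr 8) (s.reg 14) l)
    (hptr : ∀ x < N.n, s.arr 9 x ≠ 0 → N.st x ≤ s.arr 10 x ∧ s.arr 10 x ≤ N.st (x + 1) ∧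
      ∀ t, N.st x ≤ t → t < s.arr 10 x → s.arr 9 (N.adj t) ≠ 0 ∨ N.adj t = s.reg 14)
    (hM : N.MarkedBelow (Function.update (s.arr 9) (s.reg 14) (s.reg 15)) (s.arr 8) (i + 1))
    (hr : N.matched (s.arr 8) = r) :
    N.SearchState F i r (visit.run s) (s.reg 14 :: l) ∧
      N.potential ((visit.run s).arr 9) ((visit.run s).arr 10) + 2 =
        N.potential (s.arr 9) (s.arr 10) := by
  obtain ⟨⟨e7, e8⟩, e9, e10, e11, f11, hcase⟩ := run_visit s
  rw [hD.st] at e10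
  rw [SearchState, e7, e8, e9, e10, e11, f11, hcur]
  refine ⟨⟨rfl, hM, ?_⟩, potential_push hy hmy hv⟩
  rcases hcase with ⟨h6, h7, f12, f13⟩ | ⟨hno, f12⟩
  · obtain ⟨j, hj⟩ := Nat.exists_eq_succ_of_ne_zero h6.ne'
    rw [Nat.succ_eq_add_one] at hj
    rw [hj, Nat.add_sub_cancel] at h7
    obtain ⟨hjm, hcj⟩ := (hD.code _ _).mp hj
    exact Or.inr (Or.inl ⟨by omega, by simp, hr, j, by omega,
      h.push_found hy hmy hv hstep hptr hjm hcj h7⟩)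
  · refine Or.inl ⟨by omega, hr, h.push hy hmy hv hstep hptr fun j hj hjc h0 => hno ?_⟩
    have := (hD.code _ _).mpr ⟨hj, hjc⟩
    exact ⟨by omega, by rw [this, Nat.add_sub_cancel, h0]⟩

theorem searchState_step {F : Prop} {i r k : ℕ} {s : Store} {x : ℕ} {l : List ℕ} (hD : Holds N k s)
    (h : N.SearchState F i r s (x :: l)) :
    ∃ l', N.SearchState F i r (step.run s) l' ∧
      N.potential ((step.run s).arr 9) ((step.run s).arr 10) + l'.length + 1 ≤
        N.potential (s.arr 9) (s.arr 10) + (x :: l).length := by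
  obtain ⟨hcur, hM, ⟨hf, hr, hS⟩ | ⟨hf, -, hr, j, hj, hR⟩ | ⟨-, h0, -⟩⟩ := h
  · have hpar := hS.core.chain.1
    have hxn := hS.core.chain.2.1
    have hmx := hS.core.chain.2.2.1
    rw [top] at hcur
    by_cases hlt : s.arr 10 x < N.st (x + 1)
    · have hlt' : s.arr 10 x < s.arr 0 (x + 1) := by rw [hD.st]; exact hlt
      have hadj : s.arr 1 (s.arr 10 x) = N.adj (s.arr 10 x) := by rw [hD.adj]
      have hE : N.E x (N.adj (s.arr 10 x)) :=
        ⟨hxn, _, (hS.core.explored x hxn hmx).1, hlt, rfl⟩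
      have hpot := potential_advance hxn hmx hlt
      by_cases hmy : s.arr 9 (N.adj (s.arr 10 x)) = 0
      · set s₁ := ((((s.setReg 16 x).setReg 14 (N.adj (s.arr 10 x))).setArr 10 x
          (s.arr 10 x + 1)).setReg 15 1) with hs₁
        have hrun : step.run s = visit.run s₁ := by
          simp [step, explore, hcur, hf, hlt', hadj, hmy, hs₁]
        have h14 : s₁.reg 14 = N.adj (s.arr 10 x) := by simp [hs₁]
        obtain ⟨h1, h2⟩ := searchState_visit (s := s₁) (F := F) (i := i) (r := r) (l := x :: l)
          (ptr := s.arr 10) (k := k)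
          ((((hD.setReg _ (by simp)).setReg _ (by simp)).setArr _ _ (by simp)).setReg _ (by simp))
          (by simpa [hs₁] using hS) (by simp [hs₁, hcur, top]) (by simp [hs₁, hf])
          (by rw [h14]; exact hE.lt) (by rw [h14]; simpa [hs₁] using hmy) (by simp [hs₁])
          (by rw [h14]; exact Or.inl ⟨by simp [hs₁], hE⟩)
          (by rw [h14]; simpa [hs₁] using hS.core.explored_update hlt)
          (by rw [h14]; simpa [hs₁] using
            hM.mono (update_ne_zero one_ne_zero) fun _ h => h)
          (by simpa [hs₁] using hr)
        refine ⟨_, hrun ▸ h1, ?_⟩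
        rw [hrun]
        have h3 : N.potential (s₁.arr 9) (s₁.arr 10) + 1 = N.potential (s.arr 9) (s.arr 10) := by
          simpa [hs₁] using hpot
        simp only [List.length_cons]
        omega
      · have hadv := hS.advance hxn hlt hmy
        refine ⟨x :: l, ⟨?_, ?_, Or.inl ⟨?_, ?_, ?_⟩⟩, ?_⟩ <;>
          simp [step, explore, nop, hcur, hf, hlt', hadj, hmy, hM, hr, hadv, top]
        omega
    · have hlt' : ¬ s.arr 10 x < s.arr 0 (x + 1) := by rw [hD.st]; exact hlt
      by_cases h6 : 0 < s.arr 6 x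
      · obtain ⟨j, hj⟩ := Nat.exists_eq_succ_of_ne_zero h6.ne'
        rw [Nat.succ_eq_add_one] at hj
        obtain ⟨hjm, hcj⟩ := (hD.code _ _).mp hj
        obtain ⟨i', hi'⟩ := Nat.exists_eq_succ_of_ne_zero (hS.sens j hjm (by rw [hcj]; exact hmx))
        rw [Nat.succ_eq_add_one] at hi'
        obtain ⟨hip, hmi⟩ := hS.core.valid.S j hjm i' hi'
        have hb : s.arr 2 i' = N.b i' := by rw [hD.b]
        by_cases hmy : s.arr 9 (N.b i') = 0
        · set s₁ := (((s.setReg 16 x).setReg 17 i').setReg 14 (N.b i')).setReg 15 (i' + 2) with hs₁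
          have hrun : step.run s = visit.run s₁ := by
            simp [step, explore, hcur, hf, hlt', hj, hi', hb, hmy, hs₁]
          have h14 : s₁.reg 14 = N.b i' := by simp [hs₁]
          obtain ⟨h1, h2⟩ := searchState_visit (s := s₁) (F := F) (i := i) (r := r) (l := x :: l)
            (ptr := s.arr 10) (k := k)
            ((((hD.setReg _ (by simp)).setReg _ (by simp)).setReg _ (by simp)).setReg _ (by simp))
            (by simpa [hs₁] using hS) (by simp [hs₁, hcur, top]) (by simp [hs₁, hf])
            (by rw [h14]; exact N.b_lt i' hip) (by rw [h14]; simpa [hs₁] using hmy)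
            (by simp [hs₁])
            (by
              rw [h14]
              exact Or.inr ⟨i', hip, j, hjm, by simp [hs₁], rfl, hcj.symm, by simpa [hs₁] using hmi⟩)
            (fun z hz hmz => by
              obtain ⟨g1, g2, g3⟩ := hS.core.explored z hz (by simpa [hs₁] using hmz)
              exact ⟨by simpa [hs₁] using g1, by simpa [hs₁] using g2,
                fun t g4 g5 => Or.inl (by simpa [hs₁] using g3 t g4 (by simpa [hs₁] using g5))⟩)
            (by rw [h14]; simpa [hs₁] using
              hM.mono (update_ne_zero (by omega)) fun _ h => h)
            (by simpa [hs₁] using hr)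
          refine ⟨_, hrun ▸ h1, ?_⟩
          rw [hrun]
          have h3 : N.potential (s₁.arr 9) (s₁.arr 10) = N.potential (s.arr 9) (s.arr 10) := by
            simp [hs₁]
          simp only [List.length_cons]
          omega
        · have hpop := hS.pop hlt fun j' hj' hc => by
            obtain rfl := N.c_inj j' hj' j hjm (hc.trans hcj.symm)
            rw [hi', Nat.add_sub_cancel]
            exact hmy
          refine ⟨l, ⟨?_, ?_, Or.inl ⟨?_, ?_, ?_⟩⟩, ?_⟩ <;>
            simp [step, explore, hcur, hf, hlt', hj, hi', hb, hmy, hM, hr, hpop, hpar]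
      · have hpop := hS.pop hlt fun j' hj' hc => by
          have := (hD.code x j').mpr ⟨hj', hc⟩
          omega
        have h6' : s.arr 6 x = 0 := by omega
        refine ⟨l, ⟨?_, ?_, Or.inl ⟨?_, ?_, ?_⟩⟩, ?_⟩ <;>
          simp [step, explore, hcur, hf, hlt', h6', hM, hr, hpop, hpar]
  · have hpar := hR.core.chain.1
    rw [top] at hcur
    have hf' : 0 < s.reg 12 := by omega
    by_cases h1 : s.arr 9 x = 1
    · obtain ⟨hR', hl⟩ := hR.pop_edge h1
      refine ⟨l, ⟨?_, ?_, Or.inr (Or.inl ⟨?_, hl, ?_, j, ?_, ?_⟩)⟩, ?_⟩ <;>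
        simp [step, retreat, nop, hcur, hf', h1, hpar, hj, hM, hf, hr, hR']
    · have hm0 := hR.core.chain.2.2.1
      obtain ⟨i', hi'⟩ : ∃ i', s.arr 9 x = i' + 2 := ⟨s.arr 9 x - 2, by omega⟩
      have hM' : N.MarkedBelow (s.arr 9) (Function.update (s.arr 8) i' (j + 1)) (i + 1) := by
        refine hM.mono (fun _ h => h) fun i'' h0 => ?_
        by_contra hne
        exact update_ne_zero (Nat.succ_ne_zero j) i'' hne h0
      cases l with
      | nil =>
        obtain ⟨hmx, hrest, hcard⟩ := hR.pop_root
        obtain rfl : i' = i := by omega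
        rw [top] at hpar
        refine ⟨[], ⟨?_, ?_, Or.inr (Or.inr ⟨?_, rfl, ?_, ?_⟩)⟩, ?_⟩ <;>
          simp [step, retreat, nop, hcur, hf', hi', hpar, hj, hf, hM', hcard, hr, hrest, top]
      | cons y l =>
        obtain ⟨hip, hmi, j', hj', hcj', hR'⟩ := hR.pop_mate hi'
        rw [top] at hpar
        have hcode := (hD.code y j').mpr ⟨hj', hcj'⟩
        have hcard := matched_update (N := N) hmi (Nat.succ_ne_zero j)
        refine ⟨y :: l, ⟨?_, ?_, Or.inr (Or.inl ⟨?_, by simp, ?_, j', ?_, ?_⟩)⟩, ?_⟩ <;>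
          simp [step, retreat, nop, hcur, hf', hi', hpar, hj, hf, hM', hcard, hr, hcode, hR', top]
  · exact absurd h0 (by simp)

end Net
end ResilientControl

namespace ResilientControl
open Machine
namespace Net
variable {N : Net}

theorem Valid.matched_le {mA mS : ℕ → ℕ} (h : N.Valid mA mS) : N.matched mA ≤ min N.p N.m := by
  refine le_min ?_ ?_
  · exact (Finset.card_filter_le _ _).trans (Finset.card_range _).le
  · calc N.matched mA ≤ (Finset.range N.m).card := by
          refine Finset.card_le_card_of_injOn (fun i => mA i - 1) ?_ ?_
          · intro i hi
            simp only [Finset.coe_filter, Finset.mem_range, Set.mem_ofPred_eq] at hi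
            have := (h.A i hi.1 (mA i - 1) (by omega)).1
            simpa using this
          · intro i hi i' hi' he
            simp only [Finset.coe_filter, Finset.mem_range, Set.mem_ofPred_eq] at hi hi'
            have h1 := (h.A i hi.1 (mA i - 1) (by omega)).2.1
            have h2 := (h.A i' hi'.1 (mA i' - 1) (by omega)).2.1
            simp only at he
            rw [he] at h1
            omega
      _ = N.m := Finset.card_range _

theorem Valid.card_sensors {mA mS : ℕ → ℕ} (h : N.Valid mA mS) :
    ((Finset.range N.m).filter fun j => mS j ≠ 0).card = N.matched mA := by
  refine Finset.card_nbij' (fun j => mS j - 1) (fun i => mA i - 1) ?_ ?_ ?_ ?_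
  · intro j hj
    simp only [Finset.coe_filter, Finset.mem_range, Set.mem_ofPred_eq] at hj ⊢
    have := h.S j hj.1 (mS j - 1) (by omega)
    exact ⟨this.1, by omega⟩
  · intro i hi
    simp only [Finset.coe_filter, Finset.mem_range, Set.mem_ofPred_eq] at hi ⊢
    have := h.A i hi.1 (mA i - 1) (by omega)
    exact ⟨this.1, by omega⟩
  · intro j hj
    simp only [Finset.coe_filter, Finset.mem_range, Set.mem_ofPred_eq] at hj
    have := h.S j hj.1 (mS j - 1) (by omega)
    simp only
    omega
  · intro i hi
    simp only [Finset.coe_filter, Finset.mem_range, Set.mem_ofPred_eq] at hi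
    have := h.A i hi.1 (mA i - 1) (by omega)
    simp only
    omega

/-- The state of a phase that began with `r₀` matched actuators, before the search from `i`. -/
structure PhaseState (N : Net) (r₀ i : ℕ) (s : Store) : Prop where
  rest : N.Rest (r₀ < s.reg 6) (s.arr 9) (s.arr 10) (s.arr 8) (s.arr 7)
  card : N.matched (s.arr 8) = s.reg 6
  le : r₀ ≤ s.reg 6
  add : s.reg 6 + s.reg 7 = min N.p N.m
  marked : N.MarkedBelow (s.arr 9) (s.arr 8) i

theorem wp_search {k r₀ u : ℕ} {s : Store} (hD : Holds N k s) (h : N.PhaseState r₀ (s.reg 5) s)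
    (hi : s.reg 5 < N.p) (hfree : s.arr 8 (s.reg 5) = 0) (hmark : s.arr 9 (N.b (s.reg 5)) = 0) :
    Wp search s (100 * N.potential (s.arr 9) (s.arr 10) + 70 + u) fun s' v' =>
      N.PhaseState r₀ (s.reg 5 + 1) s' ∧ 100 * N.potential (s'.arr 9) (s'.arr 10) + u ≤ v' := by
  have hb : s.arr 2 (s.reg 5) = N.b (s.reg 5) := by rw [hD.b]
  set i := s.reg 5 with hi5
  set r := s.reg 6 with hr6
  set s₁ := (((s.setReg 14 (N.b i)).setReg 15 (i + 2)).setReg 11 0).setReg 12 0 with hs₁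
  have hrun : start.run s = visit.run s₁ := by
    simp [start, hb, hs₁, ← hi5]
  have h14 : s₁.reg 14 = N.b i := by simp [hs₁]
  have hS := h.rest.searching hi hfree (s.arr 11)
  obtain ⟨h1, h2⟩ := searchState_visit (s := s₁) (F := r₀ < r) (i := i) (r := r) (l := [])
    (ptr := s.arr 10) (k := k)
    ((((hD.setReg _ (by simp)).setReg _ (by simp)).setReg _ (by simp)).setReg _ (by simp))
    (by simpa [hs₁] using hS) (by simp [hs₁, top]) (by simp [hs₁])
    (by rw [h14]; exact N.b_lt i hi) (by rw [h14]; simpa [hs₁] using hmark) (by simp [hs₁])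
    (by rw [h14]; exact ⟨by simp [hs₁], rfl⟩)
    (fun z hz hmz => by
      obtain ⟨g1, g2, g3⟩ := h.rest.explored z hz (by simpa [hs₁] using hmz)
      exact ⟨by simpa [hs₁] using g1, by simpa [hs₁] using g2,
        fun t g4 g5 => Or.inl (by simpa [hs₁] using g3 t g4 (by simpa [hs₁] using g5))⟩)
    (by
      rw [h14]
      intro i' h3 h4 h5
      simp only [hs₁, Store.arr_setReg] at h5
      by_cases h6 : i' = i
      · simp [h6, hs₁]
      · exact update_ne_zero (by simp [hs₁]) _ (h.marked i' (by omega) h4 h5))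
    (by simpa [hs₁] using h.card)
  have h3 : N.potential (s₁.arr 9) (s₁.arr 10) = N.potential (s.arr 9) (s.arr 10) := by
    simp [hs₁]
  have hb1 : start.bound ≤ 50 := by decide
  have hb2 : step.bound ≤ 97 := by decide
  refine .seq (.of_run rfl (by omega) ?_)
  have hf0 : start.Frame s (start.run s) := (Prog.runs_run (P := start) rfl s).choose_spec.2.frame
  have hD1 : Holds N k (start.run s) := hD.frame hf0 rfl rfl
  rw [hrun] at hf0 hD1 ⊢
  refine .seq (.loop (I := fun s' v' => ∃ l, N.SearchState (r₀ < r) i r s' l ∧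
    100 * (N.potential (s'.arr 9) (s'.arr 10) + l.length) + 20 + u ≤ v')
    ⟨[s₁.reg 14], h1, by simp only [List.length_singleton]; omega⟩ ?_)
  rintro s' v' hf ⟨l, hl, hv⟩
  have hD' : Holds N k s' := hD1.frame hf rfl rfl
  have hcost : (Test.lt (Expr.const 0) (Expr.reg 11)).cost = 3 := rfl
  rw [hcost]
  refine ⟨by omega, fun ht => ?_, fun ht => ?_⟩
  · cases l with
    | nil => simp [hl.1, top] at ht
    | cons x l =>
      obtain ⟨l', hl', hpot⟩ := searchState_step hD' hl
      exact .of_run rfl (by rw [List.length_cons] at hv; omega) ⟨l', hl', by omega⟩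
  · cases l with
    | cons x l => simp [hl.1, top] at ht
    | nil =>
      have hr' : s'.reg 6 = r := (hf.reg 6 rfl).trans (hf0.reg 6 rfl)
      have hw' : s'.reg 7 = s.reg 7 := (hf.reg 7 rfl).trans (hf0.reg 7 rfl)
      have hadd := h.add
      rw [← hr6] at hadd
      have hbd : finish.bound ≤ 12 := by decide
      have harr : (finish.run s').arr = s'.arr := by
        by_cases h0 : 0 < s'.reg 12 <;> simp [finish, nop, h0, Store.setReg]
      rw [List.length_nil] at hv
      refine .of_run rfl (by omega) ?_
      obtain ⟨-, hM, ⟨hf', hc, hS'⟩ | ⟨-, h0, -⟩ | ⟨hf', -, hc, hR⟩⟩ := hl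
      · refine ⟨⟨?_, ?_, ?_, ?_, ?_⟩, ?_⟩
        · simpa [finish, hf', hr', nop] using hS'.rest
        · simpa [finish, hf', hr', nop] using hc
        · simpa [finish, hf', hr', nop] using h.le
        · simp [finish, hf', hr', hw', nop, hadd]
        · simpa [finish, hf', nop] using hM
        · rw [harr]
          omega
      · exact absurd rfl h0
      · have hle := hR.valid.matched_le
        have hf'' : 0 < s'.reg 12 := by omega
        have hle' := h.le
        have hlt : r₀ < r + 1 := by omega
        refine ⟨⟨?_, ?_, ?_, ?_, ?_⟩, ?_⟩
        · simpa [finish, hf'', hr', hlt] using hR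
        · simpa [finish, hf'', hr'] using hc
        · simp [finish, hf'', hr']; omega
        · simp [finish, hf'', hr', hw']; omega
        · simpa [finish, hf''] using hM
        · rw [harr]
          omega

theorem wp_unmark {k : ℕ} {s : Store} (hD : Holds N k s) :
    Wp unmark s (12 * N.n + 10) fun s' _ => ∀ x < N.n, s'.arr 9 x = 0 := by
  refine .seq (.of_run rfl (by simp [Prog.bound, Expr.cost]) ?_)
  refine .loop (I := fun s' v' => s'.reg 5 ≤ N.n ∧ (∀ x < s'.reg 5, s'.arr 9 x = 0) ∧
    12 * (N.n - s'.reg 5) + 4 ≤ v') ⟨by simp, by simp, by simp [Prog.bound, Expr.cost]⟩ ?_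
  rintro s' v' hf ⟨h1, h2, h3⟩
  have hn : s'.reg 0 = N.n := by rw [hf.reg 0 rfl]; simp [hD.n]
  have hcost : (Test.lt (Expr.reg 5) (Expr.reg 0)).cost = 3 := rfl
  rw [hcost]
  refine ⟨by omega, fun ht => ?_, fun ht => ?_⟩
  · have hlt : s'.reg 5 < N.n := by simpa [hn] using ht
    refine .of_run rfl (by simp [Prog.bound, Expr.cost]; omega) ⟨?_, ?_, ?_⟩
    · simpa using hlt
    · intro x hx
      simp at hx
      simp [Function.update_apply]
      intro hne
      exact h2 x (by omega)
    · simp [Prog.bound, Expr.cost]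
      omega
  · have hge : s'.reg 5 = N.n := by
      simp [hn] at ht
      omega
    rwa [hge] at h2


/-- The outcome of a phase that began with `r₀` matched actuators. -/
structure PhaseResult (N : Net) (r₀ : ℕ) (s : Store) : Prop where
  valid : N.Valid (s.arr 8) (s.arr 7)
  card : N.matched (s.arr 8) = s.reg 6
  add : s.reg 6 + s.reg 7 = min N.p N.m
  sensor : ∀ i < N.p, ∃ j < N.m, s.arr 7 j ≠ 0 ∧ N.Reach (N.b i) (N.c j)
  actuator : ∀ j < N.m, ∃ i < N.p, s.arr 8 i ≠ 0 ∧ N.Reach (N.b i) (N.c j)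
  progress : r₀ < s.reg 6 ∨ s.reg 7 = 0

/-- A bound for the number of steps of a phase. -/
def phaseCost (N : Net) : ℕ := 100 * N.st N.n + 212 * N.n + 100 * N.p + 100

theorem wp_phase {k : ℕ} {s : Store} (hD : Holds N k s) (hst : N.st 0 = 0)
    (hV : N.Valid (s.arr 8) (s.arr 7)) (hcard : N.matched (s.arr 8) = s.reg 6)
    (hadd : s.reg 6 + s.reg 7 = min N.p N.m)
    (hsnk : ∀ x < N.n, ∃ j < N.m, N.Reach x (N.c j))
    (hsrc : ∀ y < N.n, ∃ i < N.p, N.Reach (N.b i) y)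
    {M : Finset (ℕ × ℕ)} (hM : ∀ e ∈ M, e.1 < N.p ∧ e.2 < N.m ∧ N.Reach (N.b e.1) (N.c e.2))
    (hM₁ : ∀ e ∈ M, ∀ e' ∈ M, e.1 = e'.1 → e = e') (hM₂ : ∀ e ∈ M, ∀ e' ∈ M, e.2 = e'.2 → e = e')
    (hMcard : M.card = min N.p N.m) :
    Wp phase s N.phaseCost fun s' _ => N.PhaseResult (s.reg 6) s' := by
  refine .seq ((wp_unmark hD).call (by unfold phaseCost; omega) fun s₁ hf₁ h₁ => ?_)
  have hD₁ : Holds N k s₁ := hD.frame hf₁ rfl rfl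
  have a7 : s₁.arr 7 = s.arr 7 := hf₁.arr 7 rfl
  have a8 : s₁.arr 8 = s.arr 8 := hf₁.arr 8 rfl
  have r6 : s₁.reg 6 = s.reg 6 := hf₁.reg 6 rfl
  have r7 : s₁.reg 7 = s.reg 7 := hf₁.reg 7 rfl
  have hpot := N.potential_zero (ptr := s₁.arr 10) h₁
  have hrest : N.PhaseState (s.reg 6) 0 s₁ := by
    refine ⟨⟨by rw [a7, a8]; exact hV, ?_, ?_, ?_⟩, by rw [a8, r6, hcard], r6.ge,
      by rw [r6, r7, hadd], fun i' hi' => absurd hi' (by omega)⟩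
    · exact fun x hx hm => absurd (h₁ x hx) hm
    · exact fun x hx hm => absurd (h₁ x hx) hm
    · exact fun j hj hm => absurd (h₁ _ (N.c_lt j hj)) hm
  refine .seq (.of_run rfl (by simp [Prog.bound, Expr.cost]; unfold phaseCost; omega) ?_)
  refine .loop (I := fun s' v' => s'.reg 5 ≤ N.p ∧ N.PhaseState (s.reg 6) (s'.reg 5) s' ∧
    100 * N.potential (s'.arr 9) (s'.arr 10) + 100 * (N.p - s'.reg 5) + 5 ≤ v') ⟨by simp, ?_, ?_⟩ ?_
  · obtain ⟨g1, g2, g3, g4, g5⟩ := hrest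
    exact ⟨by simpa using g1, by simpa using g2, by simpa using g3, by simpa using g4,
      by simpa using g5⟩
  · simp [Prog.bound, Expr.cost]; unfold phaseCost; omega
  rintro s' v' hf ⟨h1, h2, h3⟩
  have hD' : Holds N k s' := by
    refine (hD₁.setReg 0 (x := 5) (by simp)).frame hf rfl rfl
  have hp := hD'.p
  have hcost : (Test.lt (Expr.reg 5) (Expr.reg 1)).cost = 3 := rfl
  rw [hcost]
  refine ⟨by omega, fun ht => ?_, fun ht => ?_⟩
  · have hlt : s'.reg 5 < N.p := by simpa [hp] using ht
    have hb : s'.arr 2 (s'.reg 5) = N.b (s'.reg 5) := by rw [hD'.b]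
    have hincr : ∀ s'' w, s''.reg 5 = s'.reg 5 → N.PhaseState (s.reg 6) (s'.reg 5 + 1) s'' →
        100 * N.potential (s''.arr 9) (s''.arr 10) + 100 * (N.p - (s'.reg 5 + 1)) + 10 ≤ w →
        Wp (Prog.assign 5 (.succ (.reg 5))) s'' w fun s' v' => s'.reg 5 ≤ N.p ∧
          N.PhaseState (s.reg 6) (s'.reg 5) s' ∧
          100 * N.potential (s'.arr 9) (s'.arr 10) + 100 * (N.p - s'.reg 5) + 5 ≤ v' := by
      intro s'' w e1 e2 e3
      obtain ⟨g1, g2, g3, g4, g5⟩ := e2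
      refine .of_run rfl (by simp [Prog.bound, Expr.cost]; omega) ⟨by simpa [e1] using hlt,
        ⟨by simpa using g1, by simpa using g2, by simpa using g3, by simpa using g4,
          by simpa [e1] using g5⟩, by simp [Prog.bound, Expr.cost, e1]; omega⟩
    have hskip : (s'.arr 8 (s'.reg 5) = 0 → s'.arr 9 (N.b (s'.reg 5)) ≠ 0) →
        N.PhaseState (s.reg 6) (s'.reg 5 + 1) s' := by
      refine fun hh => ⟨h2.rest, h2.card, h2.le, h2.add, fun i' g1 g2 g3 => ?_⟩
      rcases Nat.lt_succ_iff_lt_or_eq.mp g1 with g4 | g4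
      · exact h2.marked i' g4 g2 g3
      · rw [g4] at g3 ⊢
        exact hh g3
    have hnop : ∀ w, 100 * N.potential (s'.arr 9) (s'.arr 10) + 100 * (N.p - (s'.reg 5 + 1)) + 13 ≤ w →
        (s'.arr 8 (s'.reg 5) = 0 → s'.arr 9 (N.b (s'.reg 5)) ≠ 0) →
        Wp nop s' w fun s'' v'' => Wp (Prog.assign 5 (.succ (.reg 5))) s'' v'' fun s' v' =>
          s'.reg 5 ≤ N.p ∧ N.PhaseState (s.reg 6) (s'.reg 5) s' ∧
          100 * N.potential (s'.arr 9) (s'.arr 10) + 100 * (N.p - s'.reg 5) + 5 ≤ v' := by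
      intro w hw hh
      obtain ⟨g1, g2, g3, g4, g5⟩ := hskip hh
      refine .of_run rfl (by simp [nop, Prog.bound, Expr.cost]; omega) (hincr _ _ (by simp [nop])
        ⟨by simpa [nop] using g1, by simpa [nop] using g2, by simpa [nop] using g3,
          by simpa [nop] using g4, by simpa [nop] using g5⟩ ?_)
      simp [nop, Prog.bound, Expr.cost]
      omega
    have hc1 : (Test.eq (.read 8 (.reg 5)) (.const 0)).cost = 4 := rfl
    have hc2 : (Test.eq (.read 9 (.read 2 (.reg 5))) (.const 0)).cost = 5 := rfl
    refine .seq (.ite (by rw [hc1]; omega) (fun ht1 => .ite (by rw [hc1, hc2]; omega)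
      (fun ht2 => ?_) fun ht2 => ?_) fun ht1 => ?_)
    · have hfree : s'.arr 8 (s'.reg 5) = 0 := of_decide_eq_true ht1
      have hmark : s'.arr 9 (N.b (s'.reg 5)) = 0 := by simpa [hb] using ht2
      have hs := wp_search (u := 100 * (N.p - (s'.reg 5 + 1)) + 10) hD' h2 hlt hfree hmark
      rw [hc1, hc2]
      obtain ⟨s'', t, w, g1, g2, g3, g4⟩ := hs
      exact ⟨s'', t, w, g1, by omega, hincr s'' w (g1.frame.reg 5 rfl) g3 (by omega)⟩
    · refine hnop _ (by rw [hc1, hc2]; omega) fun _ => ?_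
      simpa [hb] using ht2
    · refine hnop _ (by rw [hc1]; omega) fun h0 => ?_
      simp [h0] at ht1
  · have hge : s'.reg 5 = N.p := by
      simp [hp] at ht
      omega
    rw [hge] at h2
    have hall : ∀ i < N.p, s'.arr 8 i = 0 → s'.arr 9 (N.b i) ≠ 0 := fun i hi => h2.marked i hi hi
    refine ⟨h2.rest.valid, h2.card, h2.add, fun i hi => h2.rest.exists_sensor hsnk hall hi,
      fun j hj => h2.rest.exists_actuator hsrc hall hj, ?_⟩
    by_cases hlt : s.reg 6 < s'.reg 6
    · exact Or.inl hlt
    · right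
      have hrest := h2.rest
      rw [show (s.reg 6 < s'.reg 6) = False by simp [hlt]] at hrest
      have := hrest.card_le hall hM hM₁ hM₂
      have h3 := h2.card
      have h4 := h2.add
      omega

end Net
end ResilientControl

namespace ResilientControl

/-! ### The matching and the order of its vertices -/

namespace Machine

open ResilientControl.Expr (reg const read)
open ResilientControl.Test (lt eq)
open ResilientControl.Prog (assign store ite loop)

/-- Another phase is called for, and register 8 set, if the matching is not as large as conceivable, and
has fewer than `k + 2` edges or leaves fewer than `k + 1` vertices free on the smaller side. -/
def judge : Prog :=
  assign 8 (const 0) ;;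
  ite (lt (const 0) (reg 7))
    (ite (lt (reg 6) (.succ (.succ (reg 3)))) (assign 8 (const 1))
      (ite (lt (reg 7) (.succ (reg 3))) (assign 8 (const 1)) nop)) nop

/-- Phases are repeated as long as they are called for. Each of them but the last enlarges the matching,
so that there are at most `2 k + 2`. -/
def findMatching : Prog := loop (lt (const 0) (reg 8)) (phase ;; judge)

/-- The codes of the sensors at the states are stored. -/
def encode : Prog :=
  assign 5 (const 0) ;;
  loop (lt (reg 5) (reg 2))
    (store 6 (read 3 (reg 5)) (.succ (reg 5)) ;; assign 5 (.succ (reg 5)))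

/-- The smaller and the larger one of the numbers of actuators and sensors are determined. No matching
is needed, and register 8 not set, if every actuator is to be linked with every sensor. -/
def setSizes : Prog :=
  ite (lt (reg 1) (reg 2)) (assign 9 (reg 1) ;; assign 10 (reg 2))
    (assign 9 (reg 2) ;; assign 10 (reg 1)) ;;
  assign 7 (reg 9) ;;
  ite (lt (.succ (reg 3)) (reg 9)) (assign 8 (const 1)) (assign 8 (const 0))

/-- The matched actuators and their partners are listed in the arrays 12 and 13. -/
def listMatched : Prog :=
  assign 18 (const 0) ;;
  assign 5 (const 0) ;;
  loop (lt (reg 5) (reg 1))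
    (ite (lt (const 0) (read 8 (reg 5)))
      (store 12 (reg 18) (reg 5) ;; store 13 (reg 18) (.pred (read 8 (reg 5))) ;;
        assign 18 (.succ (reg 18))) nop ;;
    assign 5 (.succ (reg 5)))

/-- The free vertices are listed after the matched ones. -/
def listFree (bnd mate ord : ℕ) : Prog :=
  assign 18 (reg 6) ;;
  assign 5 (const 0) ;;
  loop (lt (reg 5) (reg bnd))
    (ite (eq (read mate (reg 5)) (const 0))
      (store ord (reg 18) (reg 5) ;; assign 18 (.succ (reg 18))) nop ;;
    assign 5 (.succ (reg 5)))

end Machine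

open Machine

namespace Net
variable {N : Net}

/-- What the final matching has to satisfy. -/
structure MatchResult (N : Net) (k : ℕ) (s : Store) : Prop where
  valid : N.Valid (s.arr 8) (s.arr 7)
  card : N.matched (s.arr 8) = s.reg 6
  add : s.reg 6 + s.reg 7 = min N.p N.m
  sensor : ∀ i < N.p, ∃ j < N.m, s.arr 7 j ≠ 0 ∧ N.Reach (N.b i) (N.c j)
  actuator : ∀ j < N.m, ∃ i < N.p, s.arr 8 i ≠ 0 ∧ N.Reach (N.b i) (N.c j)
  size : k + 2 ≤ s.reg 6
  rest : s.reg 7 = 0 ∨ k + 1 ≤ s.reg 7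

theorem wp_findMatching {k : ℕ} {s : Store} (hD : Holds N k s) (hst : N.st 0 = 0)
    (hV : N.Valid (s.arr 8) (s.arr 7)) (hcard : N.matched (s.arr 8) = 0) (h6 : s.reg 6 = 0)
    (h7 : s.reg 7 = min N.p N.m) (h8 : s.reg 8 = 1) (hk : k + 2 ≤ min N.p N.m)
    (hsnk : ∀ x < N.n, ∃ j < N.m, N.Reach x (N.c j))
    (hsrc : ∀ y < N.n, ∃ i < N.p, N.Reach (N.b i) y)
    {M : Finset (ℕ × ℕ)} (hM : ∀ e ∈ M, e.1 < N.p ∧ e.2 < N.m ∧ N.Reach (N.b e.1) (N.c e.2))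
    (hM₁ : ∀ e ∈ M, ∀ e' ∈ M, e.1 = e'.1 → e = e') (hM₂ : ∀ e ∈ M, ∀ e' ∈ M, e.2 = e'.2 → e = e')
    (hMcard : M.card = min N.p N.m) :
    Wp findMatching s ((2 * k + 2) * (N.phaseCost + 40) + 3) fun s' _ => N.MatchResult k s' := by
  refine .loop (I := fun s' v' => N.Valid (s'.arr 8) (s'.arr 7) ∧
    N.matched (s'.arr 8) = s'.reg 6 ∧ s'.reg 6 + s'.reg 7 = min N.p N.m ∧
    ((s'.reg 8 = 0 ∧ N.MatchResult k s' ∧ 3 ≤ v') ∨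
      (s'.reg 8 ≠ 0 ∧ 0 < s'.reg 7 ∧ (s'.reg 6 < k + 2 ∨ s'.reg 7 < k + 1) ∧
        (k + 2 - s'.reg 6 + min (s'.reg 7) k) * (N.phaseCost + 40) + 3 ≤ v')))
    ⟨hV, by rw [hcard, h6], by rw [h6, h7, zero_add], Or.inr ⟨by omega, by omega, by omega, ?_⟩⟩ ?_
  · rw [h6, h7, min_eq_right (by omega), show k + 2 - 0 + k = 2 * k + 2 by omega]
  rintro s' v' hf ⟨g1, g2, g3, g4⟩
  have hD' : Holds N k s' := hD.frame hf rfl rfl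
  have hcost : (Test.lt (Expr.const 0) (Expr.reg 8)).cost = 3 := rfl
  rw [hcost]
  rcases g4 with ⟨e1, e2, e3⟩ | ⟨e1, e2, e3, e4⟩
  · exact ⟨e3, fun ht => by simp [e1] at ht, fun _ => e2⟩
  · refine ⟨by omega, fun _ => ?_, fun ht => absurd (of_decide_eq_false ht) (by simpa using e1)⟩
    set T := N.phaseCost + 40 with hT
    have hone : 1 * T ≤ (k + 2 - s'.reg 6 + min (s'.reg 7) k) * T :=
      Nat.mul_le_mul_right T (by omega)
    refine .seq ((wp_phase hD' hst g1 g2 g3 hsnk hsrc hM hM₁ hM₂ hMcard).call (by omega)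
      fun s₁ hf₁ hR => ?_)
    have hb : judge.bound ≤ 37 := by decide
    have hD₁ : Holds N k s₁ := hD'.frame hf₁ rfl rfl
    have hk' := hD₁.k
    obtain ⟨f1, f2, f3, f4, f5, f6⟩ := hR
    refine .of_run rfl (by omega) ?_
    have harr : (judge.run s₁).arr = s₁.arr := by
      by_cases c1 : 0 < s₁.reg 7 <;> by_cases c2 : s₁.reg 6 < k + 2 <;>
        by_cases c3 : s₁.reg 7 < k + 1 <;> simp [judge, nop, Store.setReg, c1, c2, c3, hk']
    have hr6 : (judge.run s₁).reg 6 = s₁.reg 6 :=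
      (Prog.runs_run (P := judge) rfl s₁).choose_spec.2.frame.reg 6 rfl
    have hr7 : (judge.run s₁).reg 7 = s₁.reg 7 :=
      (Prog.runs_run (P := judge) rfl s₁).choose_spec.2.frame.reg 7 rfl
    have hr8 : (judge.run s₁).reg 8 =
        if 0 < s₁.reg 7 ∧ (s₁.reg 6 < k + 2 ∨ s₁.reg 7 < k + 1) then 1 else 0 := by
      by_cases c1 : 0 < s₁.reg 7 <;> by_cases c2 : s₁.reg 6 < k + 2 <;>
        by_cases c3 : s₁.reg 7 < k + 1 <;> simp [judge, nop, c1, c2, c3, hk']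
    rw [harr, hr6, hr7, hr8]
    refine ⟨f1, f2, f3, ?_⟩
    split_ifs with hc
    · right
      have hlt : k + 2 - s₁.reg 6 + min (s₁.reg 7) k + 1 ≤
          k + 2 - s'.reg 6 + min (s'.reg 7) k := by omega
      have := Nat.mul_le_mul_right T hlt
      rw [Nat.add_mul _ 1 T] at this
      exact ⟨by omega, hc.1, hc.2, by omega⟩
    · left
      exact ⟨rfl, ⟨by rw [harr]; exact f1, by rw [harr, hr6]; exact f2, by rw [hr6, hr7]; exact f3,
        by rw [harr]; exact f4, by rw [harr]; exact f5, by rw [hr6]; omega, by rw [hr7]; omega⟩,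
        by omega⟩

/-- The store holds the input, and all else is zero. -/
structure Input (N : Net) (k : ℕ) (s : Store) : Prop where
  n : s.reg 0 = N.n
  p : s.reg 1 = N.p
  m : s.reg 2 = N.m
  k : s.reg 3 = k
  reg : ∀ x, 4 ≤ x → s.reg x = 0
  st : s.arr 0 = N.st
  adj : s.arr 1 = N.adj
  b : s.arr 2 = N.b
  c : s.arr 3 = N.c
  arr : ∀ a i, 4 ≤ a → s.arr a i = 0

theorem wp_encode_setSizes {k v : ℕ} {s : Store} {Q : Store → ℕ → Prop} (h : N.Input k s)
    (hQ : ∀ s', Holds N k s' → (∀ i, s'.arr 7 i = 0) → (∀ i, s'.arr 8 i = 0) → s'.reg 4 = 0 →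
      s'.reg 6 = 0 → s'.reg 7 = min N.p N.m → s'.reg 8 = (if k + 1 < min N.p N.m then 1 else 0) →
      Q s' v) : Wp (encode ;; setSizes) s (20 * N.m + 50 + v) Q := by
  refine .seq (.seq (.of_run rfl (by simp [Prog.bound, Expr.cost]; omega) ?_))
  refine .loop (I := fun s' v' => s'.reg 5 ≤ N.m ∧
    (∀ x j, s'.arr 6 x = j + 1 ↔ j < s'.reg 5 ∧ N.c j = x) ∧ 20 * (N.m - s'.reg 5) + 40 + v ≤ v')
    ⟨by simp, by simp [h.arr], by simp [Prog.bound, Expr.cost]; omega⟩ ?_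
  rintro s' v' hf ⟨h1, h2, h3⟩
  have hm : s'.reg 2 = N.m := by rw [hf.reg 2 rfl]; simp [h.m]
  have hc : s'.arr 3 = N.c := by rw [hf.arr 3 rfl]; simp [h.c]
  have hcost : (Test.lt (Expr.reg 5) (Expr.reg 2)).cost = 3 := rfl
  rw [hcost]
  refine ⟨by omega, fun ht => ?_, fun ht => ?_⟩
  · have hlt : s'.reg 5 < N.m := by simpa [hm] using ht
    refine .of_run rfl (by simp [Prog.bound, Expr.cost]; omega) ⟨?_, ?_, ?_⟩
    · simpa using hlt
    · intro x j
      simp only [Prog.run, Expr.eval, Store.arr_setReg, Store.arr_setArr, Store.reg_setReg,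
        Store.reg_setArr, hc, if_true]
      rw [Function.update_apply]
      split_ifs with hx
      · constructor
        · intro hj
          exact ⟨by omega, by rw [hx, show j = s'.reg 5 by omega]⟩
        · rintro ⟨hj, hjx⟩
          rw [N.c_inj j (by omega) (s'.reg 5) hlt (hjx.trans hx)]
      · rw [h2 x j]
        constructor
        · exact fun hh => ⟨by omega, hh.2⟩
        · rintro ⟨hj, hjx⟩
          refine ⟨?_, hjx⟩
          by_contra hge
          exact hx (by rw [← hjx, show j = s'.reg 5 by omega])
    · simp [Prog.bound, Expr.cost]
      omega
  · have hge : s'.reg 5 = N.m := by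
      simp [hm] at ht
      omega
    rw [hge] at h2
    have hb : setSizes.bound ≤ 37 := by decide
    obtain ⟨t, ht, hrun⟩ := Prog.runs_run (P := setSizes) rfl s'
    have hn : s'.reg 0 = N.n := by rw [hf.reg 0 rfl]; simp [h.n]
    have hp : s'.reg 1 = N.p := by rw [hf.reg 1 rfl]; simp [h.p]
    have hk : s'.reg 3 = k := by rw [hf.reg 3 rfl]; simp [h.k]
    have harr : (setSizes.run s').arr = s'.arr := by
      by_cases c1 : N.p < N.m
      · by_cases c2 : k + 1 < N.p <;> simp [setSizes, Store.setReg, c1, c2, hp, hm, hk]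
      · by_cases c2 : k + 1 < N.m <;> simp [setSizes, Store.setReg, c1, c2, hp, hm, hk]
    refine ⟨_, t, v, hrun, by omega, hQ _ ⟨?_, ?_, ?_, ?_, ?_, ?_, ?_, ?_, ?_, ?_, ?_⟩ ?_ ?_ ?_ ?_
      ?_ ?_⟩
    · rw [hrun.frame.reg 0 rfl, hn]
    · rw [hrun.frame.reg 1 rfl, hp]
    · rw [hrun.frame.reg 2 rfl, hm]
    · rw [hrun.frame.reg 3 rfl, hk]
    · by_cases c1 : N.p < N.m
      · by_cases c2 : k + 1 < N.p <;> simp [setSizes, c1, c2, hp, hm, hk] <;> omega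
      · by_cases c2 : k + 1 < N.m <;> simp [setSizes, c1, c2, hp, hm, hk] <;> omega
    · by_cases c1 : N.p < N.m
      · by_cases c2 : k + 1 < N.p <;> simp [setSizes, c1, c2, hp, hm, hk] <;> omega
      · by_cases c2 : k + 1 < N.m <;> simp [setSizes, c1, c2, hp, hm, hk] <;> omega
    · rw [harr, hf.arr 0 rfl]; simp [h.st]
    · rw [harr, hf.arr 1 rfl]; simp [h.adj]
    · rw [harr, hf.arr 2 rfl]; simp [h.b]
    · rw [harr, hc]
    · rw [harr]; exact h2
    · rw [harr, hf.arr 7 rfl]; simp [h.arr]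
    · rw [harr, hf.arr 8 rfl]; simp [h.arr]
    · rw [hrun.frame.reg 4 rfl, hf.reg 4 rfl]; simp [h.reg]
    · rw [hrun.frame.reg 6 rfl, hf.reg 6 rfl]; simp [h.reg]
    · by_cases c1 : N.p < N.m
      · by_cases c2 : k + 1 < N.p <;> simp [setSizes, c1, c2, hp, hm, hk] <;> omega
      · by_cases c2 : k + 1 < N.m <;> simp [setSizes, c1, c2, hp, hm, hk] <;> omega
    · by_cases c1 : N.p < N.m
      · rw [min_eq_left c1.le]
        by_cases c2 : k + 1 < N.p <;> simp [setSizes, c1, c2, hp, hm, hk]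
      · rw [min_eq_right (by omega)]
        by_cases c2 : k + 1 < N.m <;> simp [setSizes, c1, c2, hp, hm, hk]

theorem wp_listMatched {k : ℕ} {s : Store} (hD : Holds N k s)
    (hcard : N.matched (s.arr 8) = s.reg 6) :
    Wp listMatched s (40 * N.p + 20) fun s' _ =>
      (∀ l < s.reg 6, s'.arr 12 l < N.p ∧ s.arr 8 (s'.arr 12 l) = s'.arr 13 l + 1) ∧
      ∀ l < s.reg 6, ∀ l' < s.reg 6, s'.arr 12 l = s'.arr 12 l' → l = l' := by
  refine .seq (.of_run rfl (by simp [Prog.bound, Expr.cost]) ?_)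
  refine .seq (.of_run rfl (by simp [Prog.bound, Expr.cost]) ?_)
  refine .loop (I := fun s' v' => s'.reg 5 ≤ N.p ∧
    s'.reg 18 = Nat.count (fun i => s.arr 8 i ≠ 0) (s'.reg 5) ∧
    (∀ l < s'.reg 18, s'.arr 12 l < s'.reg 5 ∧ s.arr 8 (s'.arr 12 l) = s'.arr 13 l + 1) ∧
    (∀ l < s'.reg 18, ∀ l' < s'.reg 18, s'.arr 12 l = s'.arr 12 l' → l = l') ∧
    40 * (N.p - s'.reg 5) + 10 ≤ v') ⟨by simp, by simp, by simp, by simp, ?_⟩ ?_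
  · simp [Prog.bound, Expr.cost]
  rintro s' v' hf ⟨h1, h2, h3, h4, h5⟩
  have hp : s'.reg 1 = N.p := by rw [hf.reg 1 rfl]; simp [hD.p]
  have h8 : s'.arr 8 = s.arr 8 := by rw [hf.arr 8 rfl]; simp
  have hcost : (Test.lt (Expr.reg 5) (Expr.reg 1)).cost = 3 := rfl
  rw [hcost]
  refine ⟨by omega, fun ht => ?_, fun ht => ?_⟩
  · have hlt : s'.reg 5 < N.p := by simpa [hp] using ht
    refine .of_run rfl (by simp [Prog.bound, Expr.cost, Test.cost, nop]; omega) ?_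
    by_cases h0 : 0 < s.arr 8 (s'.reg 5)
    · refine ⟨?_, ?_, ?_, ?_, ?_⟩
      · simpa [h8, h0] using hlt
      · simp [h8, h0, Nat.count_succ, h2, h0.ne']
      · intro l hl
        simp only [Prog.run, Test.eval, Expr.eval, h8, h0] at hl ⊢
        simp at hl ⊢
        by_cases hl' : l = s'.reg 18
        · subst hl'
          simp [h8]
          omega
        · have := h3 l (by omega)
          simp [hl', this]
          omega
      · intro l hl l' hl'
        simp only [Prog.run, Test.eval, Expr.eval, h8, h0] at hl hl' ⊢
        simp at hl hl' ⊢
        by_cases e : l = s'.reg 18 <;> by_cases e' : l' = s'.reg 18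
        · omega
        · have := (h3 l' (by omega)).1
          simp [e, e']
          omega
        · have := (h3 l (by omega)).1
          simp [e, e']
          omega
        · simp [e, e']
          exact h4 l (by omega) l' (by omega)
      · simp only [Prog.run, Test.eval, Expr.eval, h8, h0]
        simp [Prog.bound, Expr.cost, Test.cost, nop]
        omega
    · have h0' : s.arr 8 (s'.reg 5) = 0 := by omega
      refine ⟨?_, ?_, ?_, ?_, ?_⟩
      · simpa [h8, h0', nop] using hlt
      · simp [h8, h0', Nat.count_succ, h2, nop]
      · intro l hl
        simp [h8, h0', nop] at hl ⊢
        have := h3 l hl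
        exact ⟨by omega, this.2⟩
      · intro l hl l' hl'
        simp [h8, h0', nop] at hl hl' ⊢
        exact h4 l hl l' hl'
      · simp [h8, h0', nop, Prog.bound, Expr.cost, Test.cost]
        omega
  · have hge : s'.reg 5 = N.p := by
      simp [hp] at ht
      omega
    have hc : s'.reg 18 = s.reg 6 := by
      rw [h2, hge, Nat.count_eq_card_filter_range]
      exact hcard
    rw [hge, hc] at h3
    rw [hc] at h4
    exact ⟨h3, h4⟩

theorem wp_listFree {bnd mate ord B : ℕ} {s : Store} (hbnd : s.reg bnd = B)
    (hb5 : bnd ≠ 5) (hb16 : bnd ≠ 16) (hb18 : bnd ≠ 18) (hmo : mate ≠ ord)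
    (hcard : ((Finset.range B).filter fun i => s.arr mate i ≠ 0).card = s.reg 6)
    (hlt : ∀ l < s.reg 6, s.arr ord l < B ∧ s.arr mate (s.arr ord l) ≠ 0)
    (hinj : ∀ l < s.reg 6, ∀ l' < s.reg 6, s.arr ord l = s.arr ord l' → l = l') :
    Wp (listFree bnd mate ord) s (40 * B + 20) fun s' _ =>
      (∀ l < s.reg 6, s'.arr ord l = s.arr ord l) ∧ (∀ l < B, s'.arr ord l < B) ∧
      ∀ l < B, ∀ l' < B, s'.arr ord l = s'.arr ord l' → l = l' := by
  refine .seq (.of_run rfl (by simp [Prog.bound, Expr.cost]) ?_)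
  refine .seq (.of_run rfl (by simp [Prog.bound, Expr.cost]) ?_)
  refine .loop (I := fun s' v' => s'.reg 5 ≤ B ∧
    s'.reg 18 = s.reg 6 + Nat.count (fun i => s.arr mate i = 0) (s'.reg 5) ∧
    (∀ l < s.reg 6, s'.arr ord l = s.arr ord l) ∧
    (∀ l, s.reg 6 ≤ l → l < s'.reg 18 → s'.arr ord l < s'.reg 5 ∧ s.arr mate (s'.arr ord l) = 0) ∧
    (∀ l < s'.reg 18, ∀ l' < s'.reg 18, s'.arr ord l = s'.arr ord l' → l = l') ∧
    40 * (B - s'.reg 5) + 10 ≤ v') ⟨by simp, by simp, by simp, ?_, ?_, ?_⟩ ?_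
  · intro l h1 h2
    simp at h2
    omega
  · simpa using hinj
  · simp [Prog.bound, Expr.cost]
  rintro s' v' hf ⟨h1, h2, h2', h3, h4, h5⟩
  have hp : s'.reg bnd = B := by
    rw [hf.reg bnd (by simp [Prog.avoidsReg, nop, hb5, hb16, hb18])]
    simp [hb5, hb18, hbnd]
  have h8 : s'.arr mate = s.arr mate := by
    rw [hf.arr mate (by simp [Prog.avoidsArr, nop, hmo])]
    simp
  have hcost : (Test.lt (Expr.reg 5) (Expr.reg bnd)).cost = 3 := rfl
  rw [hcost]
  refine ⟨by omega, fun ht => ?_, fun ht => ?_⟩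
  · have hlt' : s'.reg 5 < B := by simpa [hp] using ht
    refine .of_run rfl (by simp [Prog.bound, Expr.cost, Test.cost, nop]; omega) ?_
    by_cases h0 : s.arr mate (s'.reg 5) = 0
    · refine ⟨?_, ?_, ?_, ?_, ?_, ?_⟩
      · simpa [h8, h0] using hlt'
      · simp [h8, h0, Nat.count_succ, h2, add_assoc]
      · intro l hl
        simp [h8, h0]
        rw [Function.update_of_ne (by omega), h2' l hl]
      · intro l hl0 hl
        simp [h8, h0] at hl ⊢
        by_cases hl' : l = s'.reg 18
        · subst hl'
          simp [h0]
        · have := h3 l hl0 (by omega)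
          simp [hl', this]
          omega
      · have hne : ∀ l < s'.reg 18, s'.arr ord l ≠ s'.reg 5 := by
          intro l hl hh
          by_cases hl0 : l < s.reg 6
          · have := (hlt l hl0).2
            rw [← h2' l hl0, hh] at this
            exact this h0
          · have := (h3 l (by omega) hl).1
            omega
        intro l hl l' hl'
        simp [h8, h0] at hl hl' ⊢
        by_cases e : l = s'.reg 18 <;> by_cases e' : l' = s'.reg 18
        · omega
        · have := hne l' (by omega)
          simp [e, e']
          omega
        · have := hne l (by omega)
          simp [e, e']
          omega
        · simp [e, e']
          exact h4 l (by omega) l' (by omega)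
      · simp [h8, h0, Prog.bound, Expr.cost, Test.cost, nop]
        omega
    · refine ⟨?_, ?_, ?_, ?_, ?_, ?_⟩
      · simpa [h8, h0, nop] using hlt'
      · simp [h8, h0, Nat.count_succ, h2, nop]
      · intro l hl
        simp [h8, h0, nop]
        exact h2' l hl
      · intro l hl0 hl
        simp [h8, h0, nop] at hl ⊢
        have := h3 l hl0 hl
        exact ⟨by omega, this.2⟩
      · intro l hl l' hl'
        simp [h8, h0, nop] at hl hl' ⊢
        exact h4 l hl l' hl'
      · simp [h8, h0, nop, Prog.bound, Expr.cost, Test.cost]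
        omega
  · have hge : s'.reg 5 = B := by
      simp [hp] at ht
      omega
    have hc : s'.reg 18 = B := by
      have := Finset.card_filter_add_card_filter_not (s := Finset.range B)
        (fun i => s.arr mate i = 0)
      have hcard' : ((Finset.range B).filter fun i => ¬ s.arr mate i = 0).card = s.reg 6 := by
        convert hcard
      rw [Finset.card_range, hcard'] at this
      rw [h2, hge, Nat.count_eq_card_filter_range]
      omega
    rw [hge, hc] at h3
    rw [hc] at h4
    refine ⟨h2', fun l hl => ?_, h4⟩
    by_cases hl0 : l < s.reg 6
    · rw [h2' l hl0]
      exact (hlt l hl0).1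
    · exact (h3 l (by omega) hl).1

end Net
end ResilientControl

namespace ResilientControl

/-! ### The output -/

theorem linkBlock_succ (a rows base size off d : ℕ) :
    linkBlock a (rows + 1) base size off d = linkBlock a rows base size off d ∪
      (Finset.range d).image fun t => (a + rows, base + (rows + off + t) % size) := by
  ext e
  simp only [Finset.mem_union, mem_linkBlock, Finset.mem_image, Finset.mem_range]
  constructor
  · rintro ⟨l, hl, t, ht, rfl⟩
    rcases Nat.lt_succ_iff_lt_or_eq.mp hl with h | rfl
    · exact Or.inl ⟨l, h, t, ht, rfl⟩
    · exact Or.inr ⟨t, ht, rfl⟩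
  · rintro (⟨l, hl, t, ht, rfl⟩ | ⟨t, ht, rfl⟩)
    · exact ⟨l, by omega, t, ht, rfl⟩
    · exact ⟨rows, by omega, t, ht, rfl⟩

theorem linkBlock_zero (a base size off d : ℕ) : linkBlock a 0 base size off d = ∅ := by
  simp [linkBlock]

theorem succ_mod {size : ℕ} (hs : 0 < size) (y : ℕ) :
    (y + 1) % size = if y % size + 1 = size then 0 else y % size + 1 := by
  have h := Nat.mod_lt y hs
  split_ifs with h1
  · rw [← Nat.mod_add_mod, h1, Nat.mod_self]
  · rw [← Nat.mod_add_mod, Nat.mod_eq_of_lt (by omega)]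

namespace Machine

open ResilientControl.Expr (reg const read)
open ResilientControl.Test (lt eq)
open ResilientControl.Prog (assign store ite loop)

/-- The link of row 19 and column 23 is appended to the output. The rows belong to the larger one of the
two sets of vertices. -/
def emit : Prog :=
  ite (lt (reg 1) (reg 2))
    (store 4 (reg 4) (read 13 (reg 19)) ;; store 5 (reg 4) (read 12 (reg 23)))
    (store 4 (reg 4) (read 13 (reg 23)) ;; store 5 (reg 4) (read 12 (reg 19))) ;;
  assign 4 (.succ (reg 4))

/-- The number in register `x` moves on by one, cyclically between the numbers in the registers 21
and 22. -/
def rotate (x : ℕ) : Prog :=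
  assign x (.succ (reg x)) ;; ite (eq (reg x) (reg 22)) (assign x (reg 21)) nop

/-- The links of row 19, from column 24 on. -/
def emitRow : Prog :=
  assign 23 (reg 24) ;;
  assign 25 (const 0) ;;
  loop (lt (reg 25) (.succ (reg 3))) (emit ;; rotate 23 ;; assign 25 (.succ (reg 25)))

/-- The links of the rows from 19 to 20. -/
def emitBlock : Prog :=
  loop (lt (reg 19) (reg 20)) (emitRow ;; rotate 24 ;; assign 19 (.succ (reg 19)))

/-- Prepares the links among the matched pairs: each sensor is linked with the actuators of the `k + 1`
next pairs, cyclically. -/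
def emitCore : Prog :=
  assign 19 (const 0) ;; assign 20 (reg 6) ;; assign 21 (const 0) ;; assign 22 (reg 6) ;;
  assign 24 (const 1)

/-- Prepares the links of the rows that are not in the matching: each of them gets `k + 1` consecutive
columns among the free ones, or among all if none is free. -/
def emitExtra : Prog :=
  assign 19 (reg 6) ;; assign 20 (reg 10) ;; assign 21 (const 0) ;;
  ite (lt (const 0) (reg 7)) (assign 21 (reg 6)) nop ;; assign 22 (reg 9) ;; assign 24 (reg 21)

/-- The links are put out. -/
def output : Prog := emitCore ;; emitBlock ;; emitExtra ;; emitBlock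

end Machine

open Machine

namespace Net
variable {N : Net}

/-- The links in the output. -/
def emitted (s : Store) : Finset (ℕ × ℕ) :=
  (Finset.range (s.reg 4)).image fun t => (s.arr 4 t, s.arr 5 t)

/-- The link of a row and a column, for the orders of the actuators and the sensors in the arrays 12
and 13. -/
def linkOf (N : Net) (s : Store) (e : ℕ × ℕ) : ℕ × ℕ :=
  if N.p < N.m then (s.arr 13 e.1, s.arr 12 e.2) else (s.arr 13 e.2, s.arr 12 e.1)

theorem linkOf_congr {s s' : Store} (h12 : s'.arr 12 = s.arr 12) (h13 : s'.arr 13 = s.arr 13) :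
    N.linkOf s' = N.linkOf s := by
  funext e
  simp [linkOf, h12, h13]

theorem emitted_congr {s s' : Store} (h : s'.reg 4 = s.reg 4) (h4 : s'.arr 4 = s.arr 4)
    (h5 : s'.arr 5 = s.arr 5) : emitted s' = emitted s := by
  simp [emitted, h, h4, h5]

theorem emitted_emit {s : Store} (hp : s.reg 1 = N.p) (hm : s.reg 2 = N.m) :
    emitted (emit.run s) = emitted s ∪ {N.linkOf s (s.reg 19, s.reg 23)} := by
  have key : ∀ f g : ℕ → ℕ, ∀ L u v : ℕ,
      (Finset.range (L + 1)).image (fun t => (Function.update f L u t, Function.update g L v t)) =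
        (Finset.range L).image (fun t => (f t, g t)) ∪ {(u, v)} := by
    intro f g L u v
    rw [Finset.range_add_one, Finset.image_insert, Function.update_self, Function.update_self,
      Finset.union_comm, ← Finset.insert_eq]
    congr 1
    refine Finset.image_congr fun t ht => ?_
    have : t < L := by simpa using ht
    simp [Function.update_of_ne (show t ≠ L by omega)]
  by_cases hlt : N.p < N.m <;> simp [emitted, emit, linkOf, hp, hm, hlt, key]

theorem run_rotate {s : Store} {x size y : ℕ} (hx : x ≠ 16) (hx1 : x ≠ 21) (hx2 : x ≠ 22)
    (hs : 0 < size) (h21 : s.reg 22 = s.reg 21 + size) (h : s.reg x = s.reg 21 + y % size) :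
    ((rotate x).run s).reg x = s.reg 21 + (y + 1) % size := by
  rw [succ_mod hs]
  by_cases h1 : y % size + 1 = size
  · simp [rotate, h1, h, h21, hx1.symm, hx2.symm, add_assoc]
  · simp [rotate, nop, h1, h, h21, hx2.symm, hx, add_assoc]

theorem wp_emitRow {k : ℕ} {s : Store} (hD : Holds N k s) {size z : ℕ} (hs : 0 < size)
    (h22 : s.reg 22 = s.reg 21 + size) (h24 : s.reg 24 = s.reg 21 + z % size) :
    Wp emitRow s (60 * (k + 1) + 20) fun s' _ => emitted s' = emitted s ∪
      ((Finset.range (k + 1)).image fun t => (s.reg 19, s.reg 21 + (z + t) % size)).image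
        (N.linkOf s) := by
  refine .seq (.of_run rfl (by simp [Prog.bound, Expr.cost]) ?_)
  refine .seq (.of_run rfl (by simp [Prog.bound, Expr.cost]) ?_)
  refine .loop (I := fun s' v' => s'.reg 25 ≤ k + 1 ∧
    s'.reg 23 = s.reg 21 + (z + s'.reg 25) % size ∧
    emitted s' = emitted s ∪ ((Finset.range (s'.reg 25)).image
      fun t => (s.reg 19, s.reg 21 + (z + t) % size)).image (N.linkOf s) ∧
    60 * (k + 1 - s'.reg 25) + 10 ≤ v') ⟨by simp, by simpa using h24, ?_, ?_⟩ ?_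
  · simp [emitted]
  · simp [Prog.bound, Expr.cost]
  rintro s' v' hf ⟨h1, h2, h3, h4⟩
  have hD' : Holds N k s' :=
    ((hD.setReg _ (x := 23) (by simp)).setReg _ (x := 25) (by simp)).frame hf rfl rfl
  have r19 : s'.reg 19 = s.reg 19 := by rw [hf.reg 19 rfl]; simp
  have r21 : s'.reg 21 = s.reg 21 := by rw [hf.reg 21 rfl]; simp
  have r22 : s'.reg 22 = s.reg 22 := by rw [hf.reg 22 rfl]; simp
  have a12 : s'.arr 12 = s.arr 12 := by rw [hf.arr 12 rfl]; simp
  have a13 : s'.arr 13 = s.arr 13 := by rw [hf.arr 13 rfl]; simp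
  have hcost : (Test.lt (Expr.reg 25) (.succ (Expr.reg 3))).cost = 4 := rfl
  have hk := hD'.k
  rw [hcost]
  refine ⟨by omega, fun ht => ?_, fun ht => ?_⟩
  · have hlt : s'.reg 25 < k + 1 := by simpa [hk] using ht
    have hb : (emit ;; rotate 23 ;; Prog.assign 25 (.succ (.reg 25))).bound ≤ 45 := by decide
    obtain ⟨t1, -, hr1⟩ := Prog.runs_run (P := emit) rfl s'
    obtain ⟨t2, -, hr2⟩ := Prog.runs_run (P := rotate 23) rfl (emit.run s')
    have f1 := hr1.frame
    have f2 := hr2.frame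
    have hrot : ((rotate 23).run (emit.run s')).reg 23 =
        (emit.run s').reg 21 + (z + s'.reg 25 + 1) % size := by
      refine run_rotate (by simp) (by simp) (by simp) hs ?_ ?_
      · rw [f1.reg 22 rfl, f1.reg 21 rfl, r22, r21, h22]
      · rw [f1.reg 23 rfl, f1.reg 21 rfl, r21, h2]
    have h25 : ((rotate 23).run (emit.run s')).reg 25 = s'.reg 25 :=
      (f2.reg 25 rfl).trans (f1.reg 25 rfl)
    refine .of_run rfl (by omega) ⟨?_, ?_, ?_, ?_⟩
    · simp [-Prog.run, Prog.run_seq, Prog.run_assign, h25]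
      omega
    · simp [-Prog.run, Prog.run_seq, Prog.run_assign, h25, hrot, f1.reg 21 rfl, r21, add_assoc]
    · have e1 : emitted ((emit ;; rotate 23 ;; Prog.assign 25 (.succ (.reg 25))).run s') =
          emitted (emit.run s') := by
        refine emitted_congr ?_ ?_ ?_
        · simp [-Prog.run, Prog.run_seq, Prog.run_assign, f2.reg 4 rfl]
        · simp [-Prog.run, Prog.run_seq, Prog.run_assign, f2.arr 4 rfl]
        · simp [-Prog.run, Prog.run_seq, Prog.run_assign, f2.arr 5 rfl]
      have e2 : ((emit ;; rotate 23 ;; Prog.assign 25 (.succ (.reg 25))).run s').reg 25 =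
          s'.reg 25 + 1 := by
        simp [-Prog.run, Prog.run_seq, Prog.run_assign, h25]
      rw [e1, e2, emitted_emit hD'.p hD'.m, h3, linkOf_congr a12 a13, r19, h2,
        Finset.range_add_one, Finset.image_insert, Finset.image_insert, Finset.union_assoc,
        Finset.insert_eq, Finset.union_comm {_}]
    · simp [-Prog.run, Prog.run_seq, Prog.run_assign, h25]
      omega
  · have hge : s'.reg 25 = k + 1 := by
      simp [hk] at ht
      omega
    rwa [hge] at h3

theorem wp_emitBlock {k : ℕ} {s : Store} (hD : Holds N k s) {a rows size off : ℕ}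
    (h19 : s.reg 19 = a) (h20 : s.reg 20 = a + rows) (hs : 0 < rows → 0 < size)
    (h22 : 0 < rows → s.reg 22 = s.reg 21 + size)
    (h24 : 0 < rows → s.reg 24 = s.reg 21 + off % size) :
    Wp emitBlock s (rows * (60 * (k + 1) + 50) + 3) fun s' _ => emitted s' = emitted s ∪
      (linkBlock a rows (s.reg 21) size off (k + 1)).image (N.linkOf s) := by
  refine .loop (I := fun s' v' => ∃ l ≤ rows, s'.reg 19 = a + l ∧
    (l < rows → s'.reg 24 = s.reg 21 + (l + off) % size) ∧
    emitted s' = emitted s ∪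
      (linkBlock a l (s.reg 21) size off (k + 1)).image (N.linkOf s) ∧
    (rows - l) * (60 * (k + 1) + 50) + 3 ≤ v')
    ⟨0, by omega, by simpa using h19, fun h => by simpa using h24 h, by simp [linkBlock_zero],
      by simp⟩ ?_
  rintro s' v' hf ⟨l, hl, h1, h2, h3, h4⟩
  have hD' : Holds N k s' := hD.frame hf rfl rfl
  have r20 : s'.reg 20 = a + rows := by rw [hf.reg 20 rfl, h20]
  have r21 : s'.reg 21 = s.reg 21 := hf.reg 21 rfl
  have r22 : s'.reg 22 = s.reg 22 := hf.reg 22 rfl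
  have a12 : s'.arr 12 = s.arr 12 := hf.arr 12 rfl
  have a13 : s'.arr 13 = s.arr 13 := hf.arr 13 rfl
  have hcost : (Test.lt (Expr.reg 19) (Expr.reg 20)).cost = 3 := rfl
  rw [hcost]
  refine ⟨by omega, fun ht => ?_, fun ht => ?_⟩
  · have hlt : l < rows := by simpa [h1, r20] using ht
    obtain ⟨e, he⟩ : ∃ e, rows - l = e + 1 := ⟨rows - l - 1, by omega⟩
    rw [he, Nat.add_mul, one_mul] at h4
    have hsz := hs (by omega)
    have h22' : s'.reg 22 = s'.reg 21 + size := by rw [r22, r21]; exact h22 (by omega)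
    refine .seq ((wp_emitRow hD' hsz h22' (z := l + off) (by rw [r21]; exact h2 hlt)).call (by omega)
      fun s₁ f₁ hem => ?_)
    have hb : (rotate 24 ;; Prog.assign 19 (.succ (.reg 19))).bound ≤ 17 := by decide
    obtain ⟨t2, -, hr2⟩ := Prog.runs_run (P := rotate 24) rfl s₁
    have f2 := hr2.frame
    have hrot : ((rotate 24).run s₁).reg 24 = s₁.reg 21 + (l + off + 1) % size := by
      refine run_rotate (by simp) (by simp) (by simp) hsz ?_ ?_
      · rw [f₁.reg 22 rfl, f₁.reg 21 rfl, h22']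
      · rw [f₁.reg 24 rfl, f₁.reg 21 rfl, r21]; exact h2 hlt
    have h19' : ((rotate 24).run s₁).reg 19 = a + l := by
      rw [f2.reg 19 rfl, f₁.reg 19 rfl, h1]
    refine .of_run rfl (by omega) ⟨l + 1, hlt, ?_, fun _ => ?_, ?_, ?_⟩
    · simp [-Prog.run, Prog.run_seq, Prog.run_assign, h19', add_assoc]
    · simp only [Prog.run_seq, Prog.run_assign, Store.reg_setReg]
      rw [if_neg (by simp), hrot, f₁.reg 21 rfl, r21, add_right_comm]
    · have e1 : emitted ((rotate 24 ;; Prog.assign 19 (.succ (.reg 19))).run s₁) =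
          emitted s₁ := by
        refine emitted_congr ?_ ?_ ?_
        · simp [-Prog.run, Prog.run_seq, Prog.run_assign, f2.reg 4 rfl]
        · simp [-Prog.run, Prog.run_seq, Prog.run_assign, f2.arr 4 rfl]
        · simp [-Prog.run, Prog.run_seq, Prog.run_assign, f2.arr 5 rfl]
      rw [e1, hem, h3, linkOf_congr a12 a13, h1, r21, linkBlock_succ, Finset.image_union,
        Finset.union_assoc]
    · rw [show rows - (l + 1) = e by omega]
      omega
  · have hge : l = rows := by
      simp [h1, r20] at ht
      omega
    rwa [hge] at h3

theorem wp_output {k : ℕ} {s : Store} (hD : Holds N k s) {r w : ℕ} (h6 : s.reg 6 = r)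
    (h7 : s.reg 7 = w) (hrw : r + w = min N.p N.m) (hq : 0 < min N.p N.m) (hr : r = 0 ∨ 2 ≤ r)
    (h4 : s.reg 4 = 0) :
    Wp output s (max N.p N.m * (60 * (k + 1) + 50) + 60) fun s' _ => emitted s' =
      (linkBlock 0 r 0 r 1 (k + 1) ∪ linkBlock r (max N.p N.m - r) (if 0 < w then r else 0)
        (if 0 < w then w else r) 0 (k + 1)).image (N.linkOf s) := by
  have hb1 : emitCore.bound ≤ 15 := by decide
  have hb2 : emitExtra.bound ≤ 25 := by decide
  have hrR : r + (max N.p N.m - r) = max N.p N.m := by omega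
  have hsum : max N.p N.m * (60 * (k + 1) + 50) = r * (60 * (k + 1) + 50) +
      (max N.p N.m - r) * (60 * (k + 1) + 50) := by rw [← Nat.add_mul, hrR]
  obtain ⟨t1, -, hr1⟩ := Prog.runs_run (P := emitCore) rfl s
  have f1 := hr1.frame
  refine .seq (.of_run rfl (by omega) ?_)
  have hblock := wp_emitBlock (hD.frame f1 rfl rfl) (a := 0) (rows := r) (size := r) (off := 1)
    (by simp [emitCore]) (by simp [emitCore, h6]) id (fun _ => by simp [emitCore, h6])
    (fun h => by simp [emitCore, Nat.mod_eq_of_lt (show 1 < r by omega)])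
  refine .seq (hblock.call (by omega) fun s₁ f₁ hem => ?_)
  have hD₁ : Holds N k s₁ := (hD.frame f1 rfl rfl).frame f₁ rfl rfl
  have g6 : s₁.reg 6 = r := by rw [f₁.reg 6 rfl, f1.reg 6 rfl, h6]
  have g7 : s₁.reg 7 = w := by rw [f₁.reg 7 rfl, f1.reg 7 rfl, h7]
  have a12 : s₁.arr 12 = s.arr 12 := by rw [f₁.arr 12 rfl, f1.arr 12 rfl]
  have a13 : s₁.arr 13 = s.arr 13 := by rw [f₁.arr 13 rfl, f1.arr 13 rfl]
  obtain ⟨t2, -, hr2⟩ := Prog.runs_run (P := emitExtra) rfl s₁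
  have f2 := hr2.frame
  have h21 : (emitExtra.run s₁).reg 21 = if 0 < w then r else 0 := by
    by_cases hw : 0 < w <;> simp [emitExtra, nop, hw, g6, g7]
  have h24 : (emitExtra.run s₁).reg 24 = if 0 < w then r else 0 := by
    by_cases hw : 0 < w <;> simp [emitExtra, nop, hw, g6, g7]
  have h22 : (emitExtra.run s₁).reg 22 = min N.p N.m := by
    rw [← hD₁.q]
    by_cases hw : 0 < w <;> simp [emitExtra, nop, hw, g6, g7]
  have h19 : (emitExtra.run s₁).reg 19 = r := by
    by_cases hw : 0 < w <;> simp [emitExtra, nop, hw, g6, g7]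
  have h20 : (emitExtra.run s₁).reg 20 = max N.p N.m := by
    rw [← hD₁.R]
    by_cases hw : 0 < w <;> simp [emitExtra, nop, hw, g6, g7]
  refine .seq (.of_run rfl (by omega) ?_)
  have hblock₂ := wp_emitBlock (hD₁.frame f2 rfl rfl) (a := r) (rows := max N.p N.m - r)
    (size := if 0 < w then w else r) (off := 0) h19 (by rw [h20, hrR])
    (fun _ => by split_ifs <;> omega) (fun _ => by rw [h22, h21]; split_ifs <;> omega)
    (fun _ => by rw [h24, h21, Nat.zero_mod, add_zero])
  refine hblock₂.call (by omega) fun s₂ f₂ hem₂ => ?_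
  have hcore : (emitCore.run s).reg 21 = 0 := by simp [emitCore]
  rw [hem₂, emitted_congr (f2.reg 4 rfl) (f2.arr 4 rfl) (f2.arr 5 rfl), hem,
    emitted_congr (f1.reg 4 rfl) (f1.arr 4 rfl) (f1.arr 5 rfl),
    linkOf_congr (f1.arr 12 rfl) (f1.arr 13 rfl),
    linkOf_congr ((f2.arr 12 rfl).trans a12) ((f2.arr 13 rfl).trans a13), h21, hcore,
    Finset.image_union]
  simp [emitted, h4]

end Net
end ResilientControl

namespace ResilientControl

/-! ### The complete program -/

namespace Machine

/-- The actuators and the sensors are listed, matched ones first and in corresponding order. -/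
def order : Prog := listMatched ;; listFree 1 8 12 ;; listFree 2 7 13

/-- The complete program: a matching found in at most `2 k + 2` phases, and links made from it. -/
def program : Prog := (encode ;; setSizes) ;; findMatching ;; order ;; output

end Machine

open Machine

namespace Net
variable {N : Net}

theorem wp_order {k : ℕ} {s : Store} (hD : Holds N k s) (hV : N.Valid (s.arr 8) (s.arr 7))
    (hcard : N.matched (s.arr 8) = s.reg 6) :
    Wp order s (80 * N.p + 40 * N.m + 60) fun s' _ =>
      (∀ l < s.reg 6, s'.arr 12 l < N.p ∧ s.arr 8 (s'.arr 12 l) = s'.arr 13 l + 1) ∧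
      ((∀ l < N.p, s'.arr 12 l < N.p) ∧
        ∀ l < N.p, ∀ l' < N.p, s'.arr 12 l = s'.arr 12 l' → l = l') ∧
      (∀ l < N.m, s'.arr 13 l < N.m) ∧
        ∀ l < N.m, ∀ l' < N.m, s'.arr 13 l = s'.arr 13 l' → l = l' := by
  refine .seq ((wp_listMatched hD hcard).call (by omega) fun s₁ f₁ h₁ => ?_)
  have hD₁ : Holds N k s₁ := hD.frame f₁ rfl rfl
  have h6 : s₁.reg 6 = s.reg 6 := f₁.reg 6 rfl
  have h8 : s₁.arr 8 = s.arr 8 := f₁.arr 8 rfl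
  refine .seq ((wp_listFree (bnd := 1) (mate := 8) (ord := 12) hD₁.p (by simp) (by simp) (by simp)
    (by simp) (by rw [h8, h6]; exact hcard) ?_ ?_).call (by omega) fun s₂ f₂ h₂ => ?_)
  · intro l hl
    rw [h6] at hl
    rw [h8]
    exact ⟨(h₁.1 l hl).1, by rw [(h₁.1 l hl).2]; omega⟩
  · intro l hl l' hl'
    rw [h6] at hl hl'
    exact h₁.2 l hl l' hl'
  have hD₂ : Holds N k s₂ := hD₁.frame f₂ rfl rfl
  have h6' : s₂.reg 6 = s.reg 6 := (f₂.reg 6 rfl).trans h6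
  have h7 : s₂.arr 7 = s.arr 7 := (f₂.arr 7 rfl).trans (f₁.arr 7 rfl)
  have h13 : s₂.arr 13 = s₁.arr 13 := f₂.arr 13 rfl
  rw [h6] at h₂
  refine (wp_listFree (bnd := 2) (mate := 7) (ord := 13) hD₂.m (by simp) (by simp) (by simp)
    (by simp) (by rw [h7, h6', hV.card_sensors, hcard]) ?_ ?_).call (by omega) fun s₃ f₃ h₃ => ?_
  · intro l hl
    rw [h6'] at hl
    rw [h7, h13]
    obtain ⟨g1, g2⟩ := h₁.1 l hl
    obtain ⟨g3, g4, -⟩ := hV.A _ g1 _ g2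
    exact ⟨g3, by omega⟩
  · intro l hl l' hl' he
    rw [h6'] at hl hl'
    rw [h13] at he
    obtain ⟨g1, g2⟩ := h₁.1 l hl
    obtain ⟨g1', g2'⟩ := h₁.1 l' hl'
    have g3 := (hV.A _ g1 _ g2).2.1
    have g3' := (hV.A _ g1' _ g2').2.1
    rw [he] at g3
    exact h₁.2 l hl l' hl' (by omega)
  rw [h6'] at h₃
  rw [f₃.arr 12 rfl]
  refine ⟨fun l hl => ?_, h₂.2, h₃.2⟩
  rw [h₂.1 l hl, h₃.1 l hl, h13]
  exact h₁.1 l hl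

/-- The links in the final store are right: they come from orders `oA` and `oS` of the actuators and the sensors
which begin with `r` matched pairs; `w` vertices of the smaller side are free. If `r = 0`, all
links are made. -/
def Correct (N : Net) (k : ℕ) (s : Store) : Prop :=
  ∃ (oA oS : ℕ → ℕ) (r w : ℕ), r + w = min N.p N.m ∧
    (∀ l < N.p, oA l < N.p) ∧ (∀ l < N.p, ∀ l' < N.p, oA l = oA l' → l = l') ∧
    (∀ l < N.m, oS l < N.m) ∧ (∀ l < N.m, ∀ l' < N.m, oS l = oS l' → l = l') ∧
    emitted s = (linkBlock 0 r 0 r 1 (k + 1) ∪ linkBlock r (max N.p N.m - r)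
      (if 0 < w then r else 0) (if 0 < w then w else r) 0 (k + 1)).image
        (fun e => if N.p < N.m then (oS e.1, oA e.2) else (oS e.2, oA e.1)) ∧
    ((k + 1 = min N.p N.m ∧ r = 0) ∨
      (k + 2 ≤ r ∧ (w = 0 ∨ k + 1 ≤ w) ∧ (∀ l < r, N.Reach (N.b (oA l)) (N.c (oS l))) ∧
        (∀ i < N.p, ∃ l < r, N.Reach (N.b i) (N.c (oS l))) ∧
        ∀ j < N.m, ∃ l < r, N.Reach (N.b (oA l)) (N.c j)))

/-- A bound for the number of steps of the program. -/
def totalCost (N : Net) (k : ℕ) : ℕ :=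
  20 * N.m + 50 + ((2 * k + 2) * (N.phaseCost + 40) + 3 + ((80 * N.p + 40 * N.m + 60) +
    (max N.p N.m * (60 * (k + 1) + 50) + 60)))

theorem wp_program {k : ℕ} {s : Store} (hI : N.Input k s) (hst : N.st 0 = 0)
    (hq : k + 1 ≤ min N.p N.m)
    (hsnk : ∀ x < N.n, ∃ j < N.m, N.Reach x (N.c j))
    (hsrc : ∀ y < N.n, ∃ i < N.p, N.Reach (N.b i) y)
    {M : Finset (ℕ × ℕ)} (hM : ∀ e ∈ M, e.1 < N.p ∧ e.2 < N.m ∧ N.Reach (N.b e.1) (N.c e.2))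
    (hM₁ : ∀ e ∈ M, ∀ e' ∈ M, e.1 = e'.1 → e = e') (hM₂ : ∀ e ∈ M, ∀ e' ∈ M, e.2 = e'.2 → e = e')
    (hMcard : M.card = min N.p N.m) :
    Wp program s (N.totalCost k) fun s' _ => N.Correct k s' := by
  refine .seq (wp_encode_setSizes (v := (2 * k + 2) * (N.phaseCost + 40) + 3 +
    ((80 * N.p + 40 * N.m + 60) + (max N.p N.m * (60 * (k + 1) + 50) + 60))) hI
    fun s₁ hD₁ h7 h8 h4 h6 hr7 hr8 => ?_)
  have hV₁ : N.Valid (s₁.arr 8) (s₁.arr 7) :=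
    ⟨fun i _ j h => by rw [h8] at h; omega, fun j _ i h => by rw [h7] at h; omega⟩
  have hc₁ : N.matched (s₁.arr 8) = 0 := by simp [matched, h8]
  have hfind : Wp findMatching s₁ ((2 * k + 2) * (N.phaseCost + 40) + 3) fun s' _ =>
      N.Valid (s'.arr 8) (s'.arr 7) ∧ N.matched (s'.arr 8) = s'.reg 6 ∧
        s'.reg 6 + s'.reg 7 = min N.p N.m ∧
        ((k + 1 = min N.p N.m ∧ s'.reg 6 = 0) ∨ N.MatchResult k s') := by
    by_cases hlt : k + 1 < min N.p N.m
    · rw [if_pos hlt] at hr8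
      exact (wp_findMatching hD₁ hst hV₁ hc₁ h6 hr7 hr8 hlt hsnk hsrc hM hM₁ hM₂ hMcard).mono
        fun s' _ _ h => ⟨h.valid, h.card, h.add, Or.inr h⟩
    · rw [if_neg hlt] at hr8
      refine .loop (I := fun s' v' => s' = s₁ ∧ 3 ≤ v') ⟨rfl, by omega⟩ ?_
      rintro s' v' - ⟨rfl, hv⟩
      exact ⟨hv, fun ht => by simp [hr8] at ht, fun _ =>
        ⟨hV₁, by rw [hc₁, h6], by rw [h6, hr7, zero_add], Or.inl ⟨by omega, h6⟩⟩⟩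
  refine .seq (hfind.call (by omega) fun s₂ f₂ ⟨hV₂, hc₂, hadd, hres⟩ => ?_)
  have hD₂ : Holds N k s₂ := hD₁.frame f₂ rfl rfl
  refine .seq ((wp_order hD₂ hV₂ hc₂).call (by omega) fun s₃ f₃ ⟨o1, o2, o3⟩ => ?_)
  have hD₃ : Holds N k s₃ := hD₂.frame f₃ rfl rfl
  have hr : s₂.reg 6 = 0 ∨ 2 ≤ s₂.reg 6 := by
    rcases hres with h | h
    · exact Or.inl h.2
    · have := h.size
      omega
  have h4' : s₃.reg 4 = 0 := by rw [f₃.reg 4 rfl, f₂.reg 4 rfl, h4]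
  refine (wp_output hD₃ (f₃.reg 6 rfl) (f₃.reg 7 rfl) hadd (by omega) hr h4').call (by omega)
    fun s₄ f₄ h₄ => ?_
  refine ⟨s₃.arr 12, s₃.arr 13, s₂.reg 6, s₂.reg 7, hadd, o2.1, o2.2, o3.1, o3.2, h₄, ?_⟩
  refine hres.imp id fun h => ?_
  have hinj : ∀ l < s₂.reg 6, ∀ l' < s₂.reg 6, s₃.arr 12 l = s₃.arr 12 l' → l = l' :=
    fun l hl l' hl' => o2.2 l (by omega) l' (by omega)
  -- all matched actuators are among the first ones, since there are as many
  have hall : ∀ i < N.p, s₂.arr 8 i ≠ 0 → ∃ l < s₂.reg 6, s₃.arr 12 l = i := by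
    have heq : (Finset.range (s₂.reg 6)).image (s₃.arr 12) =
        (Finset.range N.p).filter fun i => s₂.arr 8 i ≠ 0 := by
      refine Finset.eq_of_subset_of_card_le ?_ ?_
      · intro i hi
        obtain ⟨l, hl, rfl⟩ := Finset.mem_image.mp hi
        obtain ⟨g1, g2⟩ := o1 l (Finset.mem_range.mp hl)
        exact Finset.mem_filter.mpr ⟨Finset.mem_range.mpr g1, by rw [g2]; omega⟩
      · rw [Finset.card_image_of_injOn, Finset.card_range]
        · exact hc₂.le
        · intro l hl l' hl' he
          exact hinj l (by simpa using hl) l' (by simpa using hl') he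
    intro i hi h0
    have : i ∈ (Finset.range (s₂.reg 6)).image (s₃.arr 12) := by
      rw [heq]
      exact Finset.mem_filter.mpr ⟨Finset.mem_range.mpr hi, h0⟩
    obtain ⟨l, hl, rfl⟩ := Finset.mem_image.mp this
    exact ⟨l, Finset.mem_range.mp hl, rfl⟩
  refine ⟨h.size, h.rest, fun l hl => ?_, fun i hi => ?_, fun j hj => ?_⟩
  · obtain ⟨g1, g2⟩ := o1 l hl
    exact (hV₂.A _ g1 _ g2).2.2
  · obtain ⟨j, hj, hmj, hreach⟩ := h.sensor i hi
    obtain ⟨i', hi'⟩ := Nat.exists_eq_succ_of_ne_zero hmj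
    obtain ⟨g1, g2⟩ := hV₂.S j hj i' hi'
    obtain ⟨l, hl, rfl⟩ := hall i' g1 (by omega)
    have := (o1 l hl).2
    exact ⟨l, hl, by rwa [show s₃.arr 13 l = j by omega]⟩
  · obtain ⟨i, hi, hmi, hreach⟩ := h.actuator j hj
    obtain ⟨l, hl, rfl⟩ := hall i hi hmi
    exact ⟨l, hl, hreach⟩

end Net

/-! ### The input -/

section

variable {n p m : ℕ} {Abar : Matrix (Fin n) (Fin n) Bool} {b : Fin p → Fin n} {c : Fin m → Fin n}

theorem adjacency_eq {v : ℕ} (hv : v ≤ n) : adjacency Abar v = (List.range v).flatMap fun x =>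
    if h : x < n then (successors Abar ⟨x, h⟩).map Fin.val else [] := by
  have h1 : List.range v = ((List.finRange n).filter fun x => x.val < v).map Fin.val := by
    have h2 : (List.range n).filter (fun x => decide (x < v)) = List.range v := by
      obtain ⟨e, rfl⟩ := Nat.exists_eq_add_of_le hv
      rw [List.range_add, List.filter_append, List.filter_eq_self.mpr, List.filter_eq_nil_iff.mpr,
        List.append_nil]
      · simp
      · simp
    rw [← h2, ← List.map_coe_finRange_eq_range, List.filter_map]
    rfl
  rw [h1, List.flatMap_map, adjacency]
  simp

theorem adjacency_succ (x : Fin n) : adjacency Abar (x.val + 1) =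
    adjacency Abar x.val ++ (successors Abar x).map Fin.val := by
  rw [adjacency_eq x.2, adjacency_eq x.2.le, List.range_succ, List.flatMap_append]
  simp

theorem adjacency_prefix {v : ℕ} (hv : v ≤ n) : ∃ l, adjacency Abar n = adjacency Abar v ++ l := by
  obtain ⟨e, he⟩ := Nat.exists_eq_add_of_le hv
  rw [adjacency_eq le_rfl, adjacency_eq hv]
  conv => enter [1, l, 1, 2]; rw [he]
  rw [List.range_add, List.flatMap_append]
  exact ⟨_, rfl⟩

theorem getD_adjacency (x : Fin n) {t : ℕ} (h : t < (successors Abar x).length) :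
    (adjacency Abar n).getD ((adjacency Abar x.val).length + t) 0 =
      ((successors Abar x)[t]).val := by
  obtain ⟨l, hl⟩ := adjacency_prefix (Abar := Abar) (v := x.val + 1) x.2
  rw [hl, adjacency_succ, List.getD_append _ _ _ _ (by simp; omega),
    List.getD_append_right _ _ _ _ (by omega), Nat.add_sub_cancel_left, List.getD_eq_getElem _ _ (by simpa using h)]
  simp

theorem length_adjacency_le : (adjacency Abar n).length ≤ numNonzero Abar := by
  have h1 : ∀ x : Fin n, (successors Abar x).length =
      (Finset.univ.filter fun y => Abar y x = true).card := by
    intro x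
    simp [successors, Finset.card, Finset.filter, Finset.univ, Fintype.elems]
  have h2 : (adjacency Abar n).length = ∑ x : Fin n, (successors Abar x).length := by
    rw [adjacency]
    simp [List.length_flatMap, Fin.sum_univ_def]
  rw [h2, numNonzero, Finset.card_filter, Fintype.sum_prod_type_right]
  simp_rw [h1, Finset.card_filter]
  exact le_rfl

end
end ResilientControl

namespace ResilientControl

section

variable {n p m : ℕ} {Abar : Matrix (Fin n) (Fin n) Bool} {b : Fin p → Fin n} {c : Fin m → Fin n}

/-- The start of the list of state `v` among the adjacency lists. -/
def offset (Abar : Matrix (Fin n) (Fin n) Bool) (v : ℕ) : ℕ :=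
  if v ≤ n then (adjacency Abar v).length else 0

theorem offset_succ (x : Fin n) :
    offset Abar (x.val + 1) = offset Abar x.val + (successors Abar x).length := by
  have h : x.val + 1 ≤ n := x.2
  rw [offset, offset, if_pos h, if_pos x.2.le, adjacency_succ]
  simp

theorem mem_successors {x y : Fin n} : y ∈ successors Abar x ↔ Abar y x = true := by
  simp [successors]

theorem exists_successor (x : Fin n) {t : ℕ} (h1 : offset Abar x.val ≤ t)
    (h2 : t < offset Abar (x.val + 1)) :
    ∃ y : Fin n, Abar y x = true ∧ (adjacency Abar n).getD t 0 = y.val := by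
  rw [offset_succ] at h2
  obtain ⟨e, rfl⟩ := Nat.exists_eq_add_of_le h1
  have he : e < (successors Abar x).length := by omega
  refine ⟨(successors Abar x)[e], mem_successors.mp (List.getElem_mem he), ?_⟩
  rw [← getD_adjacency x he, offset, if_pos x.2.le]

theorem exists_position {x y : Fin n} (h : Abar y x = true) :
    ∃ t, offset Abar x.val ≤ t ∧ t < offset Abar (x.val + 1) ∧
      (adjacency Abar n).getD t 0 = y.val := by
  obtain ⟨e, he, hy⟩ := List.getElem_of_mem (mem_successors.mpr h)
  refine ⟨offset Abar x.val + e, by omega, by rw [offset_succ]; omega, ?_⟩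
  rw [offset, if_pos x.2.le, getD_adjacency x he, hy]

/-- The data in the input. -/
def inputNet (Abar : Matrix (Fin n) (Fin n) Bool) (b : Fin p → Fin n)
    (hc : Function.Injective c) : Net where
  n := n
  p := p
  m := m
  st := offset Abar
  adj t := (adjacency Abar n).getD t 0
  b i := if h : i < p then (b ⟨i, h⟩).val else 0
  c j := if h : j < m then (c ⟨j, h⟩).val else 0
  b_lt i hi := by simp [hi]
  c_lt j hj := by simp [hj]
  c_inj j hj j' hj' h := by
    simp only [hj, hj', dif_pos] at h
    simpa using hc (Fin.ext h)
  adj_lt x hx t h1 h2 := by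
    obtain ⟨y, -, hy⟩ := exists_successor ⟨x, hx⟩ h1 h2
    rw [hy]
    exact y.2
  st_le x hx := by
    have := offset_succ (Abar := Abar) ⟨x, hx⟩
    simp only at this
    omega

variable {hc : Function.Injective c}

theorem inputNet_b (i : Fin p) : (inputNet Abar b hc).b i.val = (b i).val := by
  simp [inputNet]

theorem inputNet_c (j : Fin m) : (inputNet Abar b hc).c j.val = (c j).val := by
  simp [inputNet]

theorem inputNet_reach_iff {x y : Fin n} :
    (inputNet Abar b hc).Reach x.val y.val ↔ StateReach Abar x y := by
  constructor
  · have key : ∀ z, (inputNet Abar b hc).Reach x.val z →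
        ∃ y : Fin n, y.val = z ∧ StateReach Abar x y := by
      intro z hz
      induction hz with
      | refl => exact ⟨x, rfl, .refl⟩
      | tail _ he ih =>
        obtain ⟨y, rfl, hy⟩ := ih
        obtain ⟨-, t, h1, h2, rfl⟩ := he
        obtain ⟨y', h3, h4⟩ := exists_successor y h1 h2
        exact ⟨y', h4.symm, hy.tail h3⟩
    intro h
    obtain ⟨y', h1, h2⟩ := key _ h
    rwa [← Fin.ext h1]
  · intro h
    refine h.lift (fun x : Fin n => x.val) fun x y hxy => ?_
    obtain ⟨t, h1, h2, h3⟩ := exists_position hxy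
    exact ⟨x.2, t, h1, h2, h3⟩

theorem inputNet_input (k : ℕ) :
    (inputNet Abar b hc).Input k (inputStore Abar b c k) := by
  refine ⟨rfl, rfl, rfl, rfl, fun x hx => ?_, rfl, rfl, rfl, rfl, fun a i ha => ?_⟩
  · obtain ⟨e, rfl⟩ := Nat.exists_eq_add_of_le' hx
    rfl
  · obtain ⟨e, rfl⟩ := Nat.exists_eq_add_of_le' ha
    rfl

theorem totalCost_le (hn : 0 < n) (k : ℕ) :
    (inputNet Abar b hc).totalCost k ≤
      2000 * ((k + 1) * (numVertices n p m + numEdges Abar b c)) := by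
  have hst : (inputNet Abar b hc).st (inputNet Abar b hc).n ≤ numEdges Abar b c := by
    have : offset Abar n ≤ numNonzero Abar := by
      rw [offset, if_pos le_rfl]
      exact length_adjacency_le
    exact this.trans (by unfold numEdges; omega)
  have h1 : (inputNet Abar b hc).phaseCost + 40 ≤
      400 * (numVertices n p m + numEdges Abar b c) := by
    unfold Net.phaseCost numVertices
    have e1 : (inputNet Abar b hc).n = n := rfl
    have e2 : (inputNet Abar b hc).p = p := rfl
    omega
  have e2 : (inputNet Abar b hc).p = p := rfl
  have e3 : (inputNet Abar b hc).m = m := rfl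
  unfold Net.totalCost
  rw [e2, e3]
  set S := numVertices n p m + numEdges Abar b c with hS
  have h2 : max p m ≤ S := by
    unfold numVertices at hS
    omega
  have h3 : n + p + m ≤ S := by
    unfold numVertices at hS
    omega
  have h4 : S ≤ (k + 1) * S := Nat.le_mul_of_pos_left S (Nat.succ_pos k)
  have h5 : (2 * k + 2) * ((inputNet Abar b hc).phaseCost + 40) ≤ 800 * ((k + 1) * S) :=
    calc (2 * k + 2) * ((inputNet Abar b hc).phaseCost + 40) ≤ (2 * k + 2) * (400 * S) :=
          Nat.mul_le_mul_left _ h1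
      _ = 800 * ((k + 1) * S) := by ring
  have h6 : max p m * (60 * (k + 1) + 50) ≤ 110 * ((k + 1) * S) :=
    calc max p m * (60 * (k + 1) + 50) ≤ S * (110 * (k + 1)) :=
          Nat.mul_le_mul h2 (by omega)
      _ = 110 * ((k + 1) * S) := by ring
  omega

end

/-! ### Correctness and running time -/

theorem card_linkBlock_le (a rows base size off d : ℕ) :
    (linkBlock a rows base size off d).card ≤ rows * d := by
  refine Finset.card_image_le.trans ?_
  simp

theorem mem_linkBlock_of_full {rows size l v : ℕ} (hl : l < rows) (hv : v < size) :
    (l, v) ∈ linkBlock 0 rows 0 size 0 size := by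
  refine mem_linkBlock.mpr ⟨l, hl, (v + size - l % size) % size, Nat.mod_lt _ (by omega), ?_⟩
  have h := Nat.mod_lt l (show 0 < size by omega)
  have h2 := Nat.div_add_mod l size
  rw [add_zero, zero_add, zero_add, Nat.add_mod_mod,
    show l + (v + size - l % size) = v + size * (l / size + 1) by rw [mul_add]; omega,
    Nat.add_mul_mod_self_left, Nat.mod_eq_of_lt hv]

section

variable {n p m : ℕ} {Abar : Matrix (Fin n) (Fin n) Bool} {b : Fin p → Fin n} {c : Fin m → Fin n}

/-- What the program has computed is a sparsest resilient pattern. -/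
theorem exists_outputs_of_correct {hc' : Function.Injective c} {k : ℕ}
    (hA : HasPerfectStateMatching Abar) (hb : IsMinimumActuation Abar b)
    (hc : IsMinimumSensing Abar c) {K : Fin (k + 1) → Finset (Fin m × Fin p)}
    (hK : IsDisjointProcedureFamily Abar b c k K) (hpos : 0 < min p m) {s : Store}
    (h : (inputNet Abar b hc').Correct k s) :
    ∃ K, Outputs s K ∧ IsSparsestResilient Abar b c k K := by
  obtain ⟨oA, oS, r, w, hrw, hI, hI', hS, hS', hem, hres⟩ := h
  change r + w = min p m at hrw
  change ∀ l < p, oA l < p at hI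
  change ∀ l < p, ∀ l' < p, oA l = oA l' → l = l' at hI'
  change ∀ l < m, oS l < m at hS
  change ∀ l < m, ∀ l' < m, oS l = oS l' → l = l' at hS'
  change Net.emitted s = (linkBlock 0 r 0 r 1 (k + 1) ∪ linkBlock r (max p m - r)
    (if 0 < w then r else 0) (if 0 < w then w else r) 0 (k + 1)).image
      (fun e => if p < m then (oS e.1, oA e.2) else (oS e.2, oA e.1)) at hem
  set L := linkBlock 0 r 0 r 1 (k + 1) ∪ linkBlock r (max p m - r)
    (if 0 < w then r else 0) (if 0 < w then w else r) 0 (k + 1) with hL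
  have hbound : ∀ e ∈ L, e.1 < max p m ∧ e.2 < min p m := by
    intro e he
    rcases Finset.mem_union.mp he with he | he
    · obtain ⟨l, hl, t, -, rfl⟩ := mem_linkBlock.mp he
      have := Nat.mod_lt (l + 1 + t) (show 0 < r by omega)
      exact ⟨by simp only; omega, by simp only; omega⟩
    · obtain ⟨l, hl, t, -, rfl⟩ := mem_linkBlock.mp he
      have := Nat.mod_lt (l + 0 + t) (show 0 < if 0 < w then w else r by split_ifs <;> omega)
      refine ⟨by simp only; omega, ?_⟩
      simp only
      split_ifs at this ⊢ <;> omega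
  have hLcard : L.card ≤ (k + 1) * max p m := by
    calc L.card ≤ r * (k + 1) + (max p m - r) * (k + 1) :=
          (Finset.card_union_le _ _).trans
            (Nat.add_le_add (card_linkBlock_le ..) (card_linkBlock_le ..))
      _ = (k + 1) * max p m := by
          rw [← Nat.add_mul, show r + (max p m - r) = max p m by omega, mul_comm]
  have hembound : ∀ e ∈ Net.emitted s, e.1 < m ∧ e.2 < p := by
    intro e he
    rw [hem] at he
    obtain ⟨e', he', rfl⟩ := Finset.mem_image.mp he
    have := hbound e' he'
    split_ifs with hlt
    · exact ⟨hS _ (by omega), hI _ (by omega)⟩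
    · exact ⟨hS _ (by omega), hI _ (by omega)⟩
  set K₀ : Finset (Fin m × Fin p) :=
    Finset.univ.filter fun e => (e.1.val, e.2.val) ∈ Net.emitted s with hK₀
  have himage : Net.emitted s = K₀.image fun e => (e.1.val, e.2.val) := by
    ext e
    simp only [Finset.mem_image, hK₀, Finset.mem_filter, Finset.mem_univ, true_and]
    constructor
    · intro he
      obtain ⟨h1, h2⟩ := hembound e he
      exact ⟨(⟨e.1, h1⟩, ⟨e.2, h2⟩), he, rfl⟩
    · rintro ⟨e', he', rfl⟩
      exact he'
  refine ⟨K₀, himage, ?_⟩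
  have hval : Function.Injective fun e : Fin m × Fin p => (e.1.val, e.2.val) := by
    rintro ⟨j, i⟩ ⟨j', i'⟩ h
    simp only [Prod.mk.injEq] at h
    exact Prod.ext (Fin.ext h.1) (Fin.ext h.2)
  have hcard : K₀.card ≤ (k + 1) * max p m := by
    rw [← Finset.card_image_of_injective K₀ hval, ← himage, hem]
    exact Finset.card_image_le.trans hLcard
  rcases hres with ⟨hk, rfl⟩ | ⟨hr, hw, hpair, hout, hin⟩
  · -- every actuator is linked with every sensor, as in the union of the given family
    change k + 1 = min p m at hk
    have hmem : ∀ l < max p m, ∀ v < min p m, (l, v) ∈ L := by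
      intro l hl v hv
      refine Finset.mem_union_right _ ?_
      rw [if_pos (by omega), if_pos (by omega), hk, show w = min p m by omega, Nat.sub_zero]
      exact mem_linkBlock_of_full hl hv
    have huniv : K₀ = Finset.univ := by
      refine Finset.eq_univ_of_forall fun e => Finset.mem_filter.mpr ⟨Finset.mem_univ e, ?_⟩
      obtain ⟨l, hl, hlj⟩ := surjOn_of_injOn_iio hS hS' e.1.2
      obtain ⟨v, hv, hvi⟩ := surjOn_of_injOn_iio hI hI' e.2.2
      rw [hem]
      by_cases hlt : p < m
      · exact Finset.mem_image.mpr ⟨(l, v), hmem l (by omega) v (by omega), by simp [hlt, hlj, hvi]⟩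
      · exact Finset.mem_image.mpr ⟨(v, l), hmem v (by omega) l (by omega), by simp [hlt, hlj, hvi]⟩
    have huniv' : Finset.univ.biUnion K = Finset.univ := by
      rw [← Finset.card_eq_iff_eq_univ, hK.card, hk, min_mul_max]
      simp [mul_comm]
    have hae := hK.ae_eq_empty hA hb hc
    rw [huniv', ← huniv] at hae
    exact isSparsestResilient_of_ae hA hb hc hae hcard
  · have hcase : (r = min p m ∧ (if 0 < w then r else 0) = 0 ∧
        (if 0 < w then w else r) = min p m) ∨ ((if 0 < w then r else 0) = r ∧
          (if 0 < w then r else 0) + (if 0 < w then w else r) = min p m ∧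
            k + 1 ≤ if 0 < w then w else r) := by
      by_cases h0 : 0 < w
      · right
        rw [if_pos h0, if_pos h0]
        exact ⟨rfl, hrw, by omega⟩
      · left
        rw [if_neg h0, if_neg h0]
        exact ⟨by omega, rfl, by omega⟩
    have hrob : IsRobust (min p m) (max p m) r (k + 1) L :=
      isRobust_linkBlock (by omega) (by omega) (by omega) (by omega) hcase
    have hreach : ∀ (i : Fin p) (j : Fin m),
        (inputNet Abar b hc').Reach ((inputNet Abar b hc').b i.val)
          ((inputNet Abar b hc').c j.val) → StateReach Abar (b i) (c j) := by
      intro i j hij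
      rwa [inputNet_b, inputNet_c, inputNet_reach_iff] at hij
    have hmain : ∀ L' : Finset (ℕ × ℕ), IsRobust p m r (k + 1) L' →
        Net.emitted s = L'.image (fun e => (oS e.1, oA e.2)) →
        IsSparsestResilient Abar b c k K₀ := by
      intro L' hL' himage'
      refine isSparsestResilient_of_isRobust hA hb hc (by omega) (by omega) hL' hS hS' hI hI' ?_ ?_ ?_
        hcard (himage.symm.trans himage')
      · intro l hl i j hi hj
        exact hreach i j (by rw [hi, hj]; exact hpair l hl)
      · intro i
        obtain ⟨l, hl, hr⟩ := hout i.val i.2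
        exact ⟨l, hl, fun j hj => hreach i j (by rw [hj]; exact hr)⟩
      · intro j
        obtain ⟨l, hl, hr⟩ := hin j.val j.2
        exact ⟨l, hl, fun i hi => hreach i j (by rw [hi]; exact hr)⟩
    by_cases hlt : p < m
    · rw [min_eq_left hlt.le, max_eq_right hlt.le] at hrob
      refine hmain L hrob ?_
      rw [hem]
      simp only [hlt, if_true]
    · rw [min_eq_right (by omega), max_eq_left (by omega)] at hrob
      refine hmain _ hrob.swap ?_
      rw [hem, Finset.image_image]
      simp only [hlt, if_false]
      rfl

theorem exists_runs_program {k : ℕ} (hn : 0 < n) (hA : HasPerfectStateMatching Abar)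
    (hb : IsMinimumActuation Abar b) (hc : IsMinimumSensing Abar c)
    {K : Fin (k + 1) → Finset (Fin m × Fin p)} (hK : IsDisjointProcedureFamily Abar b c k K) :
    ∃ (s : Store) (t : ℕ) (K : Finset (Fin m × Fin p)),
      Runs Machine.program (inputStore Abar b c k) s t ∧
        t ≤ 2000 * ((k + 1) * (numVertices n p m + numEdges Abar b c)) ∧
        Outputs s K ∧ IsSparsestResilient Abar b c k K := by
  have hc' := hc.transpose.injective hA.transpose
  obtain ⟨i₀, -⟩ := hb.exists_reach ⟨0, hn⟩
  obtain ⟨j₀, -⟩ := hc.exists_reach ⟨0, hn⟩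
  have hpos : 0 < min p m := by
    have := i₀.2
    have := j₀.2
    omega
  have hq : k + 1 ≤ min p m := by
    have h1 := Finset.card_le_univ (Finset.univ.biUnion K)
    rw [hK.card, Fintype.card_prod, Fintype.card_fin, Fintype.card_fin, mul_comm m p,
      ← min_mul_max p m] at h1
    exact Nat.le_of_mul_le_mul_right h1 (by omega)
  obtain ⟨M, hM, hMcard⟩ := (hK.1 0).exists_matching
  have hval : Function.Injective fun e : Fin p × Fin m => (e.1.val, e.2.val) := by
    rintro ⟨i, j⟩ ⟨i', j'⟩ h
    simp only [Prod.mk.injEq] at h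
    exact Prod.ext (Fin.ext h.1) (Fin.ext h.2)
  obtain ⟨s, t, v, hrun, ht, hcorrect⟩ := Net.wp_program (N := inputNet Abar b hc')
    (M := M.image fun e => (e.1.val, e.2.val)) (inputNet_input k)
    (by simp [inputNet, offset, adjacency_eq (Nat.zero_le n)]) hq
    (fun x hx => by
      obtain ⟨j, hj⟩ := hc.exists_reach ⟨x, hx⟩
      exact ⟨j.val, j.2, by rw [inputNet_c]; exact inputNet_reach_iff.mpr hj⟩)
    (fun y hy => by
      obtain ⟨i, hi⟩ := hb.exists_reach ⟨y, hy⟩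
      exact ⟨i.val, i.2, by rw [inputNet_b]; exact inputNet_reach_iff.mpr hi⟩)
    (fun e he => by
      obtain ⟨e', he', rfl⟩ := Finset.mem_image.mp he
      refine ⟨e'.1.2, e'.2.2, ?_⟩
      rw [inputNet_b, inputNet_c, inputNet_reach_iff]
      exact reaches_iff.mp (hM.1 e' he'))
    (fun e₁ he₁ e₂ he₂ h => by
      obtain ⟨e, he, rfl⟩ := Finset.mem_image.mp he₁
      obtain ⟨e', he', rfl⟩ := Finset.mem_image.mp he₂
      rw [hM.2 e he e' he' (Or.inl (Fin.ext h))])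
    (fun e₁ he₁ e₂ he₂ h => by
      obtain ⟨e, he, rfl⟩ := Finset.mem_image.mp he₁
      obtain ⟨e', he', rfl⟩ := Finset.mem_image.mp he₂
      rw [hM.2 e he e' he' (Or.inr (Fin.ext h))])
    (by rw [Finset.card_image_of_injective M hval, hMcard]; rfl)
  obtain ⟨K', h1, h2⟩ := exists_outputs_of_correct hA hb hc hK hpos hcorrect
  exact ⟨s, t, K', hrun, (show t ≤ _ by omega).trans (totalCost_le hn k), h1, h2⟩

end

end ResilientControl

open ResilientControl
open scoped MeasureTheory
theorem theorem3 :
    (∀ (n p m : ℕ) (Abar : Matrix (Fin n) (Fin n) Bool) (b : Fin p → Fin n) (c : Fin m → Fin n)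
        (k : ℕ) (K : Fin (k + 1) → Finset (Fin m × Fin p)),
      HasPerfectStateMatching Abar → IsMinimumActuation Abar b → IsMinimumSensing Abar c →
      IsDisjointProcedureFamily Abar b c k K →
        IsSparsestResilient Abar b c k (Finset.univ.biUnion K) ∧
        ∀ᵐ θ : Parameters Abar (inputPattern b) (outputPattern c),
          fixedModesAt θ (Finset.univ.biUnion K) (failures k (Finset.univ.biUnion K)) = ∅) ∧
    ∃ (P : Prog) (C : ℝ),
      ∀ (n p m : ℕ) (Abar : Matrix (Fin n) (Fin n) Bool) (b : Fin p → Fin n) (c : Fin m → Fin n)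
        (k : ℕ),
      0 < n → HasPerfectStateMatching Abar → IsMinimumActuation Abar b → IsMinimumSensing Abar c →
      (∃ K : Fin (k + 1) → Finset (Fin m × Fin p), IsDisjointProcedureFamily Abar b c k K) →
        ∃ (s : Store) (t : ℕ) (K : Finset (Fin m × Fin p)),
          Runs P (inputStore Abar b c k) s t ∧ (t : ℝ) ≤ C * timeBound Abar b c k ∧
          Outputs s K ∧ IsSparsestResilient Abar b c k K := by
  refine ⟨fun n p m Abar b c k K hA hb hc h => ?_, Machine.program, 2000,
    fun n p m Abar b c k hn hA hb hc ⟨K, hK⟩ => ?_⟩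
  · have hae := h.ae_eq_empty hA hb hc
    exact ⟨isSparsestResilient_of_ae hA hb hc hae h.card.le, hae⟩
  · obtain ⟨s, t, K', h1, h2, h3, h4⟩ := exists_runs_program hn hA hb hc hK
    refine ⟨s, t, K', h1, ?_, h3, h4⟩
    calc (t : ℝ) ≤ ((2000 * ((k + 1) * (numVertices n p m + numEdges Abar b c)) : ℕ) : ℝ) := by
          exact_mod_cast h2
      _ = 2000 * (((k : ℝ) + 1) * ((numVertices n p m : ℝ) + (numEdges Abar b c : ℝ))) := by
          push_cast
          ring
      _ ≤ 2000 * timeBound Abar b c k := by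
          unfold timeBound
          gcongr
          exact le_max_left _ _
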